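/- Let $n\ge 2$ be an integer and let $\mathrm{U}_n$ be the group of unitary $n\times n$ complex matrices. Write $\mathrm{Irr}(\mathrm{U}_n)$ for the set of characters of continuous irreducible finite-dimensional complex representations of $\mathrm{U}_n$, and let $\log$ denote the logarithm to base $2$. Eigenvalues of $g\in \mathrm{U}_n$ are counted with multiplicity, so that there are $n$ of them. Given $\epsilon>0$, $g\in\mathrm{U}_n$ is called $(\gamma,\epsilon)$-separated, for $0<\gamma<\frac12$, if its eigenvalues can be divided into two parts $Q,R$ with $|Q|,|R|\ge\gamma n$ such that every element of $Q$ is at distance at least $\epsilon$ (in $\mathbb{C}$) from every element of $R$; it is called $(\beta,\epsilon)$-spread, for $0<\beta<1$, if every arc of length $2\epsilon$ of the unit circle contains at most $(1-\beta)n$ of its eigenvalues. Let $\rho\in\mathrm{Irr}(\mathrm{U}_n)$ and $g\in\mathrm{U}_n$. (1) Let $0<\gamma<\frac12$ and $\epsilon=\rho(1)^{-\gamma(1-\gamma)/n^2}$. If $\rho(1)>2^{\frac{16}{\gamma}n^2\log n}$ and $g$ is $(\gamma,\epsilon)$-separated, then $$|\rho(g)|\le\rho(1)^{1-\frac12\gamma(1-\gamma)}.$$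 (2) Let $0<\beta<1$ and $\epsilon=\rho(1)^{-\frac18\beta(2-\beta)/n^2}$. If $\rho(1)>2^{\frac{8}{\beta}n^2\log n}$ and $g$ is $(\beta,\epsilon)$-spread, then $$|\rho(g)|\le\rho(1)^{1-\frac{\beta(2-\beta)}{8}}.$$ -/

import Mathlib

/-!
Up to a power of the determinant, an irreducible representation `π` of `U n` is given by polynomials
in the matrix entries and extends to all matrices. On diagonal matrices the Casimir element acts on
the character through the Laplacian of the torus, twisted by the Vandermonde product
`Δ x = ∏ i < j, (x i - x j)`. Hence `tr π (diag x) * Δ x` is an alternating eigenfunction of that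
Laplacian; all its exponents have the same norm as the dominating one, so it is a single alternant
`det (x i ^ l j)`, which is Weyl's character formula.

Divide the eigenvalues of `g` into parts `Q` and `R`. Laplace expansion along `Q` writes the
determinant as a sum of products of two smaller ones, and each of these is at most the Vandermonde
product of its block times the dimension given by Weyl's formula for its part of the exponents. The
Vandermonde products of the blocks cancel those in `Δ x`, leaving the product of the distances
between `Q` and `R`; comparing the dimensions of the blocks with `ρ(1)` gives
`|ρ(g)| * ∏ |a - b| ≤ n ^ (2 * |Q| * |R|) * ρ(1) ^ (1 - |Q| * |R| / n ^ 2)`.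
Separation bounds the distances from below, and the lower bound on `ρ(1)` absorbs the power of `n`.

If the spectrum is spread, the lower and upper `β / 2`-quantiles of its angles are more than `2 * ε`
apart, so by pigeonhole some interval of length `2 * ε / (n + 1)` between them contains no angle.
Cutting there separates the spectrum at scale `ε ^ 2`.
-/

namespace UnitaryChar

/-- `Irr G`: the irreducible (complex) characters of the topological group `G`, that is, the
characters of its continuous finite-dimensional irreducible complex representations. Every such
representation can be realized on some `ℂ^d`. -/
def Irr (G : Type*) [Group G] [TopologicalSpace G] : Set (G → ℂ) :=
  {χ | ∃ (d : ℕ) (π : Representation ℂ G (Fin d → ℂ)),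
    π.IsIrreducible ∧ (∀ v, Continuous fun g => π g v) ∧ χ = π.character}

/-- The degree `χ(1)` of a character, as a real number. -/
def degree {G : Type*} [Group G] (χ : G → ℂ) : ℝ := (χ 1).re

/-- The degree is really the value at `1`, a natural number. -/
theorem degree_spec {G : Type*} [Group G] [TopologicalSpace G] {χ : G → ℂ} (hχ : χ ∈ Irr G) :
    ((degree χ : ℝ) : ℂ) = χ 1 ∧ ∃ d : ℕ, degree χ = d := by
  obtain ⟨d, π, -, -, rfl⟩ := hχ
  simp [degree]

/-- The unitary group `U_n`. -/
abbrev U (n : ℕ) : Type := Matrix.unitaryGroup (Fin n) ℂ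

/-- The eigenvalues of `g ∈ U_n`, as a multiset (counted with multiplicity; there are `n`). -/
noncomputable def eigenvalues {n : ℕ} (g : U n) : Multiset ℂ :=
  (g : Matrix (Fin n) (Fin n) ℂ).charpoly.roots

/-- `(γ, ε)`-separated: the eigenvalues, with multiplicity, split into two parts, each of size
at least `γ n`, at mutual distance at least `ε` in `ℂ`. -/
def IsSeparated {n : ℕ} (γ ε : ℝ) (g : U n) : Prop :=
  ∃ Q R : Multiset ℂ, Q + R = eigenvalues g ∧
    γ * n ≤ (Multiset.card Q : ℝ) ∧ γ * n ≤ (Multiset.card R : ℝ) ∧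
    ∀ a ∈ Q, ∀ b ∈ R, ε ≤ ‖a - b‖

/-- The closed arc of the unit circle that starts at the angle `a` and has length `l`. -/
def arc (a l : ℝ) : Set ℂ := (fun θ : ℝ => Complex.exp (θ * Complex.I)) '' Set.Icc a (a + l)

open Classical in
/-- `(β, ε)`-spread: every arc of length `2 ε` of the unit circle contains at most `(1 - β) n`
of the eigenvalues, counted with multiplicity. -/
def IsSpread {n : ℕ} (β ε : ℝ) (g : U n) : Prop :=
  ∀ a : ℝ, ((eigenvalues g).countP (fun z => z ∈ arc a (2 * ε)) : ℝ) ≤ (1 - β) * n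

end UnitaryChar

/-! ### Averaging over a compact group -/

namespace UnitaryChar

open MeasureTheory

section CompactGroup

variable {G : Type*} [Group G] [TopologicalSpace G]

/-- The translates `g ↦ f (h⁻¹ * g)` split into finitely many products of a function of `h` lying
in `A` and a function of `g`. -/
def HasSplitTranslates (A : Set C(G, ℂ)) (f : C(G, ℂ)) : Prop :=
  ∃ (κ : Type) (_ : Fintype κ) (a b : κ → C(G, ℂ)),
    (∀ k, a k ∈ A) ∧ ∀ h g : G, f (h⁻¹ * g) = ∑ k, a k h * b k g

theorem hasSplitTranslates_of_mem_adjoin {s : Set C(G, ℂ)}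
    (hs : ∀ f ∈ s, HasSplitTranslates (StarAlgebra.adjoin ℂ s : Set C(G, ℂ)) f) {f : C(G, ℂ)}
    (hf : f ∈ StarAlgebra.adjoin ℂ s) :
    HasSplitTranslates (StarAlgebra.adjoin ℂ s : Set C(G, ℂ)) f := by
  induction hf using StarAlgebra.adjoin_induction with
  | mem f hf => exact hs f hf
  | algebraMap r =>
    exact ⟨Unit, inferInstance, fun _ => algebraMap _ _ r, fun _ => 1,
      fun _ => algebraMap_mem _ r, fun h g => by simp [Algebra.algebraMap_eq_smul_one]⟩
  | add f₁ f₂ _ _ h₁ h₂ =>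
    obtain ⟨κ₁, _, a₁, b₁, ha₁, h₁⟩ := h₁
    obtain ⟨κ₂, _, a₂, b₂, ha₂, h₂⟩ := h₂
    exact ⟨κ₁ ⊕ κ₂, inferInstance, Sum.elim a₁ a₂, Sum.elim b₁ b₂, Sum.rec ha₁ ha₂,
      fun h g => by simp [h₁, h₂]⟩
  | mul f₁ f₂ _ _ h₁ h₂ =>
    obtain ⟨κ₁, _, a₁, b₁, ha₁, h₁⟩ := h₁
    obtain ⟨κ₂, _, a₂, b₂, ha₂, h₂⟩ := h₂
    refine ⟨κ₁ × κ₂, inferInstance, fun k => a₁ k.1 * a₂ k.2, fun k => b₁ k.1 * b₂ k.2,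
      fun k => mul_mem (ha₁ _) (ha₂ _), fun h g => ?_⟩
    rw [ContinuousMap.mul_apply, h₁, h₂, Finset.sum_mul_sum, Fintype.sum_prod_type]
    simp only [ContinuousMap.mul_apply, mul_mul_mul_comm]
  | star f _ h =>
    obtain ⟨κ, _, a, b, ha, h⟩ := h
    exact ⟨κ, inferInstance, star a, star b, fun k => star_mem (ha k), fun x g => by simp [h]⟩

section Integral

variable {X E : Type*} [TopologicalSpace X] [CompactSpace X] [MeasurableSpace X] [BorelSpace X]
  [NormedAddCommGroup E] [NormedSpace ℂ E] (μ : Measure X) [IsFiniteMeasure μ]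

theorem integrable_of_continuous {E : Type*} [NormedAddCommGroup E] {F : X → E}
    (hF : Continuous F) : Integrable F μ :=
  hF.integrable_of_hasCompactSupport (HasCompactSupport.of_compactSpace F)

theorem continuous_integral_smul {F : X → E} (hF : Continuous F) :
    Continuous fun f : C(X, ℂ) => ∫ x, f x • F x ∂μ := by
  obtain ⟨M, hM⟩ := (isCompact_range hF).isBounded.exists_norm_le
  refine (LipschitzWith.of_dist_le_mul (K := (M * μ.real Set.univ).toNNReal) fun f₁ f₂ => ?_)
    |>.continuous
  have hint (f : C(X, ℂ)) : Integrable (fun x => f x • F x) μ :=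
    integrable_of_continuous μ (f.continuous.smul hF)
  have hbound (x : X) : ‖f₁ x • F x - f₂ x • F x‖ ≤ dist f₁ f₂ * M := by
    rw [← sub_smul, norm_smul, ← dist_eq_norm]
    exact mul_le_mul (ContinuousMap.dist_apply_le_dist x) (hM _ ⟨x, rfl⟩) (norm_nonneg _)
      dist_nonneg
  calc dist (∫ x, f₁ x • F x ∂μ) (∫ x, f₂ x • F x ∂μ)
      = ‖∫ x, (f₁ x • F x - f₂ x • F x) ∂μ‖ := by
        rw [dist_eq_norm, integral_sub (hint f₁) (hint f₂)]
    _ ≤ dist f₁ f₂ * M * μ.real Set.univ :=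
        norm_integral_le_of_norm_le_const (ae_of_all _ hbound)
    _ ≤ (M * μ.real Set.univ).toNNReal * dist f₁ f₂ := by
        rw [mul_assoc, mul_comm]
        exact mul_le_mul_of_nonneg_right (Real.le_coe_toNNReal _) dist_nonneg

variable [CompleteSpace E] [μ.IsOpenPosMeasure]

theorem exists_norm_integral_smul_sub_lt {F : X → E} (hF : Continuous F) (x₀ : X) {ε : ℝ}
    (hε : 0 < ε) : ∃ f : C(X, ℂ), ‖∫ x, f x • F x ∂μ - F x₀‖ < ε := by
  let bump (x : X) : ℝ := max 0 (ε / 2 - ‖F x - F x₀‖)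
  have hbump : Continuous bump := by fun_prop
  have hbump_nonneg (x : X) : 0 ≤ bump x := le_max_left _ _
  have hpos : 0 < ∫ x, bump x ∂μ := by
    rw [integral_pos_iff_support_of_nonneg hbump_nonneg (integrable_of_continuous μ hbump)]
    exact hbump.isOpen_support.measure_pos μ ⟨x₀, by simp [bump, hε]⟩
  set c : ℝ := ∫ x, bump x ∂μ with hc
  let f : C(X, ℂ) := ⟨fun x => ((c⁻¹ * bump x : ℝ) : ℂ), by fun_prop⟩
  have hF₀ : ∫ x, f x • F x₀ ∂μ = F x₀ := by
    rw [integral_smul_const]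
    simp only [f, ContinuousMap.coe_mk]
    rw [integral_complex_ofReal, integral_const_mul, ← hc, inv_mul_cancel₀ hpos.ne']
    simp
  have hbound (x : X) : ‖f x • F x - f x • F x₀‖ ≤ c⁻¹ * bump x * (ε / 2) := by
    have hnonneg : 0 ≤ c⁻¹ * bump x := mul_nonneg (inv_nonneg.mpr hpos.le) (hbump_nonneg x)
    rw [← smul_sub, norm_smul, show ‖f x‖ = c⁻¹ * bump x by
      simp only [f, ContinuousMap.coe_mk, Complex.norm_real, Real.norm_of_nonneg hnonneg]]
    rcases le_or_gt (ε / 2) ‖F x - F x₀‖ with h | h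
    · simp [show bump x = 0 from max_eq_left (by linarith)]
    · exact mul_le_mul_of_nonneg_left h.le hnonneg
  have hint {F : X → E} (hF : Continuous F) : Integrable (fun x => f x • F x) μ :=
    integrable_of_continuous μ (f.continuous.smul hF)
  refine ⟨f, ?_⟩
  calc ‖∫ x, f x • F x ∂μ - F x₀‖
      = ‖∫ x, (f x • F x - f x • F x₀) ∂μ‖ := by
        rw [integral_sub (hint hF) (hint continuous_const), hF₀]
    _ ≤ ∫ x, c⁻¹ * bump x * (ε / 2) ∂μ :=
        norm_integral_le_of_norm_le (integrable_of_continuous μ (by fun_prop)) (ae_of_all _ hbound)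
    _ = ε / 2 := by
        rw [integral_mul_const, integral_const_mul, ← hc, inv_mul_cancel₀ hpos.ne', one_mul]
    _ < ε := half_lt_self hε

end Integral

variable [IsTopologicalGroup G] [CompactSpace G] {E : Type*} [NormedRing E] [NormedAlgebra ℂ E]

theorem mul_integral_smul_of_split [MeasurableSpace G] [BorelSpace G] (μ : Measure G)
    [IsFiniteMeasure μ] [μ.IsMulLeftInvariant] {π : G →* E} (hπ : Continuous π) {f : C(G, ℂ)}
    {κ : Type*} [Fintype κ] {a b : κ → C(G, ℂ)}
    (hab : ∀ h g : G, f (h⁻¹ * g) = ∑ k, a k h * b k g) (h : G) :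
    π h * ∫ g, f g • π g ∂μ = ∑ k, a k h • ∫ g, b k g • π g ∂μ := by
  have hint (f : C(G, ℂ)) : Integrable (fun g => f g • π g) μ :=
    integrable_of_continuous μ (f.continuous.smul hπ)
  calc π h * ∫ g, f g • π g ∂μ
      = ∫ g, f g • π (h * g) ∂μ := by
        rw [← integral_const_mul_of_integrable (hint f)]
        simp only [mul_smul_comm, map_mul]
    _ = ∫ g, f (h⁻¹ * g) • π g ∂μ := by
        rw [← integral_mul_left_eq_self (fun g => f (h⁻¹ * g) • π g) h]
        simp only [inv_mul_cancel_left]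
    _ = ∫ g, ∑ k, a k h • b k g • π g ∂μ := by simp only [hab, Finset.sum_smul, mul_smul]
    _ = ∑ k, a k h • ∫ g, b k g • π g ∂μ := by
        refine (integral_finsetSum _ fun k _ => (hint (b k)).smul (a k h)).trans ?_
        exact Finset.sum_congr rfl fun k _ => integral_smul _ _

/-- Averaging `π` against some `f ∈ A` gives an operator close to `1`, hence invertible, and
splitting the translates of `f` expresses `π h` times this operator through functions in `A`. -/
theorem exists_mem_forall_eq_apply [CompleteSpace E] (A : StarSubalgebra ℂ C(G, ℂ))
    (hA : A.topologicalClosure = ⊤)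
    (hsplit : ∀ f ∈ A, HasSplitTranslates (A : Set C(G, ℂ)) f) {π : G →* E} (hπ : Continuous π)
    (ℓ : E →ₗ[ℂ] ℂ) : ∃ f ∈ A, ∀ g, f g = ℓ (π g) := by
  borelize G
  let μ : Measure G := Measure.haar
  let avg (f : C(G, ℂ)) : E := ∫ g, f g • π g ∂μ
  obtain ⟨f, hfA, hf⟩ : ∃ f ∈ A, ‖avg f - 1‖ < 1 := by
    have hdense : Dense (A : Set C(G, ℂ)) := fun f => by
      rw [← StarSubalgebra.topologicalClosure_coe, hA]; trivial
    obtain ⟨f₀, hf₀⟩ := exists_norm_integral_smul_sub_lt μ hπ 1 one_pos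
    rw [map_one] at hf₀
    have hopen : IsOpen {f : C(G, ℂ) | ‖avg f - 1‖ < 1} :=
      isOpen_lt ((continuous_integral_smul μ hπ).sub continuous_const).norm continuous_const
    exact hdense.exists_mem_open hopen ⟨f₀, hf₀⟩
  obtain ⟨u, hu⟩ : IsUnit (avg f) := by
    rw [norm_sub_rev] at hf
    simpa only [sub_sub_cancel] using isUnit_one_sub_of_norm_lt_one hf
  obtain ⟨κ, _, a, b, ha, hab⟩ := hsplit f hfA
  have hπ_eq (h : G) : π h = ∑ k, a k h • (avg (b k) * (↑u⁻¹ : E)) := by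
    calc π h = π h * avg f * (↑u⁻¹ : E) := by rw [← hu, mul_assoc, Units.mul_inv, mul_one]
      _ = ∑ k, a k h • (avg (b k) * (↑u⁻¹ : E)) := by
        simp only [avg, mul_integral_smul_of_split μ hπ hab, Finset.sum_mul, smul_mul_assoc]
  refine ⟨∑ k, ℓ (avg (b k) * (↑u⁻¹ : E)) • a k, sum_mem fun k _ => A.smul_mem (ha k) _,
    fun h => ?_⟩
  rw [hπ_eq, map_sum, ContinuousMap.sum_apply]
  simp [mul_comm]

end CompactGroup

end UnitaryChar

/-! ### Polynomial functions on the unitary group -/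

namespace UnitaryChar

open Matrix

section EntryAlgebra

variable {ι : Type*} [Fintype ι] [DecidableEq ι]

instance compactSpace_unitaryGroup {𝕜 : Type*} [RCLike 𝕜] :
    CompactSpace (unitaryGroup ι 𝕜) := by
  have hbox : IsCompact (Set.univ.pi fun _ : ι => Set.univ.pi fun _ : ι =>
      Metric.closedBall (0 : 𝕜) 1) :=
    isCompact_univ_pi fun _ => isCompact_univ_pi fun _ => isCompact_closedBall _ _
  refine isCompact_iff_compactSpace.mp
    (hbox.of_isClosed_subset (isClosed_unitary (R := Matrix ι ι 𝕜)) fun g hg i _ j _ => ?_)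
  exact mem_closedBall_zero_iff.mpr (entry_norm_bound_of_unitary hg i j)

/-- The matrix entry `g ↦ g i j` as a continuous function on the unitary group. -/
def entry (i j : ι) : C(unitaryGroup ι ℂ, ℂ) where
  toFun g := (g : Matrix ι ι ℂ) i j
  continuous_toFun := continuous_subtype_val.matrix_elem i j

variable (ι) in
/-- The algebra of polynomials in the matrix entries and their conjugates. -/
noncomputable def entryAlgebra : StarSubalgebra ℂ C(unitaryGroup ι ℂ, ℂ) :=
  StarAlgebra.adjoin ℂ (Set.range fun q : ι × ι => entry q.1 q.2)

theorem entry_mem_entryAlgebra (i j : ι) : entry i j ∈ entryAlgebra ι :=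
  StarAlgebra.subset_adjoin _ _ ⟨(i, j), rfl⟩

theorem entryAlgebra_topologicalClosure : (entryAlgebra ι).topologicalClosure = ⊤ := by
  refine ContinuousMap.starSubalgebra_topologicalClosure_eq_top_of_separatesPoints _ ?_
  intro g h hgh
  obtain ⟨i, j, hij⟩ : ∃ i j, (g : Matrix ι ι ℂ) i j ≠ (h : Matrix ι ι ℂ) i j := by
    by_contra! heq
    exact hgh (Subtype.ext (Matrix.ext heq))
  exact ⟨entry i j, ⟨entry i j, entry_mem_entryAlgebra i j, rfl⟩, hij⟩

theorem hasSplitTranslates_of_mem_entryAlgebra {f : C(unitaryGroup ι ℂ, ℂ)}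
    (hf : f ∈ entryAlgebra ι) :
    HasSplitTranslates (entryAlgebra ι : Set C(unitaryGroup ι ℂ, ℂ)) f := by
  refine hasSplitTranslates_of_mem_adjoin ?_ hf
  rintro _ ⟨⟨i, j⟩, rfl⟩
  let e := Fintype.equivFin ι
  refine ⟨Fin (Fintype.card ι), inferInstance, fun k => star (entry (e.symm k) i),
    fun k => entry (e.symm k) j, fun k => star_mem (entry_mem_entryAlgebra _ i), fun h g => ?_⟩
  rw [e.symm.sum_comp fun k => star (entry k i) h * entry k j g]
  rfl

theorem exists_pow_mul_mem_of_mem_adjoin {R A : Type*} [CommSemiring R] [CommSemiring A]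
    [Algebra R A] {B : Subalgebra R A} {δ : A} (hδ : δ ∈ B) {s : Set A}
    (hs : ∀ x ∈ s, ∃ N : ℕ, δ ^ N * x ∈ B) {x : A} (hx : x ∈ Algebra.adjoin R s) :
    ∃ N : ℕ, δ ^ N * x ∈ B := by
  induction hx using Algebra.adjoin_induction with
  | mem x hx => exact hs x hx
  | algebraMap r => exact ⟨0, mul_mem (pow_mem hδ 0) (B.algebraMap_mem r)⟩
  | add x y _ _ hx hy =>
    obtain ⟨N₁, hx⟩ := hx
    obtain ⟨N₂, hy⟩ := hy
    refine ⟨N₁ + N₂, ?_⟩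
    have : δ ^ (N₁ + N₂) * (x + y) = δ ^ N₂ * (δ ^ N₁ * x) + δ ^ N₁ * (δ ^ N₂ * y) := by ring
    exact this ▸ add_mem (mul_mem (pow_mem hδ _) hx) (mul_mem (pow_mem hδ _) hy)
  | mul x y _ _ hx hy =>
    obtain ⟨N₁, hx⟩ := hx
    obtain ⟨N₂, hy⟩ := hy
    refine ⟨N₁ + N₂, ?_⟩
    have : δ ^ (N₁ + N₂) * (x * y) = δ ^ N₁ * x * (δ ^ N₂ * y) := by ring
    exact this ▸ mul_mem hx hy

theorem exists_forall_pow_mul_mem {R A κ : Type*} [CommSemiring R] [CommSemiring A]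
    [Algebra R A] [Finite κ] {B : Subalgebra R A} {δ : A} (hδ : δ ∈ B) {x : κ → A}
    (hx : ∀ k, ∃ N : ℕ, δ ^ N * x k ∈ B) : ∃ N : ℕ, ∀ k, δ ^ N * x k ∈ B := by
  have := Fintype.ofFinite κ
  choose N hN using hx
  refine ⟨Finset.univ.sup N, fun k => ?_⟩
  rw [← Nat.sub_add_cancel (Finset.le_sup (Finset.mem_univ k)), pow_add, mul_assoc]
  exact mul_mem (pow_mem hδ _) (hN k)

theorem adjugate_eq_det_smul_star (g : unitaryGroup ι ℂ) :
    (g : Matrix ι ι ℂ).adjugate = (g : Matrix ι ι ℂ).det • star (g : Matrix ι ι ℂ) := by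
  calc (g : Matrix ι ι ℂ).adjugate
      = (g : Matrix ι ι ℂ).adjugate * g * star (g : Matrix ι ι ℂ) := by
        rw [mul_assoc, mem_unitaryGroup_iff.mp g.2, mul_one]
    _ = _ := by rw [adjugate_mul, Matrix.smul_mul, one_mul]

variable (ι) in
/-- The algebra of polynomial functions of the matrix entries, without conjugates. -/
noncomputable def polynomialFunctions : Subalgebra ℂ C(unitaryGroup ι ℂ, ℂ) :=
  (MvPolynomial.aeval fun q : ι × ι => entry q.1 q.2).range

theorem aeval_entry_apply (p : MvPolynomial (ι × ι) ℂ) (g : unitaryGroup ι ℂ) :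
    MvPolynomial.aeval (fun q : ι × ι => entry q.1 q.2) p g =
      MvPolynomial.eval (fun q => (g : Matrix ι ι ℂ) q.1 q.2) p := by
  induction p using MvPolynomial.induction_on with
  | C r => rw [MvPolynomial.aeval_C, MvPolynomial.eval_C, algebraMap_apply]; simp
  | add p q hp hq => rw [map_add, map_add, ContinuousMap.add_apply, hp, hq]
  | mul_X p q hp =>
    rw [map_mul, map_mul, ContinuousMap.mul_apply, hp, MvPolynomial.aeval_X, MvPolynomial.eval_X]
    rfl

variable (ι) in
/-- The determinant as a continuous function on the unitary group. -/
noncomputable def detFunction : C(unitaryGroup ι ℂ, ℂ) :=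
  ⟨fun g => (g : Matrix ι ι ℂ).det, continuous_subtype_val.matrix_det⟩

theorem detFunction_mem_polynomialFunctions : detFunction ι ∈ polynomialFunctions ι := by
  refine ⟨(mvPolynomialX ι ι ℂ).det, ContinuousMap.ext fun g => ?_⟩
  exact (aeval_entry_apply _ g).trans (by rw [RingHom.map_det, mvPolynomialX_mapMatrix_eval]; rfl)

/-- On the unitary group, conjugate entries are cofactors divided by the determinant. -/
theorem detFunction_mul_star_entry_mem (i j : ι) :
    detFunction ι * star (entry i j) ∈ polynomialFunctions ι := by
  refine ⟨(mvPolynomialX ι ι ℂ).adjugate j i, ContinuousMap.ext fun g => ?_⟩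
  have hadj := congrFun₂ (RingHom.map_adjugate
    (MvPolynomial.eval fun q => (g : Matrix ι ι ℂ) q.1 q.2) (mvPolynomialX ι ι ℂ)) j i
  rw [mvPolynomialX_mapMatrix_eval, adjugate_eq_det_smul_star] at hadj
  exact (aeval_entry_apply _ g).trans hadj

theorem exists_detFunction_pow_mul_mem {f : C(unitaryGroup ι ℂ, ℂ)} (hf : f ∈ entryAlgebra ι) :
    ∃ N : ℕ, detFunction ι ^ N * f ∈ polynomialFunctions ι := by
  rw [entryAlgebra, ← StarSubalgebra.mem_toSubalgebra, StarAlgebra.adjoin_toSubalgebra] at hf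
  refine exists_pow_mul_mem_of_mem_adjoin detFunction_mem_polynomialFunctions ?_ hf
  rintro f (⟨⟨i, j⟩, rfl⟩ | ⟨⟨i, j⟩, hij⟩)
  · exact ⟨0, MvPolynomial.X (i, j), by rw [pow_zero, one_mul]; exact MvPolynomial.aeval_X _ _⟩
  · obtain rfl : f = star (entry i j) := (star_eq_iff_star_eq.mp hij.symm).symm
    exact ⟨1, by rw [pow_one]; exact detFunction_mul_star_entry_mem i j⟩

end EntryAlgebra

section PolyEval

variable {ι κ : Type*}

/-- The value at the matrix `X` of a matrix `P` of polynomials in the entries of `X`. -/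
noncomputable def polyEval (P : Matrix κ κ (MvPolynomial (ι × ι) ℂ)) (X : Matrix ι ι ℂ) :
    Matrix κ κ ℂ :=
  P.map (MvPolynomial.eval fun q => X q.1 q.2)

variable [Fintype ι] [DecidableEq ι] [Fintype κ] [DecidableEq κ]

theorem exists_polyEval_eq_det_pow_smul (π : Representation ℂ (unitaryGroup ι ℂ) (κ → ℂ))
    (hπ : ∀ v, Continuous fun g => π g v) :
    ∃ (N : ℕ) (P : Matrix κ κ (MvPolynomial (ι × ι) ℂ)), ∀ g : unitaryGroup ι ℂ,
      polyEval P g = (g : Matrix ι ι ℂ).det ^ N • LinearMap.toMatrix' (π g) := by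
  let Φ : unitaryGroup ι ℂ →* ((κ → ℂ) →L[ℂ] (κ → ℂ)) :=
    ((Module.End.toContinuousLinearMap (κ → ℂ)).toMonoidHom).comp π
  have hΦ : Continuous Φ := continuous_clm_apply.mpr hπ
  have hcoeff (q : κ × κ) : ∃ f ∈ entryAlgebra ι, ∀ g, f g = LinearMap.toMatrix' (π g) q.1 q.2 := by
    refine (exists_mem_forall_eq_apply _ entryAlgebra_topologicalClosure
      (fun f => hasSplitTranslates_of_mem_entryAlgebra) hΦ
      ((LinearMap.proj q.1).comp ((LinearMap.applyₗ (Pi.single q.2 1)).comp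
        (ContinuousLinearMap.coeLM ℂ)))).imp fun f hf => ⟨hf.1, fun g => ?_⟩
    rw [hf.2, LinearMap.toMatrix'_apply]
    rfl
  choose f hf hfπ using hcoeff
  obtain ⟨N, hN⟩ := exists_forall_pow_mul_mem detFunction_mem_polynomialFunctions
    fun q => exists_detFunction_pow_mul_mem (hf q)
  choose P hP using hN
  refine ⟨N, of fun a b => P (a, b), fun g => Matrix.ext fun a b => ?_⟩
  have hab := congrArg (fun φ : C(unitaryGroup ι ℂ, ℂ) => φ g) (hP (a, b))
  rw [Matrix.smul_apply, smul_eq_mul, ← hfπ (a, b)]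
  exact (aeval_entry_apply _ g).symm.trans hab

end PolyEval

end UnitaryChar

/-! ### Polynomial representations -/

namespace UnitaryChar

open Matrix

section ZariskiDensity

theorem eq_of_eval_torus_eq {σ : Type*} {p q : MvPolynomial σ ℂ}
    (h : ∀ x : σ → ℂ, (∀ i, ‖x i‖ = 1) → MvPolynomial.eval x p = MvPolynomial.eval x q) :
    p = q := by
  refine MvPolynomial.funext_set (fun _ => Metric.sphere (0 : ℂ) 1) (fun _ => ?_) fun x hx =>
    h x fun i => by simpa using hx i trivial
  refine (isPreconnected_sphere (by simp [Complex.rank_real_complex]) 0 1).infinite_of_nontrivial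
    ⟨1, by simp, -1, by simp, by norm_num⟩

theorem eval_bind₁ {σ τ : Type*} (f : σ → MvPolynomial τ ℂ) (p : MvPolynomial σ ℂ) (x : τ → ℂ) :
    MvPolynomial.eval x (MvPolynomial.bind₁ f p) =
      MvPolynomial.eval (fun i => MvPolynomial.eval x (f i)) p :=
  MvPolynomial.eval₂Hom_bind₁ _ _ _ _

theorem map_C_map_eval {ι σ : Type*} (A : Matrix ι ι ℂ) (x : σ → ℂ) :
    (A.map MvPolynomial.C).map (MvPolynomial.eval x) = A := by
  ext; simp

variable {ι : Type*} [Fintype ι] [DecidableEq ι]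

theorem diagonal_mem_unitaryGroup {x : ι → ℂ} (hx : ∀ i, ‖x i‖ = 1) :
    diagonal x ∈ unitaryGroup ι ℂ := by
  rw [mem_unitaryGroup_iff', star_eq_conjTranspose, diagonal_conjTranspose,
    diagonal_mul_diagonal, diagonal_eq_one]
  funext i
  simp [Complex.conj_mul', hx i]

open ComplexOrder in
theorem exists_unitary_mul_diagonal_mul_star {X : Matrix ι ι ℂ} (hX : IsUnit X) :
    ∃ W ∈ unitaryGroup ι ℂ, ∃ V ∈ unitaryGroup ι ℂ, ∃ s : ι → ℂ,
      X = W * diagonal s * star V := by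
  have hpos : (star X * X).PosDef :=
    PosDef.conjTranspose_mul_self X (mulVec_injective_of_isUnit hX)
  set V : Matrix ι ι ℂ := ↑hpos.isHermitian.eigenvectorUnitary with hVdef
  have hV : V ∈ unitaryGroup ι ℂ := hpos.isHermitian.eigenvectorUnitary.2
  let s (i : ι) : ℂ := ((Real.sqrt (hpos.isHermitian.eigenvalues i) : ℝ) : ℂ)
  have hs (i : ι) : s i ≠ 0 := by
    simpa [s] using (Real.sqrt_pos.mpr (hpos.eigenvalues_pos i)).ne'
  have hss : (RCLike.ofReal ∘ hpos.isHermitian.eigenvalues : ι → ℂ) = s * s := by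
    funext i
    simp only [s, Pi.mul_apply, Function.comp, ← Complex.ofReal_mul,
      Real.mul_self_sqrt (hpos.eigenvalues_pos i).le, Complex.coe_algebraMap]
  have hdiag : star V * (star X * X) * V = diagonal (s * s) := by
    rw [hpos.isHermitian.spectral_theorem, Unitary.conjStarAlgAut_apply, hss, ← hVdef,
      ← mul_assoc, ← mul_assoc, mem_unitaryGroup_iff'.mp hV, one_mul, mul_assoc,
      mem_unitaryGroup_iff'.mp hV, mul_one]
  refine ⟨X * V * diagonal s⁻¹, mem_unitaryGroup_iff'.mpr ?_, V, hV, s, ?_⟩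
  · have hstar : star (diagonal s⁻¹) = diagonal s⁻¹ := by
      rw [star_eq_conjTranspose, diagonal_conjTranspose]
      congr 1; funext i; simp [s]
    calc star (X * V * diagonal s⁻¹) * (X * V * diagonal s⁻¹)
        = diagonal s⁻¹ * (star V * (star X * X) * V) * diagonal s⁻¹ := by
          simp only [star_mul, hstar, mul_assoc]
      _ = 1 := by
          rw [hdiag, diagonal_mul_diagonal, diagonal_mul_diagonal, diagonal_eq_one]
          funext i
          simp [hs i]
  · rw [mul_assoc (X * V), diagonal_mul_diagonal, diagonal_eq_one.mpr, mul_one, mul_assoc,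
      mem_unitaryGroup_iff.mp hV, mul_one]
    funext i
    simp [hs i]

/-- By the singular value decomposition, an invertible matrix lies in the complexification of a
torus `W * diagonal x * star V` contained in the unitary group. -/
theorem eval_eq_of_forall_unitary {p₁ p₂ : MvPolynomial (ι × ι) ℂ}
    (h : ∀ g ∈ unitaryGroup ι ℂ, MvPolynomial.eval (fun q => g q.1 q.2) p₁ =
      MvPolynomial.eval (fun q => g q.1 q.2) p₂)
    {X : Matrix ι ι ℂ} (hX : IsUnit X) :
    MvPolynomial.eval (fun q => X q.1 q.2) p₁ = MvPolynomial.eval (fun q => X q.1 q.2) p₂ := by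
  obtain ⟨W, hW, V, hV, s, rfl⟩ := exists_unitary_mul_diagonal_mul_star hX
  let F : Matrix ι ι (MvPolynomial ι ℂ) :=
    W.map MvPolynomial.C * diagonal MvPolynomial.X * (star V).map MvPolynomial.C
  have hF (x : ι → ℂ) : F.map (MvPolynomial.eval x) = W * diagonal x * star V := by
    simp only [F, Matrix.map_mul, diagonal_map (map_zero _), map_C_map_eval, MvPolynomial.eval_X]
  have heval (x : ι → ℂ) (r : MvPolynomial (ι × ι) ℂ) :
      MvPolynomial.eval x (MvPolynomial.bind₁ (fun q => F q.1 q.2) r) =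
        MvPolynomial.eval (fun q => (W * diagonal x * star V) q.1 q.2) r := by
    rw [eval_bind₁, ← hF]
    rfl
  have htorus : MvPolynomial.bind₁ (fun q => F q.1 q.2) p₁ =
      MvPolynomial.bind₁ (fun q => F q.1 q.2) p₂ := eq_of_eval_torus_eq fun x hx => by
    rw [heval, heval]
    exact h _ (mul_mem (mul_mem hW (diagonal_mem_unitaryGroup hx)) (Unitary.star_mem hV))
  rw [← heval, ← heval, htorus]

theorem eq_of_forall_unitary {p₁ p₂ : MvPolynomial (ι × ι) ℂ}
    (h : ∀ g ∈ unitaryGroup ι ℂ, MvPolynomial.eval (fun q => g q.1 q.2) p₁ =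
      MvPolynomial.eval (fun q => g q.1 q.2) p₂) : p₁ = p₂ := by
  refine mul_right_cancel₀ (det_mvPolynomialX_ne_zero ι ℂ) (MvPolynomial.funext fun x => ?_)
  rw [map_mul, map_mul, eval_det_mvPolynomialX]
  by_cases hdet : (of fun i j => x (i, j)).det = 0
  · rw [hdet, mul_zero, mul_zero]
  · have heval := eval_eq_of_forall_unitary h
      ((isUnit_iff_isUnit_det _).mpr (isUnit_iff_ne_zero.mpr hdet))
    simp only [of_apply, Prod.mk.eta] at heval
    rw [heval]

end ZariskiDensity

section PolyRep

variable {ι κ : Type*}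

theorem polyEval_mvPolynomialX (X : Matrix ι ι ℂ) : polyEval (mvPolynomialX ι ι ℂ) X = X :=
  Matrix.ext fun _ _ => MvPolynomial.eval_X _

theorem polyEval_map_C (A : Matrix κ κ ℂ) (X : Matrix ι ι ℂ) :
    polyEval (A.map MvPolynomial.C) X = A :=
  map_C_map_eval A _

theorem polyEval_map_bind₁ (P : Matrix κ κ (MvPolynomial (ι × ι) ℂ))
    (F : Matrix ι ι (MvPolynomial (ι × ι) ℂ)) (X : Matrix ι ι ℂ) :
    polyEval (P.map (MvPolynomial.bind₁ fun q => F q.1 q.2)) X = polyEval P (polyEval F X) :=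
  Matrix.ext fun _ _ => eval_bind₁ _ _ _

theorem polyEval_mul [Fintype κ] (P Q : Matrix κ κ (MvPolynomial (ι × ι) ℂ)) (X : Matrix ι ι ℂ) :
    polyEval (P * Q) X = polyEval P X * polyEval Q X :=
  Matrix.map_mul

variable [Fintype ι]

/-- The substitution `p ↦ p (Z * X)` on polynomials in the entries of a matrix `X`. -/
noncomputable def leftTranslate (Z : Matrix ι ι ℂ) :
    MvPolynomial (ι × ι) ℂ →ₐ[ℂ] MvPolynomial (ι × ι) ℂ :=
  MvPolynomial.bind₁ fun q =>
    (Z.map MvPolynomial.C * mvPolynomialX ι ι ℂ : Matrix ι ι (MvPolynomial (ι × ι) ℂ)) q.1 q.2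

/-- The substitution `p ↦ p (X * Z)` on polynomials in the entries of a matrix `X`. -/
noncomputable def rightTranslate (Z : Matrix ι ι ℂ) :
    MvPolynomial (ι × ι) ℂ →ₐ[ℂ] MvPolynomial (ι × ι) ℂ :=
  MvPolynomial.bind₁ fun q =>
    (mvPolynomialX ι ι ℂ * Z.map MvPolynomial.C : Matrix ι ι (MvPolynomial (ι × ι) ℂ)) q.1 q.2

theorem polyEval_map_leftTranslate (P : Matrix κ κ (MvPolynomial (ι × ι) ℂ)) (Z X : Matrix ι ι ℂ) :
    polyEval (P.map (leftTranslate Z)) X = polyEval P (Z * X) := by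
  rw [leftTranslate, polyEval_map_bind₁, polyEval_mul, polyEval_map_C, polyEval_mvPolynomialX]

theorem polyEval_map_rightTranslate (P : Matrix κ κ (MvPolynomial (ι × ι) ℂ))
    (Z X : Matrix ι ι ℂ) : polyEval (P.map (rightTranslate Z)) X = polyEval P (X * Z) := by
  rw [rightTranslate, polyEval_map_bind₁, polyEval_mul, polyEval_map_C, polyEval_mvPolynomialX]

variable [DecidableEq ι]

theorem eq_of_polyEval_unitary_eq {P Q : Matrix κ κ (MvPolynomial (ι × ι) ℂ)}
    (h : ∀ g : unitaryGroup ι ℂ, polyEval P g = polyEval Q g) : P = Q :=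
  Matrix.ext fun a b => eq_of_forall_unitary fun g hg => congrFun₂ (h ⟨g, hg⟩) a b

variable [Fintype κ]

theorem polyEval_mul_of_unitary {P : Matrix κ κ (MvPolynomial (ι × ι) ℂ)}
    (h : ∀ g₁ g₂ : unitaryGroup ι ℂ,
      polyEval P (g₁ * g₂ : Matrix ι ι ℂ) = polyEval P g₁ * polyEval P g₂)
    (X Y : Matrix ι ι ℂ) : polyEval P (X * Y) = polyEval P X * polyEval P Y := by
  have hleft (g : unitaryGroup ι ℂ) (Y : Matrix ι ι ℂ) :
      polyEval P (g * Y) = polyEval P g * polyEval P Y := by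
    have heq : P.map (leftTranslate g) = (polyEval P g).map MvPolynomial.C * P :=
      eq_of_polyEval_unitary_eq fun g' => by
        rw [polyEval_map_leftTranslate, polyEval_mul, polyEval_map_C, h]
    simpa only [polyEval_map_leftTranslate, polyEval_mul, polyEval_map_C] using
      congrArg (polyEval · Y) heq
  have heq : P.map (rightTranslate Y) = P * (polyEval P Y).map MvPolynomial.C :=
    eq_of_polyEval_unitary_eq fun g => by
      rw [polyEval_map_rightTranslate, polyEval_mul, polyEval_map_C, hleft]
  simpa only [polyEval_map_rightTranslate, polyEval_mul, polyEval_map_C] using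
    congrArg (polyEval · X) heq

variable [DecidableEq κ]

/-- `X ↦ polyEval P X` is an irreducible polynomial representation of the monoid of all matrices. -/
structure IsPolyRep (P : Matrix κ κ (MvPolynomial (ι × ι) ℂ)) : Prop where
  map_one : polyEval P 1 = 1
  map_mul : ∀ X Y, polyEval P (X * Y) = polyEval P X * polyEval P Y
  nonempty : Nonempty κ
  irreducible : ∀ W : Submodule ℂ (κ → ℂ), (∀ X, ∀ w ∈ W, polyEval P X *ᵥ w ∈ W) → W = ⊥ ∨ W = ⊤

theorem isPolyRep_of_polyEval_eq_smul {π : Representation ℂ (unitaryGroup ι ℂ) (κ → ℂ)}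
    (hirr : π.IsIrreducible) {N : ℕ} {P : Matrix κ κ (MvPolynomial (ι × ι) ℂ)}
    (hP : ∀ g : unitaryGroup ι ℂ,
      polyEval P g = (g : Matrix ι ι ℂ).det ^ N • LinearMap.toMatrix' (π g)) : IsPolyRep P where
  map_one := by simpa using hP 1
  map_mul := polyEval_mul_of_unitary fun g₁ g₂ => by
    rw [← UnitaryGroup.mul_val, hP, hP, hP, _root_.map_mul, Module.End.mul_eq_comp,
      LinearMap.toMatrix'_comp, smul_mul_smul_comm, UnitaryGroup.mul_val, det_mul, mul_pow]
  nonempty := by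
    by_contra hκ
    have := not_nonempty_iff.mp hκ
    obtain ⟨W₁, W₂, hne⟩ := hirr.toNontrivial
    exact hne (Subrepresentation.toSubmodule_injective (Subsingleton.elim _ _))
  irreducible W hW := by
    have hstable (g : unitaryGroup ι ℂ) (w : κ → ℂ) (hw : w ∈ W) : π g w ∈ W := by
      have hgw := hW g w hw
      rw [hP, smul_mulVec, LinearMap.toMatrix'_mulVec] at hgw
      exact (W.smul_mem_iff (pow_ne_zero N (UnitaryGroup.det_isUnit g).ne_zero)).mp hgw
    exact (hirr.eq_bot_or_eq_top ⟨W, hstable⟩).imp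
      (congrArg Subrepresentation.toSubmodule) (congrArg Subrepresentation.toSubmodule)

/-- A power of the determinant clears the denominators of the matrix entries of `π`, and polynomial
identities extend from the unitary group to all matrices. -/
theorem exists_isPolyRep {π : Representation ℂ (unitaryGroup ι ℂ) (κ → ℂ)}
    (hirr : π.IsIrreducible) (hπ : ∀ v, Continuous fun g => π g v) :
    ∃ (N : ℕ) (P : Matrix κ κ (MvPolynomial (ι × ι) ℂ)), IsPolyRep P ∧
      ∀ g : unitaryGroup ι ℂ,
        (g : Matrix ι ι ℂ).det ^ N * π.character g = (polyEval P g).trace := by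
  obtain ⟨N, P, hP⟩ := exists_polyEval_eq_det_pow_smul π hπ
  refine ⟨N, P, isPolyRep_of_polyEval_eq_smul hirr hP, fun g => ?_⟩
  rw [hP, trace_smul, smul_eq_mul, Representation.character,
    LinearMap.trace_eq_matrix_trace ℂ (Pi.basisFun ℂ κ)]
  rfl

end PolyRep

end UnitaryChar

/-! ### Invariant vector fields -/

namespace UnitaryChar

open Matrix
open MvPolynomial (X C)

section Derivations

theorem mul_derivation_eq_sum {R σ B κ : Type*} [CommRing R] [CommRing B] [Algebra R B] [Fintype κ]
    (φ : MvPolynomial σ R →ₐ[R] B) (D : Derivation R B B)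
    (D' : κ → Derivation R (MvPolynomial σ R) (MvPolynomial σ R)) (b : B) (c : κ → B)
    (h : ∀ s, b * D (φ (X s)) = ∑ k, c k * φ (D' k (X s))) (p : MvPolynomial σ R) :
    b * D (φ p) = ∑ k, c k * φ (D' k p) := by
  induction p using MvPolynomial.induction_on with
  | C r =>
    rw [← MvPolynomial.algebraMap_eq]
    simp
  | add p q hp hq => simp only [map_add, mul_add, hp, hq, Finset.sum_add_distrib]
  | mul_X p s hp =>
    simp only [map_mul, Derivation.leibniz, smul_eq_mul, map_add, mul_add, Finset.sum_add_distrib]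
    congr 1
    · rw [mul_left_comm, h, Finset.mul_sum]
      exact Finset.sum_congr rfl fun k _ => mul_left_comm _ _ _
    · rw [mul_left_comm, hp, Finset.mul_sum]
      exact Finset.sum_congr rfl fun k _ => mul_left_comm _ _ _

theorem mul_derivation_eq_mul {R σ B : Type*} [CommRing R] [CommRing B] [Algebra R B]
    (φ : MvPolynomial σ R →ₐ[R] B) (D : Derivation R B B)
    (D' : Derivation R (MvPolynomial σ R) (MvPolynomial σ R)) (b c : B)
    (h : ∀ s, b * D (φ (X s)) = c * φ (D' (X s))) (p : MvPolynomial σ R) :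
    b * D (φ p) = c * φ (D' p) := by
  simpa using mul_derivation_eq_sum φ D (fun _ : Unit => D') b (fun _ => c) (by simpa using h) p

theorem eval_aeval_polynomial {σ : Type*} (f : σ → Polynomial ℂ) (p : MvPolynomial σ ℂ) (t : ℂ) :
    (MvPolynomial.aeval f p).eval t = MvPolynomial.eval (fun q => (f q).eval t) p := by
  simpa [Polynomial.coe_aeval_eq_eval, MvPolynomial.coe_aeval_eq_eval] using
    MvPolynomial.comp_aeval_apply (f := f) (Polynomial.aeval t) p

theorem eq_zero_of_mul_derivative_mem_span {R : Type*} [CommRing R] [IsDomain R] [CharZero R]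
    {δ : Polynomial R} (hδ : δ.coeff 0 ≠ 0) {T : Set (Polynomial R)}
    (hzero : ∀ u ∈ T, u.coeff 0 = 0) (h : ∀ u ∈ T, δ * u.derivative ∈ Ideal.span T)
    {u : Polynomial R} (hu : u ∈ T) : u = 0 := by
  have hdvd (m : ℕ) : ∀ u ∈ T, Polynomial.X ^ m ∣ u := by
    induction m with
    | zero => simp
    | succ m ih =>
      intro u hu
      have hspan : Ideal.span T ≤ Ideal.span {Polynomial.X ^ m} :=
        Ideal.span_le.mpr fun v hv => Ideal.mem_span_singleton.mpr (ih v hv)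
      have hderiv : Polynomial.X ^ m ∣ u.derivative :=
        Polynomial.prime_X.pow_dvd_of_dvd_mul_left m (by rwa [Polynomial.X_dvd_iff])
          (Ideal.mem_span_singleton.mp (hspan (h u hu)))
      rw [Polynomial.X_pow_dvd_iff] at hderiv ⊢
      rintro (_ | k) hk
      · exact hzero u hu
      · have hcoeff := hderiv k (by omega)
        rw [Polynomial.coeff_derivative] at hcoeff
        exact (mul_eq_zero.mp hcoeff).resolve_right (by exact_mod_cast k.succ_ne_zero)
  ext k
  exact Polynomial.X_pow_dvd_iff.mp (hdvd (k + 1) u hu) k k.lt_succ_self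

end Derivations

section VectorField

variable {ι : Type*} [DecidableEq ι]

/-- The left-invariant vector field on the space of matrices generated by the elementary matrix
with entry `(i, j)`: it differentiates `p (X * (1 + t • single i j 1))` at `t = 0`. -/
noncomputable def vectorField (i j : ι) :
    Derivation ℂ (MvPolynomial (ι × ι) ℂ) (MvPolynomial (ι × ι) ℂ) :=
  MvPolynomial.mkDerivation ℂ fun q => if q.2 = j then X (q.1, i) else 0

theorem vectorField_X (i j : ι) (q : ι × ι) :
    vectorField i j (X q) = if q.2 = j then X (q.1, i) else 0 :=
  MvPolynomial.mkDerivation_X _ _ _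

theorem lie_vectorField (i j k l : ι) :
    ⁅vectorField i j, vectorField k l⁆ =
      (if k = j then vectorField i l else 0) - (if i = l then vectorField k j else 0) := by
  refine MvPolynomial.derivation_ext fun ⟨a, b⟩ => ?_
  simp only [Derivation.commutator_apply, vectorField_X, Derivation.sub_apply]
  split_ifs <;> simp_all [vectorField_X]

theorem eval_aeval_one_add_smul (A : Matrix ι ι ℂ) (p : MvPolynomial (ι × ι) ℂ) (t : ℂ) :
    (MvPolynomial.aeval (fun q => (1 + (Polynomial.X : Polynomial ℂ) • A.map Polynomial.C :
      Matrix ι ι (Polynomial ℂ)) q.1 q.2) p).eval t =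
      MvPolynomial.eval (fun q => (1 + t • A) q.1 q.2) p := by
  rw [eval_aeval_polynomial]
  congr 2
  funext q
  rw [Matrix.add_apply, Matrix.add_apply, Matrix.one_apply, Matrix.one_apply]
  split_ifs <;> simp [mul_comm t]

theorem det_mul_derivative_aeval [Fintype ι] (A : Matrix ι ι ℂ) (L : Matrix ι ι (Polynomial ℂ))
    (hL : L = 1 + (Polynomial.X : Polynomial ℂ) • A.map Polynomial.C)
    (p : MvPolynomial (ι × ι) ℂ) :
    L.det * (MvPolynomial.aeval (fun q => L q.1 q.2) p).derivative =
      ∑ k : ι × ι, (L.adjugate * A.map Polynomial.C) k.1 k.2 *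
        MvPolynomial.aeval (fun q => L q.1 q.2) (vectorField k.1 k.2 p) := by
  refine mul_derivation_eq_sum (MvPolynomial.aeval fun q => L q.1 q.2) Polynomial.derivative'
    (fun k : ι × ι => vectorField k.1 k.2) L.det
    (fun k => (L.adjugate * A.map Polynomial.C) k.1 k.2) (fun q => ?_) p
  have hderiv : (L q.1 q.2).derivative = A.map Polynomial.C q.1 q.2 := by
    rw [hL, Matrix.add_apply, Matrix.one_apply]
    split_ifs <;> simp
  have hprod : L * (L.adjugate * A.map Polynomial.C) = L.det • A.map Polynomial.C := by
    rw [← mul_assoc, mul_adjugate, smul_mul, one_mul]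
  rw [MvPolynomial.aeval_X, Polynomial.derivative'_apply, hderiv]
  refine (congrFun₂ hprod q.1 q.2).symm.trans ?_
  rw [mul_apply, Fintype.sum_prod_type]
  refine Finset.sum_congr rfl fun k _ => ?_
  simp [vectorField_X, apply_ite, mul_comm]

/-- Along the line `t ↦ 1 + t • A` the derivative of `p` is a combination of the `vectorField i j p`
up to the factor `det (1 + t • A)`, so the Taylor coefficients at `t = 0` vanish in turn. -/
theorem eq_zero_of_vectorField_mem [Finite ι] {S : Set (MvPolynomial (ι × ι) ℂ)}
    (hS : ∀ p ∈ S, ∀ i j, vectorField i j p ∈ S)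
    (hone : ∀ p ∈ S, MvPolynomial.eval (fun q => (1 : Matrix ι ι ℂ) q.1 q.2) p = 0)
    {p : MvPolynomial (ι × ι) ℂ} (hp : p ∈ S) : p = 0 := by
  cases nonempty_fintype ι
  refine MvPolynomial.funext fun x => ?_
  obtain ⟨A, hA⟩ : ∃ A : Matrix ι ι ℂ, 1 + A = of fun i j => x (i, j) := ⟨_, add_sub_cancel _ _⟩
  have hdet : (1 + (Polynomial.X : Polynomial ℂ) • A.map Polynomial.C).det.coeff 0 ≠ 0 := by
    rw [Polynomial.coeff_zero_eq_eval_zero, eval_det_add_X_smul]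
    simp
  have hline : MvPolynomial.aeval (fun q => (1 + (Polynomial.X : Polynomial ℂ) •
      A.map Polynomial.C : Matrix ι ι (Polynomial ℂ)) q.1 q.2) p = 0 := by
    refine eq_zero_of_mul_derivative_mem_span hdet ?_ ?_ (Set.mem_image_of_mem _ hp)
    · rintro _ ⟨p, hp, rfl⟩
      rw [Polynomial.coeff_zero_eq_eval_zero, eval_aeval_one_add_smul, zero_smul, add_zero,
        hone p hp]
    · rintro _ ⟨p, hp, rfl⟩
      rw [det_mul_derivative_aeval A _ rfl]
      exact Ideal.sum_mem _ fun k _ => Ideal.mul_mem_left _ _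
        (Ideal.subset_span (Set.mem_image_of_mem _ (hS p hp k.1 k.2)))
  have hx := eval_aeval_one_add_smul A p 1
  rw [hline, Polynomial.eval_zero, one_smul, hA] at hx
  simpa using hx.symm

end VectorField

end UnitaryChar

/-! ### The derived action -/

namespace UnitaryChar

open Matrix
open MvPolynomial (X C bind₁)

section LieAction

variable {ι κ : Type*}

theorem eq_of_forall_polyEval_eq {P Q : Matrix κ κ (MvPolynomial (ι × ι) ℂ)}
    (h : ∀ X, polyEval P X = polyEval Q X) : P = Q :=
  Matrix.ext fun a b => MvPolynomial.funext fun x => congrFun₂ (h (of fun i j => x (i, j))) a b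

/-- The coefficient of `P` at the functional `u ⬝ᵥ ·` and the vector `v`, as a polynomial. -/
noncomputable def matrixCoeff [Fintype κ] (P : Matrix κ κ (MvPolynomial (ι × ι) ℂ)) (u v : κ → ℂ) :
    MvPolynomial (ι × ι) ℂ :=
  (C ∘ u) ⬝ᵥ P *ᵥ (C ∘ v)

theorem eval_matrixCoeff [Fintype κ] (P : Matrix κ κ (MvPolynomial (ι × ι) ℂ)) (u v : κ → ℂ)
    (X : Matrix ι ι ℂ) :
    MvPolynomial.eval (fun q => X q.1 q.2) (matrixCoeff P u v) = u ⬝ᵥ polyEval P X *ᵥ v := by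
  simp [matrixCoeff, dotProduct, mulVec, polyEval]

variable [DecidableEq ι]

/-- The derived action on `κ → ℂ` of the elementary matrix with entry `(i, j)`, for the
representation `polyEval P`. -/
noncomputable def lie (P : Matrix κ κ (MvPolynomial (ι × ι) ℂ)) (i j : ι) : Matrix κ κ ℂ :=
  polyEval (P.map (vectorField i j)) 1

theorem map_vectorField_map_C_mul [Fintype κ] (A : Matrix κ κ ℂ)
    (P : Matrix κ κ (MvPolynomial (ι × ι) ℂ)) (i j : ι) :
    (A.map C * P).map (vectorField i j) = A.map C * P.map (vectorField i j) := by
  refine Matrix.ext fun a b => ?_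
  simp only [Matrix.map_apply, mul_apply, map_sum, MvPolynomial.C_mul', Derivation.map_smul]

theorem map_vectorField_mul_map_C [Fintype κ] (P : Matrix κ κ (MvPolynomial (ι × ι) ℂ))
    (A : Matrix κ κ ℂ) (i j : ι) :
    (P * A.map C).map (vectorField i j) = P.map (vectorField i j) * A.map C := by
  refine Matrix.ext fun a b => ?_
  simp only [Matrix.map_apply, mul_apply, map_sum, mul_comm _ (C _), MvPolynomial.C_mul',
    Derivation.map_smul]

variable [Fintype ι]

theorem vectorField_leftTranslate (Z : Matrix ι ι ℂ) (i j : ι) (p : MvPolynomial (ι × ι) ℂ) :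
    vectorField i j (leftTranslate Z p) = leftTranslate Z (vectorField i j p) := by
  have hgen (q : ι × ι) : vectorField i j (leftTranslate Z (X q)) =
      leftTranslate Z (vectorField i j (X q)) := by
    by_cases h : q.2 = j <;>
      simp [leftTranslate, vectorField_X, mul_apply, MvPolynomial.C_mul', h]
  simpa using mul_derivation_eq_mul (leftTranslate Z) (vectorField i j) (vectorField i j) 1 1
    (by simpa using hgen) p

theorem mul_vectorField_rightTranslate_diagonal (x : ι → ℂ) (i j : ι)
    (p : MvPolynomial (ι × ι) ℂ) :
    C (x i) * vectorField i j (rightTranslate (diagonal x) p) =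
      C (x j) * rightTranslate (diagonal x) (vectorField i j p) := by
  refine mul_derivation_eq_mul (rightTranslate (diagonal x)) (vectorField i j) (vectorField i j)
    (C (x i)) (C (x j)) (fun q => ?_) p
  by_cases h : q.2 = j
  · simp [rightTranslate, vectorField_X, diagonal_map, mul_comm (X _) (C _), MvPolynomial.C_mul', h,
      smul_comm (x i)]
  · simp [rightTranslate, vectorField_X, diagonal_map, mul_comm (X _) (C _), MvPolynomial.C_mul', h]

variable [Fintype κ] [DecidableEq κ] {P : Matrix κ κ (MvPolynomial (ι × ι) ℂ)}

theorem IsPolyRep.map_leftTranslate (hP : IsPolyRep P) (Z : Matrix ι ι ℂ) :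
    P.map (leftTranslate Z) = (polyEval P Z).map C * P :=
  eq_of_forall_polyEval_eq fun X => by
    rw [polyEval_map_leftTranslate, polyEval_mul, polyEval_map_C, hP.map_mul]

theorem IsPolyRep.map_rightTranslate (hP : IsPolyRep P) (Z : Matrix ι ι ℂ) :
    P.map (rightTranslate Z) = P * (polyEval P Z).map C :=
  eq_of_forall_polyEval_eq fun X => by
    rw [polyEval_map_rightTranslate, polyEval_mul, polyEval_map_C, hP.map_mul]

/-- Left translations commute with the left-invariant `vectorField i j`. -/
theorem IsPolyRep.map_vectorField (hP : IsPolyRep P) (i j : ι) :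
    P.map (vectorField i j) = P * (lie P i j).map C := by
  refine eq_of_forall_polyEval_eq fun Z => ?_
  have hcomm : (P.map (vectorField i j)).map (leftTranslate Z) =
      (polyEval P Z).map C * P.map (vectorField i j) := by
    rw [← map_vectorField_map_C_mul, ← hP.map_leftTranslate]
    exact Matrix.ext fun a b => (vectorField_leftTranslate Z i j (P a b)).symm
  simpa only [polyEval_map_leftTranslate, polyEval_mul, polyEval_map_C, mul_one, lie] using
    congrArg (polyEval · 1) hcomm

theorem IsPolyRep.polyEval_map_vectorField (hP : IsPolyRep P) (i j : ι) (Z : Matrix ι ι ℂ) :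
    polyEval (P.map (vectorField i j)) Z = polyEval P Z * lie P i j := by
  rw [hP.map_vectorField, polyEval_mul, polyEval_map_C]

theorem IsPolyRep.lie_mul_lie (hP : IsPolyRep P) (i j k l : ι) :
    lie P i j * lie P k l = polyEval ((P.map (vectorField k l)).map (vectorField i j)) 1 := by
  rw [hP.map_vectorField k l, map_vectorField_mul_map_C, polyEval_mul, polyEval_map_C, lie]

theorem IsPolyRep.lie_bracket (hP : IsPolyRep P) (i j k l : ι) :
    lie P i j * lie P k l - lie P k l * lie P i j =
      (if k = j then lie P i l else 0) - (if i = l then lie P k j else 0) := by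
  rw [hP.lie_mul_lie, hP.lie_mul_lie]
  ext a b
  have hbracket := congrArg (MvPolynomial.eval fun q => (1 : Matrix ι ι ℂ) q.1 q.2)
    (DFunLike.congr_fun (lie_vectorField i j k l) (P a b))
  rw [Derivation.commutator_apply, map_sub] at hbracket
  refine hbracket.trans ?_
  split_ifs <;> simp [lie, polyEval]

/-- Right translation by `diagonal x` rescales `vectorField i j` by `x j / x i`. -/
theorem IsPolyRep.diagonal_mul_lie (hP : IsPolyRep P) (x : ι → ℂ) (i j : ι) :
    x j • (polyEval P (diagonal x) * lie P i j) =
      x i • (lie P i j * polyEval P (diagonal x)) := by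
  have hcomm : C (σ := ι × ι) (x i) • (P * (polyEval P (diagonal x)).map C).map (vectorField i j) =
      C (σ := ι × ι) (x j) • (P.map (vectorField i j)).map (rightTranslate (diagonal x)) := by
    rw [← hP.map_rightTranslate]
    exact Matrix.ext fun a b => mul_vectorField_rightTranslate_diagonal x i j (P a b)
  have hsmul (c : ℂ) (Q : Matrix κ κ (MvPolynomial (ι × ι) ℂ)) (X : Matrix ι ι ℂ) :
      polyEval (C (σ := ι × ι) c • Q) X = c • polyEval Q X := by
    ext; simp [polyEval]
  simpa only [hsmul, polyEval_map_rightTranslate, map_vectorField_mul_map_C, polyEval_mul,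
    polyEval_map_C, one_mul, hP.polyEval_map_vectorField, hP.map_one] using
    (congrArg (polyEval · 1) hcomm).symm

theorem IsPolyRep.vectorField_matrixCoeff (hP : IsPolyRep P) (i j : ι) (u v : κ → ℂ) :
    vectorField i j (matrixCoeff P u v) = matrixCoeff P u (lie P i j *ᵥ v) := by
  have hv : C (σ := ι × ι) ∘ (lie P i j *ᵥ v) = (lie P i j).map C *ᵥ (C ∘ v) :=
    funext fun a => RingHom.map_mulVec C _ _ a
  rw [matrixCoeff, matrixCoeff, hv, mulVec_mulVec, ← hP.map_vectorField]
  simp only [dotProduct, mulVec, map_sum, Function.comp_apply, mul_comm _ (C _),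
    MvPolynomial.C_mul', Derivation.map_smul, Matrix.map_apply]

theorem IsPolyRep.mulVec_mem_of_lie_mulVec_mem (hP : IsPolyRep P) {W : Submodule ℂ (κ → ℂ)}
    (hW : ∀ i j, ∀ w ∈ W, lie P i j *ᵥ w ∈ W) (Z : Matrix ι ι ℂ) :
    ∀ w ∈ W, polyEval P Z *ᵥ w ∈ W := by
  intro w hw
  by_contra hnot
  obtain ⟨ℓ, hℓ, hℓW⟩ := Submodule.exists_le_ker_of_notMem hnot
  obtain ⟨u, rfl⟩ := (dotProductEquiv ℂ κ).surjective ℓ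
  have hzero : matrixCoeff P u w = 0 := by
    refine eq_zero_of_vectorField_mem (S := matrixCoeff P u '' W) ?_ ?_
      (Set.mem_image_of_mem _ hw)
    · rintro _ ⟨v, hv, rfl⟩ i j
      exact ⟨_, hW i j v hv, (hP.vectorField_matrixCoeff i j u v).symm⟩
    · rintro _ ⟨v, hv, rfl⟩
      rw [eval_matrixCoeff, hP.map_one, one_mulVec]
      exact hℓW hv
  exact hℓ (by rw [dotProductEquiv_apply_apply, ← eval_matrixCoeff, hzero, map_zero])

theorem IsPolyRep.eq_top_of_lie_mulVec_mem (hP : IsPolyRep P) {W : Submodule ℂ (κ → ℂ)}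
    (hW : ∀ i j, ∀ w ∈ W, lie P i j *ᵥ w ∈ W) (hne : W ≠ ⊥) : W = ⊤ :=
  (hP.irreducible W (hP.mulVec_mem_of_lie_mulVec_mem hW)).resolve_left hne

theorem IsPolyRep.eq_smul_one_of_commute (hP : IsPolyRep P) {M : Matrix κ κ ℂ}
    (hM : ∀ i j, Commute (lie P i j) M) : ∃ c : ℂ, M = c • (1 : Matrix κ κ ℂ) := by
  have := hP.nonempty
  obtain ⟨c, hc⟩ := Module.End.exists_eigenvalue M.mulVecLin
  have htop := hP.eq_top_of_lie_mulVec_mem (W := Module.End.eigenspace M.mulVecLin c)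
    (fun i j w hw => by
      rw [Module.End.mem_eigenspace_iff, mulVecLin_apply] at hw ⊢
      rw [mulVec_mulVec, ← (hM i j).eq, ← mulVec_mulVec, hw, mulVec_smul]) hc
  refine ⟨c, Matrix.ext_of_mulVec_single fun b => ?_⟩
  rw [smul_mulVec, one_mulVec]
  exact Module.End.mem_eigenspace_iff.mp (htop ▸ Submodule.mem_top)

end LieAction

end UnitaryChar

/-! ### Weights -/

namespace UnitaryChar

open Matrix
open MvPolynomial (X C bind₁ coeff monomial)

section Weights

variable {ι κ : Type*}

/-- The derivation `X i * ∂ / ∂ X i`, which multiplies `monomial μ r` by `μ i`. -/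
noncomputable def euler (i : ι) : Derivation ℂ (MvPolynomial ι ℂ) (MvPolynomial ι ℂ) :=
  (X i : MvPolynomial ι ℂ) • MvPolynomial.pderiv i

theorem euler_monomial (i : ι) (μ : ι →₀ ℕ) (r : ℂ) :
    euler i (monomial μ r) = (μ i : ℂ) • monomial μ r := by
  rw [Nat.cast_smul_eq_nsmul]
  exact MvPolynomial.X_mul_pderiv_monomial

theorem coeff_euler (i : ι) (μ : ι →₀ ℕ) (p : MvPolynomial ι ℂ) :
    coeff μ (euler i p) = μ i * coeff μ p := by
  classical
  induction p using MvPolynomial.induction_on' with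
  | monomial ν r =>
    rw [euler_monomial, MvPolynomial.coeff_smul, MvPolynomial.coeff_monomial]
    split_ifs with h
    · rw [h, smul_eq_mul]
    · simp
  | add p q hp hq => rw [map_add, MvPolynomial.coeff_add, MvPolynomial.coeff_add, hp, hq, mul_add]

theorem eval_monomial_eq_mul_prod [Fintype ι] (x : ι → ℂ) (μ : ι →₀ ℕ) (r : ℂ) :
    MvPolynomial.eval x (monomial μ r) = r * ∏ i, x i ^ μ i := by
  rw [MvPolynomial.eval_monomial, Finsupp.prod_fintype _ _ (by simp)]

theorem coeff_bind₁_C_mul_X [Fintype ι] (x : ι → ℂ) (p : MvPolynomial ι ℂ) (ν : ι →₀ ℕ) :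
    coeff ν (bind₁ (fun i => C (x i) * X i) p) = (∏ i, x i ^ ν i) * coeff ν p := by
  classical
  induction p using MvPolynomial.induction_on' with
  | monomial μ r =>
    have hmonomial : bind₁ (fun i => C (x i) * X i) (monomial μ r) =
        monomial μ ((∏ i, x i ^ μ i) * r) := by
      refine MvPolynomial.funext fun y => ?_
      simp only [eval_bind₁, eval_monomial_eq_mul_prod, map_mul, MvPolynomial.eval_C,
        MvPolynomial.eval_X, mul_pow, Finset.prod_mul_distrib]
      ring
    rw [hmonomial, MvPolynomial.coeff_monomial, MvPolynomial.coeff_monomial]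
    split_ifs with h
    · rw [h]
    · simp
  | add p q hp hq =>
    rw [map_add, MvPolynomial.coeff_add, MvPolynomial.coeff_add, hp, hq, mul_add]

variable [DecidableEq ι]

/-- The restriction of `P` to diagonal matrices, with the diagonal entries as variables. -/
noncomputable def torus (P : Matrix κ κ (MvPolynomial (ι × ι) ℂ)) :
    Matrix κ κ (MvPolynomial ι ℂ) :=
  P.map (bind₁ fun q => diagonal X q.1 q.2)

/-- The coefficient of `torus P` at the monomial with exponent `μ`; for a representation `P` it is
the projection onto the vectors of weight `μ`. -/
noncomputable def weightProj (P : Matrix κ κ (MvPolynomial (ι × ι) ℂ)) (μ : ι →₀ ℕ) :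
    Matrix κ κ ℂ :=
  (torus P).map (coeff μ)

theorem map_eval_torus (P : Matrix κ κ (MvPolynomial (ι × ι) ℂ)) (x : ι → ℂ) :
    (torus P).map (MvPolynomial.eval x) = polyEval P (diagonal x) := by
  ext a b
  simp only [torus, polyEval, Matrix.map_apply, eval_bind₁]
  congr 2
  funext q
  rw [diagonal_apply, diagonal_apply]
  split_ifs <;> simp

theorem bind₁_diagonal_vectorField (i : ι) (p : MvPolynomial (ι × ι) ℂ) :
    bind₁ (fun q => diagonal X q.1 q.2) (vectorField i i p) =
      euler i (bind₁ (fun q => diagonal X q.1 q.2) p) := by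
  have hgen (q : ι × ι) : euler i (bind₁ (fun q => diagonal X q.1 q.2) (X q)) =
      bind₁ (fun q => diagonal X q.1 q.2) (vectorField i i (X q)) := by
    rw [vectorField_X, MvPolynomial.bind₁_X_right, diagonal_apply]
    by_cases h : q.2 = i
    · by_cases h' : q.1 = i <;> simp [euler, diagonal_apply, h, h']
    · simp only [h, if_false, map_zero]
      split_ifs with h' <;> simp [euler, h', Ne.symm h]
  simpa using (mul_derivation_eq_mul (bind₁ fun q => diagonal X q.1 q.2) (euler i)
    (vectorField i i) 1 1 (by simpa using hgen) p).symm

theorem weightProj_finite_support [Finite κ] (P : Matrix κ κ (MvPolynomial (ι × ι) ℂ)) :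
    {ν | weightProj P ν ≠ 0}.Finite := by
  refine (Set.finite_iUnion fun a => Set.finite_iUnion fun b =>
    (torus P a b).support.finite_toSet).subset fun ν hν => ?_
  contrapose! hν
  simp only [Set.mem_iUnion, not_exists, Finset.mem_coe, MvPolynomial.notMem_support_iff] at hν
  exact not_not.mpr (Matrix.ext hν)

variable [Fintype κ]

/-- The orbit of `v` under the diagonal matrices, as a vector of polynomials. -/
noncomputable def torusOrbit (P : Matrix κ κ (MvPolynomial (ι × ι) ℂ)) (v : κ → ℂ) :
    κ → MvPolynomial ι ℂ :=
  torus P *ᵥ (C ∘ v)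

theorem eval_torusOrbit (P : Matrix κ κ (MvPolynomial (ι × ι) ℂ)) (v : κ → ℂ) (x : ι → ℂ) (a : κ) :
    MvPolynomial.eval x (torusOrbit P v a) = (polyEval P (diagonal x) *ᵥ v) a := by
  rw [torusOrbit, RingHom.map_mulVec, map_eval_torus, ← Function.comp_assoc]
  congr 2
  ext; simp

theorem coeff_torusOrbit (P : Matrix κ κ (MvPolynomial (ι × ι) ℂ)) (v : κ → ℂ) (μ : ι →₀ ℕ)
    (a : κ) : coeff μ (torusOrbit P v a) = (weightProj P μ *ᵥ v) a := by
  simp only [torusOrbit, weightProj, mulVec, dotProduct, MvPolynomial.coeff_sum,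
    Function.comp_apply, mul_comm (torus P _ _), MvPolynomial.coeff_C_mul, Matrix.map_apply,
    mul_comm (coeff _ _)]

variable [Fintype ι]

theorem map_torus_euler [DecidableEq κ] {P : Matrix κ κ (MvPolynomial (ι × ι) ℂ)}
    (hP : IsPolyRep P) (i : ι) : (torus P).map (euler i) = torus P * (lie P i i).map C := by
  have htorus : torus (P.map (vectorField i i)) = (torus P).map (euler i) :=
    Matrix.ext fun a b => bind₁_diagonal_vectorField i (P a b)
  rw [← htorus, hP.map_vectorField]
  simp only [torus, Matrix.map_mul]
  congr 1
  ext; simp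

/-- `v` has weight `μ`: diagonal matrices act on it through the monomial with exponent `μ`. -/
def IsWeightVec (P : Matrix κ κ (MvPolynomial (ι × ι) ℂ)) (μ : ι →₀ ℕ) (v : κ → ℂ) : Prop :=
  ∀ x : ι → ℂ, polyEval P (diagonal x) *ᵥ v = (∏ i, x i ^ μ i) • v

theorem IsWeightVec.torusOrbit_eq {P : Matrix κ κ (MvPolynomial (ι × ι) ℂ)} {μ : ι →₀ ℕ}
    {v : κ → ℂ} (hv : IsWeightVec P μ v) (a : κ) : torusOrbit P v a = monomial μ (v a) :=
  MvPolynomial.funext fun x => by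
    rw [eval_torusOrbit, hv, eval_monomial_eq_mul_prod, Pi.smul_apply, smul_eq_mul, mul_comm]

theorem IsWeightVec.weightProj_mulVec {P : Matrix κ κ (MvPolynomial (ι × ι) ℂ)} {μ : ι →₀ ℕ}
    {v : κ → ℂ} (hv : IsWeightVec P μ v) (ν : ι →₀ ℕ) :
    weightProj P ν *ᵥ v = if μ = ν then v else 0 := by
  ext a
  rw [← coeff_torusOrbit, hv.torusOrbit_eq, MvPolynomial.coeff_monomial]
  split_ifs <;> simp

variable [DecidableEq κ] {P : Matrix κ κ (MvPolynomial (ι × ι) ℂ)}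

theorem IsPolyRep.polyEval_diagonal_mul_weightProj (hP : IsPolyRep P) (x : ι → ℂ) (μ : ι →₀ ℕ) :
    polyEval P (diagonal x) * weightProj P μ = (∏ i, x i ^ μ i) • weightProj P μ := by
  have htorus : (polyEval P (diagonal x)).map C * torus P =
      (torus P).map (bind₁ fun i => C (x i) * X i) := by
    refine Matrix.ext fun a b => MvPolynomial.funext fun y => ?_
    have hmul := congrFun₂ (hP.map_mul (diagonal x) (diagonal y)) a b
    rw [diagonal_mul_diagonal, ← map_eval_torus P y] at hmul
    simpa [mul_apply, eval_bind₁, ← map_eval_torus] using hmul.symm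
  ext a b
  have hcoeff := congrArg (coeff μ) (congrFun₂ htorus a b)
  rw [Matrix.map_apply, coeff_bind₁_C_mul_X] at hcoeff
  simpa [mul_apply, MvPolynomial.coeff_sum, weightProj] using hcoeff

theorem IsPolyRep.isWeightVec_weightProj (hP : IsPolyRep P) (μ : ι →₀ ℕ) (v : κ → ℂ) :
    IsWeightVec P μ (weightProj P μ *ᵥ v) := fun x => by
  rw [mulVec_mulVec, hP.polyEval_diagonal_mul_weightProj, smul_mulVec]

theorem IsPolyRep.exists_weightProj_mulVec_ne_zero (hP : IsPolyRep P) {v : κ → ℂ} (hv : v ≠ 0) :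
    ∃ ν, weightProj P ν *ᵥ v ≠ 0 := by
  contrapose! hv
  ext a
  have horbit : torusOrbit P v a = 0 := MvPolynomial.ext _ _ fun ν => by
    rw [coeff_torusOrbit, hv, Pi.zero_apply, MvPolynomial.coeff_zero]
  simpa [horbit, hP.map_one] using (eval_torusOrbit P v 1 a).symm

theorem IsWeightVec.lie_self_mulVec (hP : IsPolyRep P) {μ : ι →₀ ℕ} {v : κ → ℂ}
    (hv : IsWeightVec P μ v) (i : ι) : lie P i i *ᵥ v = (μ i : ℂ) • v := by
  have horbit (a : κ) : torusOrbit P (lie P i i *ᵥ v) a = euler i (torusOrbit P v a) := by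
    have hC : C (σ := ι) ∘ (lie P i i *ᵥ v) = (lie P i i).map C *ᵥ (C ∘ v) :=
      funext fun a => RingHom.map_mulVec C _ _ a
    rw [torusOrbit, hC, mulVec_mulVec, ← map_torus_euler hP]
    simp only [torusOrbit, dotProduct, mulVec, map_sum, Function.comp_apply, mul_comm _ (C _),
      MvPolynomial.C_mul', Derivation.map_smul, Matrix.map_apply]
  ext a
  have hone := eval_torusOrbit P (lie P i i *ᵥ v) 1 a
  rw [horbit, hv.torusOrbit_eq, euler_monomial, Pi.one_def, diagonal_one, hP.map_one, one_mulVec,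
    MvPolynomial.smul_eval, eval_monomial_eq_mul_prod] at hone
  simpa using hone.symm

theorem IsWeightVec.lie_mulVec (hP : IsPolyRep P) {μ : ι →₀ ℕ} {v : κ → ℂ}
    (hv : IsWeightVec P μ v) {i j : ι} (hne : lie P i j *ᵥ v ≠ 0) :
    ∃ ν, ν + Finsupp.single j 1 = μ + Finsupp.single i 1 ∧ IsWeightVec P ν (lie P i j *ᵥ v) := by
  have horbit (a : κ) : X j * torusOrbit P (lie P i j *ᵥ v) a =
      monomial (μ + Finsupp.single i 1) ((lie P i j *ᵥ v) a) := by
    refine MvPolynomial.funext fun x => ?_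
    have hdiag := congrArg (· *ᵥ v) (hP.diagonal_mul_lie x i j)
    simp only [smul_mulVec, ← mulVec_mulVec, hv x, mulVec_smul, smul_smul] at hdiag
    rw [map_mul, MvPolynomial.eval_X, eval_torusOrbit, ← mul_one ((lie P i j *ᵥ v) a),
      ← MvPolynomial.monomial_mul, map_mul, ← MvPolynomial.X,
      eval_monomial_eq_mul_prod, MvPolynomial.eval_X]
    refine (congrFun hdiag a).trans ?_
    rw [Pi.smul_apply, smul_eq_mul]
    ring
  have hproj (ν : ι →₀ ℕ) : weightProj P ν *ᵥ (lie P i j *ᵥ v) =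
      if μ + Finsupp.single i 1 = ν + Finsupp.single j 1 then lie P i j *ᵥ v else 0 := by
    ext a
    rw [← coeff_torusOrbit, ← MvPolynomial.coeff_X_mul ν j, add_comm (Finsupp.single j 1), horbit,
      MvPolynomial.coeff_monomial]
    split_ifs <;> simp
  obtain ⟨ν, hν⟩ := hP.exists_weightProj_mulVec_ne_zero hne
  have hshift : μ + Finsupp.single i 1 = ν + Finsupp.single j 1 := by
    by_contra h
    exact hν (by rw [hproj, if_neg h])
  refine ⟨ν, hshift.symm, ?_⟩
  simpa only [hproj, if_pos hshift] using hP.isWeightVec_weightProj ν (lie P i j *ᵥ v)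

end Weights

end UnitaryChar

/-! ### The highest weight -/

namespace UnitaryChar

open Matrix

section Dominance

variable {ι : Type*} [Fintype ι]

theorem dotProduct_add_eq_of_add_single_eq (m : ι → ℕ) {μ ν : ι →₀ ℕ} {i j : ι}
    (h : ν + Finsupp.single j 1 = μ + Finsupp.single i 1) :
    m ⬝ᵥ ν + m j = m ⬝ᵥ μ + m i := by
  classical
  simpa [dotProduct_add, Finsupp.single_eq_pi_single] using congrArg (fun ξ : ι →₀ ℕ => m ⬝ᵥ ξ) h

variable [Preorder ι] {μ ν ξ : ι →₀ ℕ}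

/-- The dominance order on exponents, in dual form: pairing with weakly decreasing sequences. -/
def Dominated (ν μ : ι →₀ ℕ) : Prop :=
  ∀ m : ι → ℕ, Antitone m → m ⬝ᵥ ν ≤ m ⬝ᵥ μ

theorem Dominated.refl (μ : ι →₀ ℕ) : Dominated μ μ := fun _ _ => le_rfl

theorem Dominated.trans (h : Dominated ν μ) (h' : Dominated μ ξ) : Dominated ν ξ :=
  fun m hm => (h m hm).trans (h' m hm)

theorem dominated_of_add_single_eq {i j : ι} (hji : j ≤ i)
    (h : ν + Finsupp.single j 1 = μ + Finsupp.single i 1) : Dominated ν μ := fun m hm => by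
  have hshift := dotProduct_add_eq_of_add_single_eq m h
  have hle := hm hji
  omega

end Dominance

section HighestWeight

variable {κ : Type*} [Fintype κ]

theorem trace_eq_one_of_mulVec_mem_span_singleton {M : Matrix κ κ ℂ} {v : κ → ℂ}
    (hv : v ≠ 0) (hMv : M *ᵥ v = v) (hM : ∀ w, M *ᵥ w ∈ Submodule.span ℂ {v}) : M.trace = 1 := by
  classical
  have hproj : LinearMap.IsProj (Submodule.span ℂ {v}) M.toLin' := by
    refine ⟨fun w => by simpa using hM w, fun w hw => ?_⟩
    obtain ⟨c, rfl⟩ := Submodule.mem_span_singleton.mp hw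
    rw [toLin'_apply, mulVec_smul, hMv]
  rw [← Matrix.trace_toLin'_eq, hproj.trace, finrank_span_singleton hv, Nat.cast_one]

theorem mulVec_mem_of_mem_span {M : Matrix κ κ ℂ} {S : Set (κ → ℂ)} {W : Submodule ℂ (κ → ℂ)}
    (hS : ∀ w ∈ S, M *ᵥ w ∈ W) {w : κ → ℂ} (hw : w ∈ Submodule.span ℂ S) : M *ᵥ w ∈ W :=
  (Submodule.span_le (p := W.comap M.mulVecLin) |>.mpr hS) hw

variable {n : ℕ}

/-- The vectors obtained from `v` by applying lowering operators `lie P i j`, `j < i`. -/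
inductive Lowered (P : Matrix κ κ (MvPolynomial (Fin n × Fin n) ℂ)) (v : κ → ℂ) : (κ → ℂ) → Prop
  | base : Lowered P v v
  | step {i j : Fin n} (hji : j < i) {w : κ → ℂ} (hw : Lowered P v w) :
      Lowered P v (lie P i j *ᵥ w)

variable [DecidableEq κ] {P : Matrix κ κ (MvPolynomial (Fin n × Fin n) ℂ)} {μ : Fin n →₀ ℕ}
  {v w : κ → ℂ}

theorem Lowered.lie_mulVec_mem_span (hP : IsPolyRep P) (hv : IsWeightVec P μ v)
    (hup : ∀ i j, i < j → lie P i j *ᵥ v = 0) (hw : Lowered P v w) (i j : Fin n) :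
    lie P i j *ᵥ w ∈ Submodule.span ℂ {w | Lowered P v w} := by
  induction hw generalizing i j with
  | base =>
    rcases lt_trichotomy i j with hij | rfl | hji
    · rw [hup i j hij]
      exact Submodule.zero_mem _
    · rw [hv.lie_self_mulVec hP]
      exact Submodule.smul_mem _ _ (Submodule.subset_span Lowered.base)
    · exact Submodule.subset_span (Lowered.step hji .base)
  | @step k l hlk w _ ih =>
    have hlower := mulVec_mem_of_mem_span (M := lie P k l)
      (fun w hw => Submodule.subset_span (Lowered.step hlk hw)) (ih i j)
    have hbracket := congrArg (· *ᵥ w) (hP.lie_bracket i j k l)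
    simp only [sub_mulVec, ← mulVec_mulVec] at hbracket
    rw [eq_add_of_sub_eq hbracket]
    refine add_mem (sub_mem ?_ ?_) hlower
    · split_ifs
      · exact ih i l
      · simp
    · split_ifs
      · exact ih k j
      · simp

theorem span_lowered_eq_top (hP : IsPolyRep P) (hv : IsWeightVec P μ v) (hne : v ≠ 0)
    (hup : ∀ i j, i < j → lie P i j *ᵥ v = 0) : Submodule.span ℂ {w | Lowered P v w} = ⊤ := by
  refine hP.eq_top_of_lie_mulVec_mem (fun i j => ?_)
    (Submodule.ne_bot_iff _ |>.mpr ⟨v, Submodule.subset_span Lowered.base, hne⟩)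
  exact fun w => mulVec_mem_of_mem_span fun w hw =>
    Lowered.lie_mulVec_mem_span hP hv hup hw i j

theorem Lowered.exists_isWeightVec (hP : IsPolyRep P) (hv : IsWeightVec P μ v)
    (hw : Lowered P v w) :
    ∃ ν, IsWeightVec P ν w ∧ Dominated ν μ ∧ (ν = μ → w ∈ Submodule.span ℂ {v}) := by
  induction hw with
  | base => exact ⟨μ, hv, .refl μ, fun _ => Submodule.mem_span_singleton_self v⟩
  | @step i j hji w _ ih =>
    obtain ⟨ν, hν, hdom, -⟩ := ih
    by_cases hne : lie P i j *ᵥ w = 0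
    · rw [hne]
      exact ⟨μ, fun x => by simp, .refl μ, fun _ => Submodule.zero_mem _⟩
    obtain ⟨ξ, hshift, hξ⟩ := hν.lie_mulVec hP hne
    refine ⟨ξ, hξ, (dominated_of_add_single_eq hji.le hshift).trans hdom, ?_⟩
    rintro rfl
    have hheight := dotProduct_add_eq_of_add_single_eq (fun i => (i.rev : ℕ)) hshift
    have hle := hdom (fun i => (i.rev : ℕ)) fun a b hab => Fin.rev_le_rev.mpr hab
    have hlt : (i.rev : ℕ) < j.rev := Fin.rev_lt_rev.mpr hji
    omega

theorem IsPolyRep.exists_maximal_weight (hP : IsPolyRep P) :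
    ∃ μ v, v ≠ 0 ∧ IsWeightVec P μ v ∧ ∀ i j, i < j → lie P i j *ᵥ v = 0 := by
  have := hP.nonempty
  obtain ⟨ν, hν⟩ := hP.exists_weightProj_mulVec_ne_zero (one_ne_zero (α := κ → ℂ))
  obtain ⟨μ, hμ, hmax⟩ := Set.exists_max_image _
    (fun ν : Fin n →₀ ℕ => (fun i : Fin n => (i.rev : ℕ)) ⬝ᵥ ν) (weightProj_finite_support P)
    ⟨ν, fun h => hν (by rw [h, zero_mulVec])⟩
  obtain ⟨u, hu⟩ : ∃ u, weightProj P μ *ᵥ u ≠ 0 := by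
    contrapose! hμ
    simpa using ext_of_mulVec_single fun a => (hμ _).trans (zero_mulVec _).symm
  refine ⟨μ, _, hu, hP.isWeightVec_weightProj μ u, fun i j hij => ?_⟩
  by_contra hne
  obtain ⟨ξ, hshift, hξ⟩ := (hP.isWeightVec_weightProj μ u).lie_mulVec hP hne
  have hle := hmax ξ fun h => hne (by simpa [h] using (hξ.weightProj_mulVec ξ).symm)
  have hheight := dotProduct_add_eq_of_add_single_eq (fun i => (i.rev : ℕ)) hshift
  have hlt : (j.rev : ℕ) < i.rev := Fin.rev_lt_rev.mpr hij
  omega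

theorem IsPolyRep.exists_highest_weight (hP : IsPolyRep P) :
    ∃ μ, (weightProj P μ).trace = 1 ∧ ∀ ν, weightProj P ν ≠ 0 → Dominated ν μ := by
  obtain ⟨μ, v, hne, hv, hup⟩ := hP.exists_maximal_weight
  have hspan {M : Matrix κ κ ℂ} {W : Submodule ℂ (κ → ℂ)}
      (h : ∀ w, Lowered P v w → M *ᵥ w ∈ W) (w : κ → ℂ) : M *ᵥ w ∈ W :=
    mulVec_mem_of_mem_span h (span_lowered_eq_top hP hv hne hup ▸ Submodule.mem_top (x := w))
  refine ⟨μ, trace_eq_one_of_mulVec_mem_span_singleton hne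
    (by rw [hv.weightProj_mulVec, if_pos rfl]) (hspan fun w hw => ?_), fun ν hν => ?_⟩
  · obtain ⟨ν, hw, -, hmem⟩ := hw.exists_isWeightVec hP hv
    rw [hw.weightProj_mulVec]
    split_ifs with h
    · exact hmem h
    · exact Submodule.zero_mem _
  · contrapose! hν
    refine ext_of_mulVec_single fun a => ?_
    rw [zero_mulVec, ← Submodule.mem_bot ℂ]
    refine hspan (fun w hw => ?_) _
    obtain ⟨ξ, hw, hdom, -⟩ := hw.exists_isWeightVec hP hv
    rw [hw.weightProj_mulVec, if_neg (by rintro rfl; exact hν hdom)]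
    exact Submodule.zero_mem _

end HighestWeight

end UnitaryChar

/-! ### Alternants and the Laplacian -/

namespace UnitaryChar

open MvPolynomial (X C coeff monomial rename)

section Alternant

variable {ι : Type*}

theorem coe_mapDomain_perm (l : ι →₀ ℕ) (σ : Equiv.Perm ι) : ⇑(l.mapDomain σ) = l ∘ ⇑σ⁻¹ := by
  ext i
  simp [← Finsupp.equivMapDomain_eq_mapDomain, Finsupp.equivMapDomain_apply]

theorem eq_of_dotProduct_self_le [Fintype ι] {m l : ι → ℕ} (hle : m ⬝ᵥ m ≤ m ⬝ᵥ l)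
    (heq : m ⬝ᵥ m = l ⬝ᵥ l) : m = l := by
  have hsum : ∑ i, ((l i : ℤ) - m i) ^ 2 ≤ 0 := by
    simp only [dotProduct, ← sq] at hle heq
    zify at hle heq
    simp only [sub_sq, Finset.sum_add_distrib, Finset.sum_sub_distrib, mul_assoc, ← Finset.mul_sum]
    simp only [mul_comm (l _ : ℤ), ← heq]
    linarith
  ext i
  have hzero := (Finset.sum_eq_zero_iff_of_nonneg fun i _ => sq_nonneg ((l i : ℤ) - m i)).mp
    (hsum.antisymm (Finset.sum_nonneg fun i _ => sq_nonneg _)) i (Finset.mem_univ i)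
  have := pow_eq_zero_iff two_ne_zero |>.mp hzero
  omega

theorem dominated_mapDomain_perm [Fintype ι] [LinearOrder ι] {l : ι →₀ ℕ} (hl : Antitone l)
    (σ : Equiv.Perm ι) : Dominated (l.mapDomain σ) l := fun m hm => by
  rw [coe_mapDomain_perm]
  exact (hm.monovary hl).sum_mul_comp_perm_le_sum_mul

theorem exists_perm_antitone {n : ℕ} (m : Fin n → ℕ) : ∃ σ : Equiv.Perm (Fin n), Antitone (m ∘ σ) :=
  ⟨Tuple.sort (OrderDual.toDual ∘ m), fun _ _ hij =>
    Tuple.monotone_sort (OrderDual.toDual ∘ m) hij⟩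

variable [Fintype ι] [DecidableEq ι]

/-- The alternating sum of the monomials whose exponents are the permutations of `l`. -/
noncomputable def alternant (l : ι →₀ ℕ) : MvPolynomial ι ℂ :=
  ∑ σ : Equiv.Perm ι, monomial (l.mapDomain σ) (Equiv.Perm.sign σ : ℂ)

theorem eval_alternant (l : ι →₀ ℕ) (x : ι → ℂ) :
    MvPolynomial.eval x (alternant l) = (Matrix.of fun i j => x i ^ l j).det := by
  rw [alternant, map_sum, Matrix.det_apply']
  refine Finset.sum_congr rfl fun σ _ => ?_
  rw [eval_monomial_eq_mul_prod, ← Equiv.prod_comp σ]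
  simp only [Finsupp.mapDomain_apply σ.injective, Matrix.of_apply]

theorem exists_of_coeff_alternant_ne_zero {l m : ι →₀ ℕ} (h : coeff m (alternant l) ≠ 0) :
    ∃ σ : Equiv.Perm ι, l.mapDomain σ = m := by
  rw [alternant, MvPolynomial.coeff_sum] at h
  obtain ⟨σ, -, hσ⟩ := Finset.exists_ne_zero_of_sum_ne_zero h
  rw [MvPolynomial.coeff_monomial] at hσ
  exact ⟨σ, of_not_not fun hne => hσ (if_neg hne)⟩

theorem coeff_alternant_self {l : ι →₀ ℕ} (hl : Function.Injective l) :
    coeff l (alternant l) = 1 := by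
  rw [alternant, MvPolynomial.coeff_sum, Finset.sum_eq_single 1]
  · simp
  · refine fun σ _ hσ => ?_
    rw [MvPolynomial.coeff_monomial, if_neg fun h => hσ ?_]
    refine inv_eq_one.mp (Equiv.ext fun i => hl ?_)
    simpa [coe_mapDomain_perm] using DFunLike.congr_fun h i
  · simp

/-- Polynomials which a permutation of the variables multiplies by its sign. -/
def IsAlternating (q : MvPolynomial ι ℂ) : Prop :=
  ∀ σ : Equiv.Perm ι, rename σ q = C (Equiv.Perm.sign σ : ℂ) * q

theorem isAlternating_alternant (l : ι →₀ ℕ) : IsAlternating (alternant l) := fun τ => by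
  have hsign : ((Equiv.Perm.sign τ : ℤ) : ℂ) * (Equiv.Perm.sign τ : ℤ) = 1 := by
    rw [← Int.cast_mul, ← Units.val_mul, Int.units_mul_self, Units.val_one, Int.cast_one]
  rw [alternant, map_sum, Finset.mul_sum, ← Equiv.sum_comp (Equiv.mulLeft τ)
    fun σ => C (Equiv.Perm.sign τ : ℂ) * monomial (l.mapDomain σ) (Equiv.Perm.sign σ : ℂ)]
  refine Finset.sum_congr rfl fun σ _ => ?_
  rw [MvPolynomial.rename_monomial, MvPolynomial.C_mul_monomial, ← Finsupp.mapDomain_comp,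
    Equiv.coe_mulLeft, Equiv.Perm.sign_mul, Units.val_mul, Int.cast_mul, ← mul_assoc, hsign,
    one_mul, Equiv.Perm.coe_mul]

theorem IsAlternating.coeff_eq_sign_mul_coeff_mapDomain {q : MvPolynomial ι ℂ}
    (hq : IsAlternating q) (σ : Equiv.Perm ι) (m : ι →₀ ℕ) :
    coeff m q = Equiv.Perm.sign σ * coeff (m.mapDomain σ) q := by
  rw [← MvPolynomial.coeff_C_mul, ← hq σ, MvPolynomial.coeff_rename_mapDomain _ σ.injective]

theorem IsAlternating.injective_of_coeff_ne_zero {q : MvPolynomial ι ℂ} (hq : IsAlternating q)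
    {l : ι →₀ ℕ} (hl : coeff l q ≠ 0) : Function.Injective l := fun i j hij => by
  by_contra hne
  have hswap : l.mapDomain (Equiv.swap i j) = l := by
    ext k
    rw [coe_mapDomain_perm, Equiv.swap_inv, Function.comp_apply, Equiv.swap_apply_def]
    split_ifs with hi hj
    · rw [hi, hij]
    · rw [hj, hij]
    · rfl
  have hsign := hq.coeff_eq_sign_mul_coeff_mapDomain (Equiv.swap i j) l
  rw [hswap, Equiv.Perm.sign_swap hne] at hsign
  refine hl (self_eq_neg.mp ?_)
  simpa using hsign

theorem IsAlternating.eq_alternant {q : MvPolynomial ι ℂ} (hq : IsAlternating q) {l : ι →₀ ℕ}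
    (hl : coeff l q = 1) (horbit : ∀ m, coeff m q ≠ 0 → ∃ σ : Equiv.Perm ι, m.mapDomain σ = l) :
    q = alternant l := by
  have hinj := hq.injective_of_coeff_ne_zero (hl ▸ one_ne_zero)
  ext m
  by_cases hm : ∃ σ : Equiv.Perm ι, m.mapDomain σ = l
  · obtain ⟨σ, hσ⟩ := hm
    rw [hq.coeff_eq_sign_mul_coeff_mapDomain σ, hσ, hl,
      (isAlternating_alternant l).coeff_eq_sign_mul_coeff_mapDomain σ, hσ,
      coeff_alternant_self hinj]
  · rw [not_ne_iff.mp fun h => hm (horbit m h), eq_comm, ← not_ne_iff]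
    intro h
    obtain ⟨σ, rfl⟩ := exists_of_coeff_alternant_ne_zero h
    refine hm ⟨σ⁻¹, ?_⟩
    rw [← Finsupp.mapDomain_comp, ← Equiv.Perm.coe_mul, inv_mul_cancel, Equiv.Perm.coe_one,
      Finsupp.mapDomain_id]

end Alternant

section Vandermonde

variable {n : ℕ}

/-- The exponent vector `(n - 1, …, 1, 0)`. -/
noncomputable def rhoVec (n : ℕ) : Fin n →₀ ℕ := Finsupp.equivFunOnFinite.symm fun i => (i.rev : ℕ)

theorem rhoVec_strictAnti : StrictAnti (rhoVec n) := fun _ _ hij => Fin.rev_lt_rev.mpr hij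

/-- The Vandermonde polynomial. -/
noncomputable def vdm (n : ℕ) : MvPolynomial (Fin n) ℂ := ∏ i, ∏ j ∈ Finset.Ioi i, (X i - X j)

theorem eval_vdm (x : Fin n → ℂ) :
    MvPolynomial.eval x (vdm n) = ∏ i, ∏ j ∈ Finset.Ioi i, (x i - x j) := by
  simp only [vdm, map_prod, map_sub, MvPolynomial.eval_X]

theorem vdm_eq_alternant : vdm n = alternant (rhoVec n) := by
  refine MvPolynomial.funext fun x => ?_
  rw [eval_vdm, eval_alternant]
  refine Eq.trans ?_ ((Matrix.det_projVandermonde (fun _ => 1) x).symm.trans ?_)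
  · simp only [one_mul]
  · congr 1
    ext i j
    simp [Matrix.projVandermonde_apply, rhoVec]

theorem vdm_ne_zero : vdm n ≠ 0 :=
  Finset.prod_ne_zero_iff.mpr fun _ _ => Finset.prod_ne_zero_iff.mpr fun _ hj =>
    sub_ne_zero.mpr (MvPolynomial.X_injective.ne (Finset.mem_Ioi.mp hj).ne)

theorem eval_vdm_eq_zero {x : Fin n → ℂ} (hx : ¬ Function.Injective x) :
    MvPolynomial.eval x (vdm n) = 0 := by
  obtain ⟨i, j, hij, hne⟩ := Function.not_injective_iff.mp hx
  wlog hlt : i < j generalizing i j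
  · exact this j i hij.symm hne.symm ((not_lt.mp hlt).lt_of_ne' hne)
  rw [eval_vdm]
  exact Finset.prod_eq_zero (Finset.mem_univ i)
    (Finset.prod_eq_zero (Finset.mem_Ioi.mpr hlt) (sub_eq_zero.mpr hij))

theorem map_derivation_prod {ι R A K : Type*} [CommSemiring R] [CommSemiring A] [Algebra R A]
    [Field K] (D : Derivation R A A) (φ : A →+* K) {s : Finset ι} {f : ι → A}
    (hf : ∀ i ∈ s, φ (f i) ≠ 0) :
    φ (D (∏ i ∈ s, f i)) = φ (∏ i ∈ s, f i) * ∑ i ∈ s, φ (D (f i)) / φ (f i) := by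
  classical
  induction s using Finset.induction_on with
  | empty => simp
  | insert a s ha ih =>
    have hfa := hf a (Finset.mem_insert_self a s)
    rw [Finset.prod_insert ha, Finset.sum_insert ha, Derivation.leibniz, map_add, smul_eq_mul,
      smul_eq_mul, map_mul, map_mul, ih fun i hi => hf i (Finset.mem_insert_of_mem hi), map_mul]
    field_simp
    ring

theorem eval_derivation_vdm (D : Derivation ℂ (MvPolynomial (Fin n) ℂ) (MvPolynomial (Fin n) ℂ))
    {x : Fin n → ℂ} (hx : Function.Injective x) :
    MvPolynomial.eval x (D (vdm n)) = MvPolynomial.eval x (vdm n) * ∑ i, ∑ j ∈ Finset.Ioi i,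
      (MvPolynomial.eval x (D (X i)) - MvPolynomial.eval x (D (X j))) / (x i - x j) := by
  rw [vdm, Finset.prod_sigma', Finset.sum_sigma', map_derivation_prod]
  · simp only [map_sub, MvPolynomial.eval_X]
  · rintro ⟨i, j⟩ hij
    simpa [sub_eq_zero] using hx.ne (Finset.mem_Ioi.mp (Finset.mem_sigma.mp hij).2).ne

end Vandermonde

section Laplacian

/-- The Laplacian of the diagonal torus. -/
noncomputable def laplacian {ι : Type*} [Fintype ι] (p : MvPolynomial ι ℂ) : MvPolynomial ι ℂ :=
  ∑ i, euler i (euler i p)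

theorem coeff_laplacian {ι : Type*} [Fintype ι] (μ : ι →₀ ℕ) (p : MvPolynomial ι ℂ) :
    coeff μ (laplacian p) = ((μ ⬝ᵥ μ : ℕ) : ℂ) * coeff μ p := by
  simp only [laplacian, MvPolynomial.coeff_sum, coeff_euler, ← mul_assoc, ← Finset.sum_mul,
    dotProduct, Nat.cast_sum, Nat.cast_mul]

theorem laplacian_alternant {ι : Type*} [Fintype ι] [DecidableEq ι] (l : ι →₀ ℕ) :
    laplacian (alternant l) = C ((l ⬝ᵥ l : ℕ) : ℂ) * alternant l := by
  ext m
  rw [coeff_laplacian, MvPolynomial.coeff_C_mul]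
  by_cases h : coeff m (alternant l) = 0
  · rw [h, mul_zero, mul_zero]
  · obtain ⟨σ, rfl⟩ := exists_of_coeff_alternant_ne_zero h
    rw [coe_mapDomain_perm, comp_equiv_dotProduct_comp_equiv]

theorem sum_sum_Ioi_add {R : Type*} [CommRing R] {n : ℕ} (e : Fin n → R) :
    ∑ i, ∑ j ∈ Finset.Ioi i, (e i + e j) = ((n : R) - 1) * ∑ i, e i := by
  have hcompl (i : Fin n) : ∑ j ∈ {i}ᶜ, e j = ∑ j, e j - e i := by
    rw [← Finset.sum_add_sum_compl {i} e, Finset.sum_singleton, add_sub_cancel_left]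
  have hsum := Finset.sum_sum_Ioi_add_eq_sum_sum_off_diag fun j _ : Fin n => e j
  simp only [hcompl, Finset.sum_sub_distrib, Finset.sum_const, Finset.card_univ,
    Fintype.card_fin, nsmul_eq_mul] at hsum
  rw [sub_mul, one_mul, ← hsum]
  exact Finset.sum_congr rfl fun i _ => Finset.sum_congr rfl fun j _ => add_comm _ _

theorem eval_laplacian_mul_vdm {n : ℕ} (p : MvPolynomial (Fin n) ℂ) {x : Fin n → ℂ}
    (hx : Function.Injective x) :
    MvPolynomial.eval x (laplacian (p * vdm n)) = MvPolynomial.eval x (vdm n) *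
      (MvPolynomial.eval x (laplacian p) +
        ∑ i, ∑ j ∈ Finset.Ioi i, (x i + x j) * (MvPolynomial.eval x (euler i p) -
          MvPolynomial.eval x (euler j p)) / (x i - x j) +
        (n - 1) * ∑ i, MvPolynomial.eval x (euler i p) +
        (rhoVec n ⬝ᵥ rhoVec n : ℕ) * MvPolynomial.eval x p) := by
  set e : Fin n → ℂ := fun i => MvPolynomial.eval x (euler i p) with he
  have hleibniz : MvPolynomial.eval x (laplacian (p * vdm n)) =
      MvPolynomial.eval x (vdm n) * MvPolynomial.eval x (laplacian p) +
        2 * ∑ k, e k * MvPolynomial.eval x (euler k (vdm n)) +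
        MvPolynomial.eval x p * MvPolynomial.eval x (laplacian (vdm n)) := by
    simp only [laplacian, map_sum, Finset.mul_sum, ← Finset.sum_add_distrib]
    refine Finset.sum_congr rfl fun k _ => ?_
    simp only [Derivation.leibniz, smul_eq_mul, map_add, map_mul, he]
    ring
  have hsum (q : MvPolynomial (Fin n) ℂ) : MvPolynomial.eval x ((∑ k, e k • euler k) q) =
      ∑ k, e k * MvPolynomial.eval x (euler k q) := by
    rw [← Derivation.coeFnAddMonoidHom_apply, map_sum, Finset.sum_apply, map_sum]
    exact Finset.sum_congr rfl fun k _ => MvPolynomial.smul_eval _ _ _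
  have hX (i : Fin n) : ∑ k, e k * MvPolynomial.eval x (euler k (X i)) = x i * e i := by
    rw [Finset.sum_eq_single i] <;>
      simp +contextual [euler, MvPolynomial.pderiv_X, mul_comm]
  have hcross := eval_derivation_vdm (∑ k, e k • euler k) hx
  simp only [hsum, hX] at hcross
  have hpair : 2 * ∑ i, ∑ j ∈ Finset.Ioi i, (x i * e i - x j * e j) / (x i - x j) =
      ∑ i, ∑ j ∈ Finset.Ioi i, (x i + x j) * (e i - e j) / (x i - x j) +
        (n - 1) * ∑ i, e i := by
    rw [← sum_sum_Ioi_add]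
    simp only [Finset.mul_sum, ← Finset.sum_add_distrib]
    refine Finset.sum_congr rfl fun i _ => Finset.sum_congr rfl fun j hj => ?_
    have hij : x i - x j ≠ 0 := sub_ne_zero.mpr (hx.ne (Finset.mem_Ioi.mp hj).ne)
    field_simp
    ring
  have hlap : MvPolynomial.eval x (laplacian (vdm n)) =
      (rhoVec n ⬝ᵥ rhoVec n : ℕ) * MvPolynomial.eval x (vdm n) := by
    rw [vdm_eq_alternant, laplacian_alternant, map_mul, MvPolynomial.eval_C]
  rw [hleibniz, hcross, hlap]
  linear_combination MvPolynomial.eval x (vdm n) * hpair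

end Laplacian

end UnitaryChar

/-! ### The character formula -/

namespace UnitaryChar

open Matrix
open MvPolynomial (X C coeff monomial rename)

section TraceTorus

variable {ι κ : Type*} [DecidableEq ι] [Fintype κ]

/-- The polynomial `x ↦ tr (M * P (diag x))`. -/
noncomputable def traceTorus (P : Matrix κ κ (MvPolynomial (ι × ι) ℂ)) (M : Matrix κ κ ℂ) :
    MvPolynomial ι ℂ :=
  (M.map C * torus P).trace

theorem eval_traceTorus (P : Matrix κ κ (MvPolynomial (ι × ι) ℂ)) (M : Matrix κ κ ℂ) (x : ι → ℂ) :
    MvPolynomial.eval x (traceTorus P M) = (M * polyEval P (diagonal x)).trace := by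
  rw [traceTorus, AddMonoidHom.map_trace (MvPolynomial.eval x), ← map_eval_torus]
  change ((M.map C * torus P).map (MvPolynomial.eval x)).trace = _
  rw [Matrix.map_mul, map_C_map_eval]

theorem coeff_traceTorus (P : Matrix κ κ (MvPolynomial (ι × ι) ℂ)) (M : Matrix κ κ ℂ)
    (μ : ι →₀ ℕ) : coeff μ (traceTorus P M) = (M * weightProj P μ).trace := by
  simp only [traceTorus, trace, diag_apply, mul_apply, MvPolynomial.coeff_sum, Matrix.map_apply,
    MvPolynomial.coeff_C_mul, weightProj]

theorem traceTorus_sum {α : Type*} (P : Matrix κ κ (MvPolynomial (ι × ι) ℂ)) (s : Finset α)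
    (M : α → Matrix κ κ ℂ) : traceTorus P (∑ i ∈ s, M i) = ∑ i ∈ s, traceTorus P (M i) := by
  ext μ
  simp only [coeff_traceTorus, MvPolynomial.coeff_sum, Finset.sum_mul, trace_sum]

theorem traceTorus_smul (P : Matrix κ κ (MvPolynomial (ι × ι) ℂ)) (c : ℂ) (M : Matrix κ κ ℂ) :
    traceTorus P (c • M) = C c * traceTorus P M := by
  ext μ
  simp only [coeff_traceTorus, MvPolynomial.coeff_C_mul, smul_mul, trace_smul, smul_eq_mul]

variable [Fintype ι] [DecidableEq κ] {P : Matrix κ κ (MvPolynomial (ι × ι) ℂ)}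

theorem IsPolyRep.euler_traceTorus (hP : IsPolyRep P) (i : ι) (M : Matrix κ κ ℂ) :
    euler i (traceTorus P M) = traceTorus P (M * lie P i i) := by
  have hweight (μ : ι →₀ ℕ) : lie P i i * weightProj P μ = (μ i : ℂ) • weightProj P μ :=
    ext_of_mulVec_single fun a => by
      rw [← mulVec_mulVec, (hP.isWeightVec_weightProj μ _).lie_self_mulVec hP, smul_mulVec]
  ext μ
  rw [coeff_euler, coeff_traceTorus, coeff_traceTorus, mul_assoc, hweight, Matrix.mul_smul,
    trace_smul, smul_eq_mul]

/-- Conjugation by permutation matrices permutes the variables. -/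
theorem IsPolyRep.rename_traceTorus_one (hP : IsPolyRep P) (σ : Equiv.Perm ι) :
    rename σ (traceTorus P 1) = traceTorus P 1 := by
  refine MvPolynomial.funext fun x => ?_
  let A : Matrix ι ι ℂ := (1 : Matrix ι ι ℂ).submatrix σ (Equiv.refl ι)
  let B : Matrix ι ι ℂ := (1 : Matrix ι ι ℂ).submatrix (Equiv.refl ι) σ
  have hconj : diagonal (x ∘ σ) = A * (diagonal x * B) := by
    rw [← submatrix_diagonal _ _ σ.injective, ← submatrix_id_id (diagonal x), ← Equiv.coe_refl]
    simp only [A, B, submatrix_mul_equiv, mul_one, one_mul]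
    simp
  have hinv : B * A = 1 := by
    simp only [A, B, submatrix_mul_equiv, mul_one]
    exact submatrix_id_id 1
  rw [MvPolynomial.eval_rename, eval_traceTorus, eval_traceTorus, one_mul, one_mul, hconj,
    hP.map_mul, hP.map_mul, ← mul_assoc, trace_mul_comm, ← mul_assoc, ← hP.map_mul, hinv,
    hP.map_one, one_mul]

end TraceTorus

section Casimir

variable {ι κ : Type*} [Fintype ι] [DecidableEq ι] [Fintype κ] [DecidableEq κ]
  {P : Matrix κ κ (MvPolynomial (ι × ι) ℂ)}

theorem IsPolyRep.exists_sum_lie_self_eq (hP : IsPolyRep P) :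
    ∃ c : ℂ, ∑ i, lie P i i = c • 1 := by
  refine hP.eq_smul_one_of_commute fun k l => sub_eq_zero.mp ?_
  rw [Finset.mul_sum, Finset.sum_mul, ← Finset.sum_sub_distrib]
  simp only [hP.lie_bracket, Finset.sum_sub_distrib]
  simp

theorem IsPolyRep.exists_casimir_eq (hP : IsPolyRep P) :
    ∃ c : ℂ, ∑ i, ∑ j, lie P i j * lie P j i = c • 1 := by
  refine hP.eq_smul_one_of_commute fun k l => sub_eq_zero.mp ?_
  have hbracket (i j : ι) :
      lie P k l * (lie P i j * lie P j i) - lie P i j * lie P j i * lie P k l =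
      ((if i = l then lie P k j else 0) - (if k = j then lie P i l else 0)) * lie P j i +
        lie P i j * ((if j = l then lie P k i else 0) - (if k = i then lie P j l else 0)) := by
    rw [← hP.lie_bracket, ← hP.lie_bracket]
    noncomm_ring
  simp only [Finset.mul_sum, Finset.sum_mul, ← Finset.sum_sub_distrib, hbracket]
  simp only [sub_mul, mul_sub, Finset.sum_add_distrib, Finset.sum_sub_distrib, ite_mul, mul_ite,
    zero_mul, mul_zero]
  rw [Finset.sum_comm (f := fun i j => if i = l then lie P k j * lie P j i else 0),
    Finset.sum_comm (f := fun i j => if k = i then lie P i j * lie P j l else 0)]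
  simp

theorem IsPolyRep.sub_mul_eval_traceTorus_lie_mul_lie (hP : IsPolyRep P) (i j : ι) (x : ι → ℂ) :
    (x i - x j) * MvPolynomial.eval x (traceTorus P (lie P i j * lie P j i)) =
      x i * (MvPolynomial.eval x (traceTorus P (lie P i i)) -
        MvPolynomial.eval x (traceTorus P (lie P j j))) := by
  simp only [eval_traceTorus]
  have hdiag := congrArg (fun M => (lie P i j * M).trace) (hP.diagonal_mul_lie x j i)
  generalize polyEval P (diagonal x) = T at hdiag ⊢
  have hbracket := congrArg (fun M => (M * T).trace) (hP.lie_bracket i j j i)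
  have hcycle : (lie P i j * T * lie P j i).trace = (lie P j i * lie P i j * T).trace := by
    rw [trace_mul_comm, mul_assoc]
  simp only [if_true, Matrix.sub_mul, trace_sub] at hbracket
  simp only [Matrix.mul_smul, trace_smul, smul_eq_mul, ← mul_assoc, hcycle] at hdiag
  linear_combination hdiag + x i * hbracket

end Casimir

section WeylCharacter

variable {n : ℕ} {κ : Type*} [Fintype κ] [DecidableEq κ]
  {P : Matrix κ κ (MvPolynomial (Fin n × Fin n) ℂ)}

theorem IsPolyRep.sum_eval_traceTorus_lie_mul_lie (hP : IsPolyRep P) {x : Fin n → ℂ}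
    (hx : Function.Injective x) :
    ∑ i, ∑ j, MvPolynomial.eval x (traceTorus P (lie P i j * lie P j i)) =
      MvPolynomial.eval x (laplacian (traceTorus P 1)) +
        ∑ i, ∑ j ∈ Finset.Ioi i, (x i + x j) * (MvPolynomial.eval x (euler i (traceTorus P 1)) -
          MvPolynomial.eval x (euler j (traceTorus P 1))) / (x i - x j) := by
  have hsplit (i : Fin n) :
      ∑ j, MvPolynomial.eval x (traceTorus P (lie P i j * lie P j i)) =
        MvPolynomial.eval x (euler i (euler i (traceTorus P 1))) +
          ∑ j ∈ {i}ᶜ, MvPolynomial.eval x (traceTorus P (lie P i j * lie P j i)) := by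
    rw [← Finset.sum_add_sum_compl {i}, Finset.sum_singleton, hP.euler_traceTorus,
      hP.euler_traceTorus, one_mul]
  simp only [hsplit, Finset.sum_add_distrib, laplacian, map_sum]
  rw [← Finset.sum_sum_Ioi_add_eq_sum_sum_off_diag
    fun j i => MvPolynomial.eval x (traceTorus P (lie P i j * lie P j i))]
  congr 1
  refine Finset.sum_congr rfl fun i _ => Finset.sum_congr rfl fun j hj => ?_
  have hij : x i - x j ≠ 0 := sub_ne_zero.mpr (hx.ne (Finset.mem_Ioi.mp hj).ne)
  rw [eq_div_iff hij, hP.euler_traceTorus, hP.euler_traceTorus, one_mul, one_mul]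
  linear_combination hP.sub_mul_eval_traceTorus_lie_mul_lie i j x -
    hP.sub_mul_eval_traceTorus_lie_mul_lie j i x

theorem IsPolyRep.exists_laplacian_eq (hP : IsPolyRep P) :
    ∃ c : ℂ, laplacian (traceTorus P 1 * vdm n) = C c * (traceTorus P 1 * vdm n) := by
  obtain ⟨c, hcasimir⟩ := hP.exists_casimir_eq
  obtain ⟨N, hcentral⟩ := hP.exists_sum_lie_self_eq
  refine ⟨c + (n - 1) * N + (rhoVec n ⬝ᵥ rhoVec n : ℕ), ?_⟩
  refine mul_right_cancel₀ vdm_ne_zero (MvPolynomial.funext fun x => ?_)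
  rw [_root_.map_mul, _root_.map_mul _ (C _ * _)]
  by_cases hx : Function.Injective x
  swap
  · rw [eval_vdm_eq_zero hx, mul_zero, mul_zero]
  have hradial := hP.sum_eval_traceTorus_lie_mul_lie hx
  simp only [← map_sum, ← traceTorus_sum, hcasimir, traceTorus_smul] at hradial
  have hsum : ∑ i, MvPolynomial.eval x (euler i (traceTorus P 1)) =
      N * MvPolynomial.eval x (traceTorus P 1) := by
    simp only [hP.euler_traceTorus, one_mul, ← map_sum, ← traceTorus_sum, hcentral,
      traceTorus_smul, _root_.map_mul, MvPolynomial.eval_C]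
  rw [eval_laplacian_mul_vdm _ hx, hsum, ← hradial]
  simp only [_root_.map_mul, MvPolynomial.eval_C]
  ring

theorem IsPolyRep.isAlternating_traceTorus_mul_vdm (hP : IsPolyRep P) :
    IsAlternating (traceTorus P 1 * vdm n) := fun σ => by
  rw [_root_.map_mul, hP.rename_traceTorus_one, vdm_eq_alternant, isAlternating_alternant]
  ring

theorem dominated_rhoVec {ξ : Fin n →₀ ℕ} (hξ : coeff ξ (vdm n) ≠ 0) : Dominated ξ (rhoVec n) := by
  rw [vdm_eq_alternant] at hξ
  obtain ⟨σ, rfl⟩ := exists_of_coeff_alternant_ne_zero hξ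
  exact dominated_mapDomain_perm rhoVec_strictAnti.antitone σ

theorem coeff_add_rhoVec_mul_vdm {p : MvPolynomial (Fin n) ℂ} {μ : Fin n →₀ ℕ}
    (hp : ∀ ν, coeff ν p ≠ 0 → Dominated ν μ) :
    coeff (μ + rhoVec n) (p * vdm n) = coeff μ p := by
  rw [MvPolynomial.coeff_mul, Finset.sum_eq_single (μ, rhoVec n)]
  · rw [vdm_eq_alternant, coeff_alternant_self rhoVec_strictAnti.injective, mul_one]
  · rintro ⟨ν, ξ⟩ hνξ hne
    rw [Finset.HasAntidiagonal.mem_antidiagonal] at hνξ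
    by_contra hcoeff
    have hν := hp ν (left_ne_zero_of_mul hcoeff) _ rhoVec_strictAnti.antitone
    have hξ := right_ne_zero_of_mul hcoeff
    have hpair := congrArg (fun η : Fin n →₀ ℕ => rhoVec n ⬝ᵥ η) hνξ
    simp only [Finsupp.coe_add, dotProduct_add] at hpair
    have hself : rhoVec n ⬝ᵥ rhoVec n ≤ rhoVec n ⬝ᵥ ξ :=
      le_of_add_le_add_left (hpair.symm.le.trans (Nat.add_le_add_right hν _))
    have hrho : ξ = rhoVec n := by
      rw [vdm_eq_alternant] at hξ
      obtain ⟨σ, rfl⟩ := exists_of_coeff_alternant_ne_zero hξ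
      refine (DFunLike.coe_injective (eq_of_dotProduct_self_le hself ?_)).symm
      rw [coe_mapDomain_perm, comp_equiv_dotProduct_comp_equiv]
    exact hne (Prod.ext (add_right_cancel (hrho ▸ hνξ)) hrho)
  · simp

theorem dominated_add_rhoVec {p : MvPolynomial (Fin n) ℂ} {μ m : Fin n →₀ ℕ}
    (hp : ∀ ν, coeff ν p ≠ 0 → Dominated ν μ) (hm : coeff m (p * vdm n) ≠ 0) :
    Dominated m (μ + rhoVec n) := fun w hw => by
  rw [MvPolynomial.coeff_mul] at hm
  obtain ⟨⟨ν, ξ⟩, hνξ, hne⟩ := Finset.exists_ne_zero_of_sum_ne_zero hm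
  rw [← Finset.HasAntidiagonal.mem_antidiagonal.mp hνξ, Finsupp.coe_add, Finsupp.coe_add,
    dotProduct_add, dotProduct_add]
  exact add_le_add (hp ν (left_ne_zero_of_mul hne) w hw)
    (dominated_rhoVec (right_ne_zero_of_mul hne) w hw)

/-- All exponents of the Laplacian eigenfunction `traceTorus P 1 * vdm n` have the same norm as the
dominating exponent `l`, hence are permutations of `l`. -/
theorem IsPolyRep.exists_eq_alternant (hP : IsPolyRep P) :
    ∃ l : Fin n →₀ ℕ, Function.Injective l ∧ traceTorus P 1 * vdm n = alternant l := by
  obtain ⟨c, hc⟩ := hP.exists_laplacian_eq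
  obtain ⟨μ, htrace, hμ⟩ := hP.exists_highest_weight
  have hq := hP.isAlternating_traceTorus_mul_vdm
  have hcoeff (ν : Fin n →₀ ℕ) : coeff ν (traceTorus P 1) = (weightProj P ν).trace := by
    rw [coeff_traceTorus, one_mul]
  have hdom (ν : Fin n →₀ ℕ) (hν : coeff ν (traceTorus P 1) ≠ 0) : Dominated ν μ :=
    hμ ν fun h => hν (by rw [hcoeff, h, trace_zero])
  have hone : coeff (μ + rhoVec n) (traceTorus P 1 * vdm n) = 1 := by
    rw [coeff_add_rhoVec_mul_vdm hdom, hcoeff, htrace]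
  have hnorm (m : Fin n →₀ ℕ) (hm : coeff m (traceTorus P 1 * vdm n) ≠ 0) :
      ((m ⬝ᵥ m : ℕ) : ℂ) = c := mul_right_cancel₀ hm <| by
    rw [← coeff_laplacian, hc, MvPolynomial.coeff_C_mul]
  refine ⟨μ + rhoVec n, hq.injective_of_coeff_ne_zero (hone ▸ one_ne_zero),
    hq.eq_alternant hone fun m hm => ?_⟩
  obtain ⟨τ, hτ⟩ := exists_perm_antitone m
  refine ⟨τ⁻¹, DFunLike.coe_injective ?_⟩
  have hm' : coeff (m.mapDomain ⇑τ⁻¹) (traceTorus P 1 * vdm n) ≠ 0 :=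
    right_ne_zero_of_mul (hq.coeff_eq_sign_mul_coeff_mapDomain τ⁻¹ m ▸ hm)
  refine eq_of_dotProduct_self_le (dominated_add_rhoVec hdom hm' _ ?_) ?_
  · rwa [coe_mapDomain_perm, inv_inv]
  · exact_mod_cast (hnorm _ hm').trans (hnorm _ (hone ▸ one_ne_zero)).symm

theorem IsPolyRep.exists_trace_mul_prod_eq_det (hP : IsPolyRep P) :
    ∃ l : Fin n → ℕ, Function.Injective l ∧ ∀ x : Fin n → ℂ,
      (polyEval P (diagonal x)).trace * ∏ i, ∏ j ∈ Finset.Ioi i, (x i - x j) =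
        (of fun i j => x i ^ l j).det := by
  obtain ⟨l, hl, heq⟩ := hP.exists_eq_alternant
  refine ⟨l, hl, fun x => ?_⟩
  rw [← eval_alternant, ← heq, _root_.map_mul, eval_vdm, eval_traceTorus, one_mul]

end WeylCharacter

end UnitaryChar

/-! ### Products of distances -/

namespace UnitaryChar

open Matrix
open scoped Nat

section VandermondeNorm

variable {ι κ E : Type*} [Fintype ι] [Fintype κ] [NormedAddCommGroup E]

/-- The product of the mutual distances of a finite family, one factor for each unordered pair of
indices; for a family of scalars it is the modulus of the Vandermonde determinant. The square root
of the product over ordered pairs is used so that no order on the indices is needed. -/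
noncomputable def vandermondeNorm [DecidableEq ι] (f : ι → E) : ℝ :=
  √(∏ s, ∏ t, if s = t then 1 else ‖f s - f t‖)

/-- The product of the distances between the members of the two halves of a family. -/
noncomputable def crossNorm (f : ι ⊕ κ → E) : ℝ :=
  ∏ i, ∏ k, ‖f (.inl i) - f (.inr k)‖

theorem crossNorm_nonneg (f : ι ⊕ κ → E) : 0 ≤ crossNorm f :=
  Finset.prod_nonneg fun _ _ => Finset.prod_nonneg fun _ _ => norm_nonneg _

theorem crossNorm_comp_swap (f : ι ⊕ κ → E) : crossNorm (f ∘ Sum.swap) = crossNorm f := by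
  rw [crossNorm, Finset.prod_comm]
  simp only [crossNorm, Function.comp_apply, Sum.swap_inl, Sum.swap_inr, norm_sub_rev]

theorem continuous_crossNorm : Continuous (crossNorm : (ι ⊕ κ → E) → ℝ) := by
  unfold crossNorm
  fun_prop

variable [DecidableEq ι]

theorem vandermondeNorm_nonneg (f : ι → E) : 0 ≤ vandermondeNorm f := Real.sqrt_nonneg _

theorem sq_vandermondeNorm (f : ι → E) :
    vandermondeNorm f ^ 2 = ∏ s, ∏ t, if s = t then 1 else ‖f s - f t‖ := by
  refine Real.sq_sqrt (Finset.prod_nonneg fun s _ => Finset.prod_nonneg fun t _ => ?_)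
  split_ifs <;> positivity

theorem vandermondeNorm_comp_equiv [DecidableEq κ] (f : ι → E) (e : κ ≃ ι) :
    vandermondeNorm (f ∘ e) = vandermondeNorm f := by
  simp only [vandermondeNorm, ← e.prod_comp, Function.comp_apply, e.apply_eq_iff_eq]

theorem vandermondeNorm_pos {f : ι → E} (hf : Function.Injective f) : 0 < vandermondeNorm f := by
  refine Real.sqrt_pos.mpr (Finset.prod_pos fun s _ => Finset.prod_pos fun t _ => ?_)
  split_ifs with h
  · exact one_pos
  · exact norm_pos_iff.mpr (sub_ne_zero.mpr (hf.ne h))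

theorem continuous_vandermondeNorm : Continuous (vandermondeNorm : (ι → E) → ℝ) := by
  refine Real.continuous_sqrt.comp (continuous_finsetProd _ fun s _ =>
    continuous_finsetProd _ fun t _ => ?_)
  split_ifs <;> fun_prop

/-- Each distance inside the left half is at most twice the product of the distances of its two
ends to any member of the right half, because those are at least one. -/
theorem vandermondeNorm_inl_pow_le {f : ι ⊕ κ → E} (hf : ∀ i k, 1 ≤ ‖f (.inl i) - f (.inr k)‖) :
    vandermondeNorm (f ∘ Sum.inl) ^ (2 * Fintype.card κ) ≤
      2 ^ (Fintype.card ι ^ 2 * Fintype.card κ) * crossNorm f ^ (2 * Fintype.card ι) := by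
  set x := f ∘ Sum.inl
  have hpair : ∀ s t k, (if s = t then 1 else ‖x s - x t‖) ≤
      2 * (‖x s - f (.inr k)‖ * ‖x t - f (.inr k)‖) := by
    intro s t k
    have hs : 1 ≤ ‖x s - f (.inr k)‖ := hf s k
    have ht : 1 ≤ ‖x t - f (.inr k)‖ := hf t k
    split_ifs
    · nlinarith
    · have := norm_sub_le_norm_sub_add_norm_sub (x s) (f (.inr k)) (x t)
      rw [norm_sub_rev (f _)] at this
      nlinarith
  calc vandermondeNorm x ^ (2 * Fintype.card κ)
      = ∏ s, ∏ t, ∏ _k : κ, (if s = t then 1 else ‖x s - x t‖) := by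
        simp only [pow_mul, sq_vandermondeNorm, ← Finset.prod_pow, Finset.prod_const,
          Finset.card_univ]
    _ ≤ ∏ s, ∏ t, ∏ k, (2 * (‖x s - f (.inr k)‖ * ‖x t - f (.inr k)‖)) := by
        gcongr with s _ t _ k
        exact hpair s t k
    _ = _ := by
        simp only [Finset.prod_mul_distrib, Finset.prod_const, Finset.card_univ, Finset.prod_pow]
        rw [← show crossNorm f = ∏ i, ∏ k, ‖x i - f (.inr k)‖ from rfl]
        ring

variable [DecidableEq κ]

theorem vandermondeNorm_eq_mul_crossNorm (f : ι ⊕ κ → E) :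
    vandermondeNorm f =
      vandermondeNorm (f ∘ Sum.inl) * vandermondeNorm (f ∘ Sum.inr) * crossNorm f := by
  have hl := vandermondeNorm_nonneg (f ∘ Sum.inl)
  have hr := vandermondeNorm_nonneg (f ∘ Sum.inr)
  have hc := crossNorm_nonneg f
  rw [← sq_eq_sq₀ (vandermondeNorm_nonneg _) (by positivity)]
  have hswap : ∏ k, ∏ i, ‖f (.inr k) - f (.inl i)‖ = crossNorm f := by
    rw [← crossNorm_comp_swap]
    rfl
  simp only [mul_pow, sq_vandermondeNorm, Fintype.prod_sum_type, Sum.inl.injEq, Sum.inr.injEq,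
    reduceCtorEq, if_false, Finset.prod_mul_distrib, hswap, Function.comp_apply]
  rw [← crossNorm]
  ring

theorem vandermondeNorm_eq_prod_Ioi {ι : Type*} [Fintype ι] [LinearOrder ι]
    [LocallyFiniteOrderTop ι] [LocallyFiniteOrderBot ι] (f : ι → E) :
    vandermondeNorm f = ∏ i, ∏ j ∈ Finset.Ioi i, ‖f j - f i‖ := by
  rw [← sq_eq_sq₀ (vandermondeNorm_nonneg _) (by positivity), sq_vandermondeNorm, sq]
  simp only [← Finset.prod_mul_distrib]
  calc ∏ s, ∏ t, (if s = t then 1 else ‖f s - f t‖)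
      = ∏ s, ∏ t ∈ {s}ᶜ, ‖f t - f s‖ := Finset.prod_congr rfl fun s _ => by
        rw [← Finset.prod_mul_prod_compl {s}, Finset.prod_singleton, if_pos rfl, one_mul]
        refine Finset.prod_congr rfl fun t ht => ?_
        rw [if_neg (by simpa [eq_comm] using ht), norm_sub_rev]
    _ = ∏ i, ∏ j ∈ Finset.Ioi i, ‖f j - f i‖ * ‖f i - f j‖ :=
        (Finset.prod_prod_Ioi_mul_eq_prod_prod_off_diag fun j i => ‖f j - f i‖).symm
    _ = ∏ i, ∏ j ∈ Finset.Ioi i, ‖f j - f i‖ * ‖f j - f i‖ := by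
        simp only [norm_sub_rev]

theorem vandermondeNorm_eq_norm_det {𝕜 : Type*} [NormedField 𝕜] {n : ℕ} (f : Fin n → 𝕜) :
    vandermondeNorm f = ‖(vandermonde f).det‖ := by
  simp only [vandermondeNorm_eq_prod_Ioi, det_vandermonde, norm_prod]

theorem vandermondeNorm_eq_pow_mul {𝕜 : Type*} [NormedField 𝕜] {n : ℕ} {f g : Fin n → 𝕜} {c : 𝕜}
    (h : ∀ i j, f i - f j = c * (g i - g j)) :
    vandermondeNorm f = ‖c‖ ^ (∑ i : Fin n, (Finset.Ioi i).card) * vandermondeNorm g := by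
  simp only [vandermondeNorm_eq_prod_Ioi, h, norm_mul, Finset.prod_mul_distrib, Finset.prod_const,
    Finset.prod_pow_eq_pow_sum]

theorem vandermondeNorm_fin_succ {n : ℕ} (f : Fin (n + 1) → E) :
    vandermondeNorm f = (∏ i : Fin n, ‖f i.succ - f 0‖) * vandermondeNorm (f ∘ Fin.succ) := by
  simp only [vandermondeNorm_eq_prod_Ioi, Fin.prod_univ_succ, Fin.prod_Ioi_zero, Fin.prod_Ioi_succ,
    Function.comp_apply]

theorem vandermondeNorm_finVal (n : ℕ) :
    vandermondeNorm (fun i : Fin n => (i : ℝ)) = ∏ i ∈ Finset.range n, (i ! : ℝ) := by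
  rw [vandermondeNorm_eq_norm_det]
  cases n with
  | zero => simp
  | succ n =>
    rw [det_vandermonde_id_eq_superFactorial, ← Nat.prod_range_succ_factorial, Nat.cast_prod,
      norm_prod]
    simp only [Real.norm_natCast]

theorem vandermondeNorm_pow_le {f : ι ⊕ κ → E} (hf : ∀ i k, 1 ≤ ‖f (.inl i) - f (.inr k)‖) :
    vandermondeNorm f ^ (2 * (Fintype.card ι * Fintype.card κ)) ≤
      2 ^ (Fintype.card ι * Fintype.card κ * (Fintype.card ι + Fintype.card κ) ^ 2) *
        crossNorm f ^ (2 * (Fintype.card ι + Fintype.card κ) ^ 2) := by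
  have hleft := vandermondeNorm_inl_pow_le hf
  have hright := vandermondeNorm_inl_pow_le (f := f ∘ Sum.swap)
    fun k i => norm_sub_rev (f (.inl i)) _ ▸ hf i k
  rw [crossNorm_comp_swap] at hright
  set a := Fintype.card ι
  set b := Fintype.card κ
  set K := crossNorm f
  have hK1 : 1 ≤ K := Finset.one_le_prod fun i _ => Finset.one_le_prod fun k _ => hf i k
  set u := vandermondeNorm (f ∘ Sum.inl)
  set v := vandermondeNorm (f ∘ Sum.inr)
  have hu : 0 ≤ u := vandermondeNorm_nonneg _
  have hv : 0 ≤ v := vandermondeNorm_nonneg _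
  replace hright : v ^ (2 * a) ≤ 2 ^ (b ^ 2 * a) * K ^ (2 * b) := hright
  rw [vandermondeNorm_eq_mul_crossNorm]
  calc (u * v * K) ^ (2 * (a * b))
      = (u ^ (2 * b)) ^ a * (v ^ (2 * a)) ^ b * K ^ (2 * (a * b)) := by ring
    _ ≤ (2 ^ (a ^ 2 * b) * K ^ (2 * a)) ^ a * (2 ^ (b ^ 2 * a) * K ^ (2 * b)) ^ b *
        K ^ (2 * (a * b)) := by gcongr
    _ = 2 ^ (a ^ 2 * b * a + b ^ 2 * a * b) * K ^ (2 * a * a + 2 * b * b + 2 * (a * b)) := by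
        ring
    _ ≤ 2 ^ (a * b * (a + b) ^ 2) * K ^ (2 * (a + b) ^ 2) := by
        gcongr
        · norm_num
        · nlinarith [Nat.zero_le (a * b * (a * b))]
        · nlinarith [Nat.zero_le (a * b)]

theorem rpow_mul_rpow_le_crossNorm {f : ι ⊕ κ → E}
    (hf : ∀ i k, 1 ≤ ‖f (.inl i) - f (.inr k)‖) {d : ℝ} (hd : 0 < d)
    (hdf : d ≤ vandermondeNorm f) :
    d ^ ((Fintype.card ι * Fintype.card κ : ℝ) / (Fintype.card ι + Fintype.card κ) ^ 2) *
      2 ^ (-(Fintype.card ι * Fintype.card κ : ℝ) / 2) ≤ crossNorm f := by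
  have hpow := (pow_le_pow_left₀ hd.le hdf _).trans (vandermondeNorm_pow_le hf)
  have hK1 : 1 ≤ crossNorm f :=
    Finset.one_le_prod fun i _ => Finset.one_le_prod fun k _ => hf i k
  set a := Fintype.card ι
  set b := Fintype.card κ
  rcases Nat.eq_zero_or_pos (a + b) with hn | hn
  · obtain ⟨ha, -⟩ := Nat.add_eq_zero_iff.mp hn
    simpa [ha] using hK1
  have hn' : (0 : ℝ) < a + b := by exact_mod_cast hn
  refine le_of_pow_le_pow_left₀ (n := 2 * (a + b) ^ 2) (by positivity) (by positivity) ?_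
  have hd_pow : (d ^ ((a * b : ℝ) / (a + b) ^ 2)) ^ (2 * (a + b) ^ 2) = d ^ (2 * (a * b)) := by
    rw [← Real.rpow_natCast, ← Real.rpow_mul hd.le, ← Real.rpow_natCast d]
    congr 1
    push_cast
    field_simp
  have htwo_pow : ((2 : ℝ) ^ (-(a * b : ℝ) / 2)) ^ (2 * (a + b) ^ 2) =
      (2 ^ (a * b * (a + b) ^ 2))⁻¹ := by
    rw [← Real.rpow_natCast, ← Real.rpow_mul zero_le_two, ← Real.rpow_natCast,
      ← Real.rpow_neg zero_le_two]
    push_cast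
    ring_nf
  rwa [mul_pow, hd_pow, htwo_pow, ← div_eq_mul_inv, div_le_iff₀' (by positivity)]

end VandermondeNorm

end UnitaryChar

/-! ### Bounds for determinants of powers -/

namespace UnitaryChar

open Matrix
open scoped Nat

section Branching

variable {R : Type*} [CommRing R] {n : ℕ}

theorem sub_eq_mul_sum_Ico {F G : ℕ → R} {c : R} (h : ∀ m, F (m + 1) - F m = c * G m) {p q : ℕ}
    (hpq : p ≤ q) : F q - F p = c * ∑ m ∈ Finset.Ico p q, G m := by
  rw [← Finset.sum_Ico_sub F hpq, Finset.mul_sum]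
  exact Finset.sum_congr rfl fun m _ => h m

/-- Subtracting from each column its predecessor leaves `(1, 0, …, 0)` as the first row, and
each remaining entry telescopes into a sum of differences of `F`. -/
theorem det_eq_sum_interlacing (F : Fin (n + 1) → ℕ → R) (G : Fin n → ℕ → R) (c : Fin n → R)
    (hF_zero : ∀ m, F 0 m = 1) (hF : ∀ i m, F i.succ (m + 1) - F i.succ m = c i * G i m)
    {l : Fin (n + 1) → ℕ} (hl : Monotone l) :
    (of fun i j => F i (l j)).det = (∏ i, c i) *
      ∑ m ∈ Fintype.piFinset fun j : Fin n => Finset.Ico (l j.castSucc) (l j.succ),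
        (of fun i j => G i (m j)).det := by
  let B : Matrix (Fin (n + 1)) (Fin (n + 1)) R :=
    of fun i j => Fin.cases (F i (l 0)) (fun j => F i (l j.succ) - F i (l j.castSucc)) j
  let S : Matrix (Fin n) (Fin n) R :=
    of fun i j => ∑ m ∈ Finset.Ico (l j.castSucc) (l j.succ), G i m
  have hB : (of fun i j => F i (l j)).det = B.det := by
    refine det_eq_of_forall_col_eq_smul_add_pred (fun _ => 1) (fun i => ?_) fun i j => ?_ <;>
      simp [B]
  have hminor : B.det = (B.submatrix Fin.succ Fin.succ).det := by
    rw [det_succ_row_zero, Fin.sum_univ_succ]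
    simp [B, hF_zero]
  have htelescope : B.submatrix Fin.succ Fin.succ = of fun i j => c i * S i j := by
    ext i j
    exact sub_eq_mul_sum_Ico (hF i) (hl (Fin.castSucc_le_succ j))
  have hexpand : S.det = ∑ m ∈ Fintype.piFinset fun j : Fin n =>
      Finset.Ico (l j.castSucc) (l j.succ), (of fun i j => G i (m j)).det := by
    have hrows : Sᵀ = fun j => ∑ m ∈ Finset.Ico (l j.castSucc) (l j.succ), fun i => G i m := by
      ext j i
      simp [S, Finset.sum_apply]
    rw [← det_transpose, hrows]
    refine (detRowAlternating.toMultilinearMap.map_sum_finset _ _).trans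
      (Finset.sum_congr rfl fun m _ => ?_)
    exact (det_transpose (of fun i j => G i (m j)))
  rw [hB, hminor, htelescope, det_mul_column, hexpand]

theorem strictMono_of_mem_piFinset_Ico {l : Fin (n + 1) → ℕ} (hl : StrictMono l) {m : Fin n → ℕ}
    (hm : m ∈ Fintype.piFinset fun j : Fin n => Finset.Ico (l j.castSucc) (l j.succ)) :
    StrictMono m := by
  intro i j hij
  have hi := Finset.mem_Ico.mp (Fintype.mem_piFinset.mp hm i)
  have hj := Finset.mem_Ico.mp (Fintype.mem_piFinset.mp hm j)
  have : l i.succ ≤ l j.castSucc := hl.monotone (Fin.succ_le_castSucc_iff.mpr hij)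
  omega

end Branching

section TorusValues

theorem norm_det_mul_pow {ι 𝕜 : Type*} [Fintype ι] [DecidableEq ι] [NormedField 𝕜] {c : 𝕜}
    (hc : ‖c‖ = 1) (x : ι → 𝕜) (l : ι → ℕ) :
    ‖(of fun i j => (c * x i) ^ l j).det‖ = ‖(of fun i j => x i ^ l j).det‖ := by
  simp only [mul_pow]
  rw [show (of fun i j => c ^ l j * x i ^ l j) =
    of fun i j => c ^ l j * (of fun i j => x i ^ l j) i j from rfl, det_mul_row]
  simp [hc]

/-- The quotient of the two sides by `vandermondeNorm x` compares a Schur polynomial at a point of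
the unit torus with its value at `1`; branching reduces this to fewer variables. -/
theorem norm_det_pow_le_mul_det_choose {n : ℕ} (x : Fin n → ℂ) (hx : ∀ i, ‖x i‖ = 1)
    {l : Fin n → ℕ} (hl : StrictMono l) :
    ‖(of fun i j => x i ^ l j).det‖ ≤
      vandermondeNorm x * (of fun i j : Fin n => ((l j).choose i : ℝ)).det := by
  induction n with
  | zero => simp [vandermondeNorm]
  | succ n ih =>
    obtain ⟨c, y, hc, hy, hy_zero, rfl⟩ : ∃ (c : ℂ) (y : Fin (n + 1) → ℂ),
        ‖c‖ = 1 ∧ (∀ i, ‖y i‖ = 1) ∧ y 0 = 1 ∧ x = fun i => c * y i := by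
      have hx_ne : x 0 ≠ 0 := norm_ne_zero_iff.mp (by simp [hx])
      exact ⟨x 0, fun i => x i / x 0, hx 0, by simp [hx], div_self hx_ne,
        funext fun i => by field_simp⟩
    have hvandermonde : vandermondeNorm (fun i => c * y i) = vandermondeNorm y := by
      rw [vandermondeNorm_eq_pow_mul fun i j => (mul_sub c (y i) (y j)).symm, hc, one_pow, one_mul]
    rw [norm_det_mul_pow hc, hvandermonde, vandermondeNorm_fin_succ, hy_zero,
      det_eq_sum_interlacing (fun i m => y i ^ m) (fun i m => y i.succ ^ m) (fun i => y i.succ - 1)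
        (fun m => by simp [hy_zero]) (fun i m => by ring) hl.monotone,
      det_eq_sum_interlacing (fun (i : Fin (n + 1)) m => (m.choose i : ℝ))
        (fun (i : Fin n) m => (m.choose i : ℝ)) (fun _ => 1) (fun m => by simp)
        (fun i m => by rw [Fin.val_succ, Nat.choose_succ_succ]; push_cast; ring) hl.monotone,
      norm_mul, norm_prod, mul_assoc, Finset.prod_const_one, one_mul, Finset.mul_sum]
    gcongr
    exact (norm_sum_le _ _).trans (Finset.sum_le_sum fun m hm =>
      ih _ (fun i => hy i.succ) (strictMono_of_mem_piFinset_Ico hl hm))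

theorem det_choose_mul_prod_factorial {n : ℕ} (l : Fin n → ℕ) :
    (of fun i j : Fin n => ((l j).choose i : ℝ)).det * ∏ i ∈ Finset.range n, (i ! : ℝ) =
      (vandermonde fun i => (l i : ℝ)).det := by
  rw [det_eval_matrixOfPolynomials_eq_det_vandermonde (fun i => (l i : ℝ))
    (fun i => descPochhammer ℝ i) (fun i => descPochhammer_natDegree _ _)
    (fun i => monic_descPochhammer _ _), ← det_transpose, mul_comm, Finset.prod_range,
    ← det_mul_row]
  congr 1
  ext i j
  simp only [of_apply, transpose_apply, descPochhammer_eval_eq_descFactorial,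
    Nat.descFactorial_eq_factorial_mul_choose, Nat.cast_mul]

theorem norm_det_pow_mul_prod_factorial_le_of_strictMono {n : ℕ} (x : Fin n → ℂ)
    (hx : ∀ i, ‖x i‖ = 1) {l : Fin n → ℕ} (hl : StrictMono l) :
    ‖(of fun i j => x i ^ l j).det‖ * ∏ i ∈ Finset.range n, (i ! : ℝ) ≤
      vandermondeNorm x * vandermondeNorm fun i => (l i : ℝ) := by
  rw [vandermondeNorm_eq_norm_det fun i => (l i : ℝ), ← det_choose_mul_prod_factorial, norm_mul,
    Real.norm_of_nonneg (Finset.prod_nonneg fun i _ => Nat.cast_nonneg _), ← mul_assoc]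
  gcongr
  exact (norm_det_pow_le_mul_det_choose x hx hl).trans
    (mul_le_mul_of_nonneg_left (le_abs_self _) (vandermondeNorm_nonneg x))

theorem exists_equiv_strictMono {ι α : Type*} [Fintype ι] [LinearOrder α] {l : ι → α}
    (hl : Function.Injective l) : ∃ e : Fin (Fintype.card ι) ≃ ι, StrictMono (l ∘ e) := by
  let e := (Fintype.equivFin ι).symm
  exact ⟨(Tuple.sort (l ∘ e)).trans e, (Tuple.monotone_sort (l ∘ e)).strictMono_of_injective
    ((hl.comp e.injective).comp (Tuple.sort (l ∘ e)).injective)⟩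

theorem norm_det_pow_mul_prod_factorial_le {ι : Type*} [Fintype ι] [DecidableEq ι] (x : ι → ℂ)
    (hx : ∀ i, ‖x i‖ = 1) (l : ι → ℕ) :
    ‖(of fun i j => x i ^ l j).det‖ * ∏ i ∈ Finset.range (Fintype.card ι), (i ! : ℝ) ≤
      vandermondeNorm x * vandermondeNorm fun i => (l i : ℝ) := by
  by_cases hl : Function.Injective l
  · obtain ⟨e, he⟩ := exists_equiv_strictMono hl
    have := norm_det_pow_mul_prod_factorial_le_of_strictMono (x ∘ e) (fun i => hx (e i)) he
    rw [← vandermondeNorm_comp_equiv x e, ← vandermondeNorm_comp_equiv (fun i => (l i : ℝ)) e,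
      ← det_submatrix_equiv_self e]
    exact this
  · obtain ⟨i, j, hij, hne⟩ := Function.not_injective_iff.mp hl
    rw [det_zero_of_column_eq hne fun k => by simp [hij], norm_zero, zero_mul]
    exact mul_nonneg (vandermondeNorm_nonneg _) (vandermondeNorm_nonneg _)

end TorusValues

section Laplace

variable {ι κ R : Type*} [Fintype ι] [Fintype κ] [DecidableEq ι] [DecidableEq κ] [CommRing R]

open Equiv

theorem sign_mul_det_submatrix_mul_det_submatrix (M : Matrix (ι ⊕ κ) (ι ⊕ κ) R)
    (σ : Perm (ι ⊕ κ)) :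
    ((Perm.sign σ : ℤ) : R) *
        ((M.submatrix Sum.inl (σ ∘ Sum.inl)).det * (M.submatrix Sum.inr (σ ∘ Sum.inr)).det) =
      ∑ τ : Perm ι × Perm κ,
        ((Perm.sign σ : ℤ) : R) * ((Perm.sign (Perm.sumCongr τ.1 τ.2) : ℤ) : R) *
          ∏ s, M (Perm.sumCongr τ.1 τ.2 s) (σ s) := by
  rw [det_apply', det_apply', Finset.sum_mul_sum, ← Finset.sum_product', Finset.univ_product_univ,
    Finset.mul_sum]
  refine Finset.sum_congr rfl fun τ _ => ?_
  rw [Perm.sign_sumCongr, Fintype.prod_sum_type]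
  simp only [submatrix_apply, Function.comp, Perm.sumCongr_apply, Sum.map_inl, Sum.map_inr,
    Units.val_mul, Int.cast_mul]
  ring

theorem sum_sign_mul_sign_mul_prod {ι : Type*} [Fintype ι] [DecidableEq ι] (M : Matrix ι ι R)
    (τ : Perm ι) :
    ∑ σ : Perm ι, ((Perm.sign σ : ℤ) : R) * ((Perm.sign τ : ℤ) : R) * ∏ s, M (τ s) (σ s) =
      M.det := by
  rw [← det_transpose, det_apply', ← Equiv.sum_comp (Equiv.mulRight τ)]
  refine Finset.sum_congr rfl fun σ _ => ?_
  have hsign : ((Perm.sign τ : ℤ) : R) * ((Perm.sign τ : ℤ) : R) = 1 := by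
    rw [← Int.cast_mul, ← Units.val_mul, Int.units_mul_self, Units.val_one, Int.cast_one]
  simp only [Equiv.coe_mulRight, Perm.sign_mul, Units.val_mul, Int.cast_mul, Perm.mul_apply]
  rw [mul_assoc (((Perm.sign σ : ℤ) : R)), hsign, mul_one, Equiv.prod_comp τ (fun s => M s (σ s))]
  rfl

/-- Laplace expansion along the first block of rows, averaged over all permutations of the columns
so that no sum over subsets is needed. -/
theorem factorial_mul_factorial_mul_det (M : Matrix (ι ⊕ κ) (ι ⊕ κ) R) :
    ((Fintype.card ι)! * (Fintype.card κ)! : R) * M.det =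
      ∑ σ : Perm (ι ⊕ κ), ((Perm.sign σ : ℤ) : R) *
        ((M.submatrix Sum.inl (σ ∘ Sum.inl)).det * (M.submatrix Sum.inr (σ ∘ Sum.inr)).det) := by
  simp_rw [sign_mul_det_submatrix_mul_det_submatrix]
  rw [Finset.sum_comm, Finset.sum_congr rfl fun τ _ => sum_sign_mul_sign_mul_prod M _]
  simp [Fintype.card_perm, Finset.card_univ]

theorem norm_det_submatrix_mul_le {x : ι ⊕ κ → ℂ} (hx : ∀ s, ‖x s‖ = 1) (l : ι ⊕ κ → ℕ) {c : ℝ}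
    (hc : c ≤ crossNorm fun s => (l s : ℝ)) :
    ‖(of fun i j => x (.inl i) ^ l (.inl j)).det‖ * ‖(of fun i j => x (.inr i) ^ l (.inr j)).det‖ *
        ((∏ i ∈ Finset.range (Fintype.card ι), (i ! : ℝ)) *
          ∏ i ∈ Finset.range (Fintype.card κ), (i ! : ℝ)) * c ≤
      vandermondeNorm (x ∘ Sum.inl) * vandermondeNorm (x ∘ Sum.inr) *
        vandermondeNorm fun s => (l s : ℝ) := by
  have hinl := norm_det_pow_mul_prod_factorial_le (x ∘ Sum.inl) (fun i => hx _) (l ∘ Sum.inl)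
  have hinr := norm_det_pow_mul_prod_factorial_le (x ∘ Sum.inr) (fun i => hx _) (l ∘ Sum.inr)
  have hprod := mul_le_mul hinl hinr (by positivity)
    (mul_nonneg (vandermondeNorm_nonneg _) (vandermondeNorm_nonneg _))
  rw [vandermondeNorm_eq_mul_crossNorm fun s => (l s : ℝ)]
  set u := vandermondeNorm (x ∘ Sum.inl)
  set v := vandermondeNorm (x ∘ Sum.inr)
  calc _ ≤ _ := mul_le_mul_of_nonneg_left hc (by positivity)
    _ = ‖(of fun i j => x (.inl i) ^ l (.inl j)).det‖ *
          (∏ i ∈ Finset.range (Fintype.card ι), (i ! : ℝ)) *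
        (‖(of fun i j => x (.inr i) ^ l (.inr j)).det‖ *
          ∏ i ∈ Finset.range (Fintype.card κ), (i ! : ℝ)) * crossNorm fun s => (l s : ℝ) := by ring
    _ ≤ _ := mul_le_mul_of_nonneg_right hprod (crossNorm_nonneg _)
    _ = _ := by
      change u * vandermondeNorm ((fun s => (l s : ℝ)) ∘ Sum.inl) *
        (v * vandermondeNorm ((fun s => (l s : ℝ)) ∘ Sum.inr)) * _ = _
      ring

theorem norm_det_pow_mul_le {x : ι ⊕ κ → ℂ} (hx : ∀ s, ‖x s‖ = 1) (l : ι ⊕ κ → ℕ) {c : ℝ}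
    (hc_nonneg : 0 ≤ c) (hc : ∀ σ : Perm (ι ⊕ κ), c ≤ crossNorm fun s => (l (σ s) : ℝ)) :
    ‖(of fun s t => x s ^ l t).det‖ * ((Fintype.card ι)! * (Fintype.card κ)! *
        ((∏ i ∈ Finset.range (Fintype.card ι), (i ! : ℝ)) *
          ∏ i ∈ Finset.range (Fintype.card κ), (i ! : ℝ))) * c ≤
      (Fintype.card ι + Fintype.card κ)! * (vandermondeNorm (x ∘ Sum.inl) *
        vandermondeNorm (x ∘ Sum.inr) * vandermondeNorm fun s => (l s : ℝ)) := by
  have hexpand := congrArg norm (factorial_mul_factorial_mul_det (of fun s t => x s ^ l t))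
  rw [norm_mul, norm_mul, Complex.norm_natCast, Complex.norm_natCast] at hexpand
  set S := (∏ i ∈ Finset.range (Fintype.card ι), (i ! : ℝ)) *
    ∏ i ∈ Finset.range (Fintype.card κ), (i ! : ℝ)
  set V := vandermondeNorm (x ∘ Sum.inl) * vandermondeNorm (x ∘ Sum.inr) *
    vandermondeNorm fun s => (l s : ℝ)
  have hterm (σ : Perm (ι ⊕ κ)) : ‖((Perm.sign σ : ℤ) : ℂ) *
      (((of fun s t => x s ^ l t).submatrix Sum.inl (σ ∘ Sum.inl)).det *
        ((of fun s t => x s ^ l t).submatrix Sum.inr (σ ∘ Sum.inr)).det)‖ * (S * c) ≤ V := by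
    have hsign : ‖((Perm.sign σ : ℤ) : ℂ)‖ = 1 := by
      rcases Int.units_eq_one_or (Perm.sign σ) with h | h <;> simp [h]
    rw [norm_mul, hsign, one_mul, norm_mul, ← mul_assoc]
    refine (norm_det_submatrix_mul_le hx (l ∘ σ) (hc σ)).trans_eq ?_
    exact congrArg _ (vandermondeNorm_comp_equiv (fun s => (l s : ℝ)) σ)
  calc _ = ((Fintype.card ι)! * (Fintype.card κ)! * ‖(of fun s t => x s ^ l t).det‖) * (S * c) := by
        ring
    _ ≤ ∑ _σ : Perm (ι ⊕ κ), V := by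
        rw [hexpand]
        refine (mul_le_mul_of_nonneg_right (norm_sum_le _ _) (by positivity)).trans ?_
        rw [Finset.sum_mul]
        exact Finset.sum_le_sum fun σ _ => hterm σ
    _ = _ := by simp [Finset.card_univ, Fintype.card_perm]

end Laplace

end UnitaryChar

/-! ### The character bound on the diagonal torus -/

namespace UnitaryChar

open Matrix Filter Topology
open scoped Nat

section Dense

theorem dense_setOf_injective {ι X : Type*} [Finite ι] [TopologicalSpace X] [T2Space X]
    [PerfectSpace X] : Dense {x : ι → X | Function.Injective x} := by
  classical
  have hdense (p : ι × ι) (hp : p.1 ≠ p.2) : Dense {x : ι → X | x p.1 ≠ x p.2} := by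
    intro x
    by_cases hx : x p.1 = x p.2
    · have hlim : Tendsto (Function.update x p.1) (𝓝[≠] x p.1) (𝓝 x) := by
        have := (continuous_const.update p.1 continuous_id : Continuous (Function.update x p.1))
          |>.tendsto (x p.1)
        rw [Function.update_eq_self] at this
        exact this.mono_left nhdsWithin_le_nhds
      refine mem_closure_of_tendsto hlim (eventually_mem_nhdsWithin.mono fun y hy => ?_)
      simpa [Function.update_of_ne hp.symm, ← hx] using hy
    · exact subset_closure hx
  have heq : {x : ι → X | Function.Injective x} =
      ⋂₀ ((fun p : ι × ι => {x : ι → X | x p.1 ≠ x p.2}) '' {p | p.1 ≠ p.2}) := by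
    ext x
    simp [Function.Injective, not_imp_not]
  rw [heq]
  refine ((Set.toFinite _).image _).dense_sInter ?_ ?_
  · rintro _ ⟨p, -, rfl⟩
    exact isOpen_ne_fun (continuous_apply _) (continuous_apply _)
  · rintro _ ⟨p, hp, rfl⟩
    exact hdense p hp

theorem nontrivial_circle : Nontrivial Circle :=
  ⟨Circle.exp Real.pi, 1, fun h =>
    (by norm_num : (-1 : ℂ) ≠ 1) (by simpa using Circle.ext_iff.mp h)⟩

theorem perfectSpace_circle : PerfectSpace Circle :=
  have := nontrivial_circle
  perfectSpace_iff_forall_not_isolated.mpr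
    ConnectedSpace.neBot_nhdsWithin_compl_of_nontrivial_of_t1space

end Dense

section WeylDimension

theorem vandermondeNorm_ofReal {ι : Type*} [Fintype ι] [DecidableEq ι] (f : ι → ℝ) :
    vandermondeNorm (fun i => (f i : ℂ)) = vandermondeNorm f := by
  simp only [vandermondeNorm, ← Complex.ofReal_sub, Complex.norm_real]

variable {κ : Type*} [Fintype κ]

theorem continuous_trace_polyEval_diagonal {ι : Type*} [DecidableEq ι]
    (P : Matrix κ κ (MvPolynomial (ι × ι) ℂ)) :
    Continuous fun x : ι → ℂ => (polyEval P (diagonal x)).trace := by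
  classical
  have heq : (fun x : ι → ℂ => (polyEval P (diagonal x)).trace) =
      fun x => MvPolynomial.eval x (traceTorus P 1) := by
    ext x
    rw [eval_traceTorus, one_mul]
  exact heq ▸ MvPolynomial.continuous_eval _

variable [DecidableEq κ] {n : ℕ}

theorem IsPolyRep.exists_norm_trace_mul_vandermondeNorm_eq
    {P : Matrix κ κ (MvPolynomial (Fin n × Fin n) ℂ)} (hP : IsPolyRep P) :
    ∃ l : Fin n → ℕ, Function.Injective l ∧ ∀ x : Fin n → ℂ,
      ‖(polyEval P (diagonal x)).trace‖ * vandermondeNorm x =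
        ‖(of fun i j => x i ^ l j).det‖ := by
  obtain ⟨l, hl_inj, hl⟩ := hP.exists_trace_mul_prod_eq_det
  refine ⟨l, hl_inj, fun x => ?_⟩
  rw [← hl x, norm_mul, vandermondeNorm_eq_prod_Ioi]
  simp only [norm_prod, norm_sub_rev]

/-- The quotient of the Weyl character formula at `x i = q ^ i`, with numerator and denominator
divided by the same power of `q - 1`, is continuous at `q = 1`. -/
theorem IsPolyRep.card_mul_prod_factorial_eq {P : Matrix κ κ (MvPolynomial (Fin n × Fin n) ℂ)}
    (hP : IsPolyRep P) {l : Fin n → ℕ}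
    (hl : ∀ x : Fin n → ℂ, ‖(polyEval P (diagonal x)).trace‖ * vandermondeNorm x =
      ‖(of fun i j => x i ^ l j).det‖) :
    (Fintype.card κ : ℝ) * ∏ i ∈ Finset.range n, (i ! : ℝ) =
      vandermondeNorm fun i => (l i : ℝ) := by
  let qNumber (m : ℕ) (q : ℂ) : ℂ := ∑ k ∈ Finset.range m, q ^ k
  have hq_sub (q : ℂ) (k m : ℕ) : q ^ k - q ^ m = (q - 1) * (qNumber k q - qNumber m q) := by
    rw [mul_sub, mul_geom_sum, mul_geom_sum, sub_sub_sub_cancel_right]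
  have hq_cont (m : ℕ) : Continuous (qNumber m) := by fun_prop
  let f (q : ℂ) : ℂ := (polyEval P (diagonal fun i : Fin n => q ^ (i : ℕ))).trace
  have hf : Continuous f :=
    (continuous_trace_polyEval_diagonal P).comp (by fun_prop)
  have hne (q : ℂ) (hq : q ≠ 1) : ‖f q‖ * vandermondeNorm (fun i : Fin n => qNumber i q) =
      vandermondeNorm fun i => qNumber (l i) q := by
    have h := hl fun i => q ^ (i : ℕ)
    have hdet : (of fun i j : Fin n => (q ^ (i : ℕ)) ^ l j) = (vandermonde fun j => q ^ l j)ᵀ := by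
      ext i j
      simp only [of_apply, transpose_apply, vandermonde_apply, ← pow_mul, mul_comm]
    rw [hdet, det_transpose, ← vandermondeNorm_eq_norm_det,
      vandermondeNorm_eq_pow_mul fun i j : Fin n => hq_sub q i j,
      vandermondeNorm_eq_pow_mul fun i j => hq_sub q (l i) (l j), mul_left_comm] at h
    exact mul_left_cancel₀ (pow_ne_zero _ (norm_ne_zero_iff.mpr (sub_ne_zero.mpr hq))) h
  have hq_norm_cont (k : Fin n → ℕ) :
      Continuous fun q => vandermondeNorm fun i => qNumber (k i) q :=
    continuous_vandermondeNorm.comp (continuous_pi fun i => hq_cont (k i))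
  have heq : ‖f 1‖ * vandermondeNorm (fun i : Fin n => qNumber i 1) =
      vandermondeNorm fun i => qNumber (l i) 1 :=
    congrFun (Continuous.ext_on (dense_compl_singleton (1 : ℂ))
      (hf.norm.mul (hq_norm_cont fun i => i)) (hq_norm_cont l) hne) 1
  have hq_one (m : ℕ) : qNumber m 1 = ((m : ℝ) : ℂ) := by simp [qNumber]
  have hf_one : ‖f 1‖ = Fintype.card κ := by
    simp only [f, one_pow, diagonal_one, hP.map_one, trace_one, Complex.norm_natCast]
  rw [← vandermondeNorm_finVal, ← hf_one, ← vandermondeNorm_ofReal, ← vandermondeNorm_ofReal]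
  simpa only [hq_one] using heq

end WeylDimension

section FactorialBounds

theorem choose_add_le_pow (a b : ℕ) : (a + b).choose a ≤ (b + 1) ^ a := by
  induction a with
  | zero => simp
  | succ a ih =>
    have h := Nat.add_one_mul_choose_eq (a + b) a
    refine Nat.le_of_mul_le_mul_right (c := a + 1) ?_ a.succ_pos
    rw [show a + 1 + b = a + b + 1 by ring, ← h]
    calc (a + b + 1) * (a + b).choose a ≤ ((b + 1) * (a + 1)) * (b + 1) ^ a :=
          Nat.mul_le_mul (by nlinarith [Nat.zero_le (a * b)]) ih
      _ = _ := by ring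

theorem choose_add_le_two_pow (a b : ℕ) : (a + b).choose a ≤ 2 ^ (a * b) :=
  (choose_add_le_pow a b).trans <| by
    rw [mul_comm, pow_mul]
    exact Nat.pow_le_pow_left Nat.lt_two_pow_self a

theorem prod_factorial_add_le (a b : ℕ) : ∏ i ∈ Finset.range (a + b), i ! ≤
    (∏ i ∈ Finset.range a, i !) * (∏ i ∈ Finset.range b, i !) * (a + b - 1) ^ (a * b) := by
  rw [Finset.prod_range_add, mul_assoc, pow_mul]
  refine Nat.mul_le_mul_left _ ?_
  calc ∏ i ∈ Finset.range b, (a + i)! ≤ ∏ i ∈ Finset.range b, i ! * (a + b - 1) ^ a := by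
        refine Finset.prod_le_prod' fun i hi => ?_
        have hi := Finset.mem_range.mp hi
        rw [add_comm, ← Nat.factorial_mul_ascFactorial]
        refine Nat.mul_le_mul_left _ ((Nat.ascFactorial_le_pow_add i a).trans ?_)
        exact Nat.pow_le_pow_left (by omega) a
    _ = _ := by rw [Finset.prod_mul_distrib, Finset.prod_const, Finset.card_range]

theorem factorial_mul_prod_factorial_add_le (a b : ℕ) :
    (a + b)! * ∏ i ∈ Finset.range (a + b), i ! ≤
      a ! * b ! * ((∏ i ∈ Finset.range a, i !) * ∏ i ∈ Finset.range b, i !) *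
        (2 * (a + b - 1)) ^ (a * b) := by
  rw [← Nat.add_choose_mul_factorial_mul_factorial, ← Nat.choose_symm_add]
  calc _ ≤ 2 ^ (a * b) * a ! * b ! * _ :=
        Nat.mul_le_mul (by gcongr; exact choose_add_le_two_pow a b) (prod_factorial_add_le a b)
    _ = _ := by ring

theorem two_mul_sub_one_mul_sqrt_two_le (n : ℕ) :
    ((2 * (n - 1) : ℕ) : ℝ) * √2 ≤ (n : ℝ) ^ 2 := by
  cases n with
  | zero => simp
  | succ m =>
    have hsqrt : √2 ≤ 2 := Real.sqrt_le_self_iff.mpr (by norm_num)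
    push_cast [Nat.add_sub_cancel]
    nlinarith [sq_nonneg ((m : ℝ) - 1), mul_le_mul_of_nonneg_left hsqrt m.cast_nonneg]

theorem le_pow_mul_rpow_of_mul_factorials_le {a b : ℕ} {y d t : ℝ} (hd : 0 < d)
    (h : y * (a ! * b ! * ((∏ i ∈ Finset.range a, (i ! : ℝ)) * ∏ i ∈ Finset.range b, (i ! : ℝ))) *
        (d ^ t * 2 ^ (-(a * b : ℝ) / 2)) ≤
      (a + b)! * (d * ∏ i ∈ Finset.range (a + b), (i ! : ℝ))) :
    y ≤ (a + b : ℕ) ^ (2 * (a * b)) * d ^ (1 - t) := by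
  set F : ℝ := a ! * b ! * ((∏ i ∈ Finset.range a, (i ! : ℝ)) * ∏ i ∈ Finset.range b, (i ! : ℝ))
  have hF : 0 < F := by positivity
  have hfactorial : (a + b)! * ∏ i ∈ Finset.range (a + b), (i ! : ℝ) ≤
      F * (2 * (a + b - 1) : ℕ) ^ (a * b) := by
    simp only [F]
    exact_mod_cast factorial_mul_prod_factorial_add_le a b
  have hsqrt : (2 : ℝ) ^ (-(a * b : ℝ) / 2) * √2 ^ (a * b) = 1 := by
    rw [Real.sqrt_eq_rpow, ← Real.rpow_mul_natCast zero_le_two, ← Real.rpow_add zero_lt_two]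
    push_cast
    ring_nf
    exact Real.rpow_zero 2
  have hd_split : d = d ^ (1 - t) * d ^ t := by
    rw [← Real.rpow_add hd, sub_add_cancel, Real.rpow_one]
  rw [mul_assoc] at h
  refine le_of_mul_le_mul_right (h.trans ?_) (show 0 < F * (d ^ t * 2 ^ (-(a * b : ℝ) / 2)) by
    positivity)
  calc _ = d * ((a + b)! * ∏ i ∈ Finset.range (a + b), (i ! : ℝ)) := by ring
    _ ≤ d * (F * (2 * (a + b - 1) : ℕ) ^ (a * b)) := by gcongr
    _ = d ^ (1 - t) * d ^ t * (F * (2 * (a + b - 1) : ℕ) ^ (a * b)) *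
          (2 ^ (-(a * b : ℝ) / 2) * √2 ^ (a * b)) := by rw [hsqrt, ← hd_split, mul_one]
    _ = ((2 * (a + b - 1) : ℕ) * √2) ^ (a * b) * d ^ (1 - t) *
          (F * (d ^ t * 2 ^ (-(a * b : ℝ) / 2))) := by ring
    _ ≤ _ := by
      rw [pow_mul _ 2]
      gcongr
      exact two_mul_sub_one_mul_sqrt_two_le (a + b)

end FactorialBounds

section TorusBound

variable {α β ι κ : Type*} [Fintype α] [Fintype β] [Fintype ι] [DecidableEq ι] [Fintype κ]

theorem norm_trace_mul_crossNorm_mul_le_of_injective {P : Matrix κ κ (MvPolynomial (ι × ι) ℂ)}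
    {l : ι → ℕ}
    (hl : ∀ x : ι → ℂ, ‖(polyEval P (diagonal x)).trace‖ * vandermondeNorm x =
      ‖(of fun i j => x i ^ l j).det‖)
    (e : α ⊕ β ≃ ι) {c : ℝ} (hc_nonneg : 0 ≤ c)
    (hc : ∀ σ : Equiv.Perm (α ⊕ β), c ≤ crossNorm fun s => (l (e (σ s)) : ℝ))
    {x : ι → ℂ} (hx : Function.Injective x) (hx_norm : ∀ i, ‖x i‖ = 1) :
    ‖(polyEval P (diagonal x)).trace‖ * crossNorm (fun s => x (e s)) *
        ((Fintype.card α)! * (Fintype.card β)! *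
          ((∏ i ∈ Finset.range (Fintype.card α), (i ! : ℝ)) *
            ∏ i ∈ Finset.range (Fintype.card β), (i ! : ℝ))) * c ≤
      (Fintype.card α + Fintype.card β)! * vandermondeNorm fun i => (l i : ℝ) := by
  classical
  let y := x ∘ e
  have hbound := norm_det_pow_mul_le (x := y) (fun s => hx_norm (e s)) (l ∘ e) hc_nonneg hc
  have hdet : (of fun s t => y s ^ (l ∘ e) t).det = (of fun i j => x i ^ l j).det :=
    det_submatrix_equiv_self e (of fun i j => x i ^ l j)
  have hl_comp : (vandermondeNorm fun s => ((l ∘ e) s : ℝ)) = vandermondeNorm fun i => (l i : ℝ) :=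
    vandermondeNorm_comp_equiv (fun i => (l i : ℝ)) e
  rw [hdet, ← hl x, ← vandermondeNorm_comp_equiv x e, vandermondeNorm_eq_mul_crossNorm,
    hl_comp] at hbound
  have hpos : 0 < vandermondeNorm (y ∘ Sum.inl) * vandermondeNorm (y ∘ Sum.inr) :=
    mul_pos (vandermondeNorm_pos ((hx.comp e.injective).comp Sum.inl_injective))
      (vandermondeNorm_pos ((hx.comp e.injective).comp Sum.inr_injective))
  refine le_of_mul_le_mul_left ?_ hpos
  change _ * (_ * crossNorm y * _ * _) ≤ _
  convert hbound using 1 <;> ring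

theorem norm_trace_mul_crossNorm_mul_le {P : Matrix κ κ (MvPolynomial (ι × ι) ℂ)} {l : ι → ℕ}
    (hl : ∀ x : ι → ℂ, ‖(polyEval P (diagonal x)).trace‖ * vandermondeNorm x =
      ‖(of fun i j => x i ^ l j).det‖)
    (e : α ⊕ β ≃ ι) {c : ℝ} (hc_nonneg : 0 ≤ c)
    (hc : ∀ σ : Equiv.Perm (α ⊕ β), c ≤ crossNorm fun s => (l (e (σ s)) : ℝ)) (x : ι → Circle) :
    ‖(polyEval P (diagonal fun i => (x i : ℂ))).trace‖ * crossNorm (fun s => (x (e s) : ℂ)) *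
        ((Fintype.card α)! * (Fintype.card β)! *
          ((∏ i ∈ Finset.range (Fintype.card α), (i ! : ℝ)) *
            ∏ i ∈ Finset.range (Fintype.card β), (i ! : ℝ))) * c ≤
      (Fintype.card α + Fintype.card β)! * vandermondeNorm fun i => (l i : ℝ) := by
  have := perfectSpace_circle
  have hcoe : Continuous fun (x : ι → Circle) i => (x i : ℂ) := by fun_prop
  have htrace : Continuous fun x : ι → Circle =>
      (polyEval P (diagonal fun i => (x i : ℂ))).trace :=
    (continuous_trace_polyEval_diagonal P).comp hcoe
  have hcross : Continuous fun x : ι → Circle => crossNorm fun s => (x (e s) : ℂ) :=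
    continuous_crossNorm.comp (by fun_prop)
  revert x
  refine isClosed_property dense_setOf_injective.denseRange_val
    (isClosed_le (((htrace.norm.mul hcross).mul_const _).mul_const _) continuous_const) fun x => ?_
  exact norm_trace_mul_crossNorm_mul_le_of_injective hl e hc_nonneg hc
    (Subtype.val_injective.comp x.2) fun i => Circle.norm_coe _

theorem one_le_norm_natCast_sub_of_injective {ι : Type*} {l : ι → ℕ} (hl : Function.Injective l)
    {s t : ι} (hst : s ≠ t) : 1 ≤ ‖(l s : ℝ) - l t‖ := by
  rw [← dist_eq_norm, Nat.dist_cast_real]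
  exact Nat.pairwise_one_le_dist (hl.ne hst)

theorem IsPolyRep.norm_trace_mul_crossNorm_le [DecidableEq κ] {n : ℕ}
    {P : Matrix κ κ (MvPolynomial (Fin n × Fin n) ℂ)} (hP : IsPolyRep P) (e : α ⊕ β ≃ Fin n)
    (x : Fin n → Circle) :
    ‖(polyEval P (diagonal fun i => (x i : ℂ))).trace‖ * crossNorm (fun s => (x (e s) : ℂ)) ≤
      (n : ℝ) ^ (2 * (Fintype.card α * Fintype.card β)) *
        (Fintype.card κ : ℝ) ^ (1 - (Fintype.card α * Fintype.card β : ℝ) / n ^ 2) := by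
  classical
  obtain ⟨l, hl_inj, hl⟩ := hP.exists_norm_trace_mul_vandermondeNorm_eq
  have hdim := hP.card_mul_prod_factorial_eq hl
  have := hP.nonempty
  have hn : Fintype.card α + Fintype.card β = n := by
    rw [← Fintype.card_sum, Fintype.card_congr e, Fintype.card_fin]
  have hd : (0 : ℝ) < Fintype.card κ := Nat.cast_pos.mpr Fintype.card_pos
  have hd_le (σ : Equiv.Perm (α ⊕ β)) :
      (Fintype.card κ : ℝ) ≤ vandermondeNorm fun s => (l (e (σ s)) : ℝ) := by
    refine le_of_le_of_eq ?_ (vandermondeNorm_comp_equiv (fun i => (l i : ℝ)) (σ.trans e)).symm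
    rw [← hdim]
    exact le_mul_of_one_le_right hd.le (Finset.one_le_prod fun i _ =>
      Nat.one_le_cast.mpr (Nat.factorial_pos i))
  have hcross (σ : Equiv.Perm (α ⊕ β)) :=
    rpow_mul_rpow_le_crossNorm (f := fun s => (l (e (σ s)) : ℝ)) (fun i k =>
      one_le_norm_natCast_sub_of_injective ((hl_inj.comp e.injective).comp σ.injective)
        Sum.inl_ne_inr) hd (hd_le σ)
  have hbound := norm_trace_mul_crossNorm_mul_le hl e (by positivity) hcross x
  rw [← hdim] at hbound
  subst hn
  exact_mod_cast le_pow_mul_rpow_of_mul_factorials_le hd hbound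

end TorusBound

end UnitaryChar

/-! ### Separated spectrum -/

namespace UnitaryChar

open Matrix

section Diagonalization

open Unitary selfAdjoint
open scoped Matrix.Norms.L2Operator

variable {ι : Type*} [Fintype ι] [DecidableEq ι]

theorem exists_circle_neg_one_notMem_spectrum_smul (A : Matrix ι ι ℂ) :
    ∃ z : Circle, -1 ∉ spectrum ℂ ((z : ℂ) • A) := by
  have := nontrivial_circle
  have := PreconnectedSpace.infinite (X := Circle)
  have hfinite : {w : Circle | (w : ℂ) ∈ spectrum ℂ A}.Finite :=
    A.finite_spectrum.preimage Subtype.val_injective.injOn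
  obtain ⟨w, hw : (w : ℂ) ∉ spectrum ℂ A⟩ := hfinite.exists_notMem
  refine ⟨-w⁻¹, fun h => hw ?_⟩
  have hsmul : Circle.toUnits (-w⁻¹) • (w : ℂ) = -1 := by
    rw [Units.smul_def, Circle.toUnits_apply, Units.val_mk0, Circle.coe_neg, Circle.coe_inv,
      smul_eq_mul, neg_mul, inv_mul_cancel₀ w.coe_ne_zero]
  rw [← hsmul] at h
  exact spectrum.smul_mem_smul_iff.mp h

theorem exists_exp_I_smul_eq_mul_diagonal_mul_star {H : Matrix ι ι ℂ} (hH : H.IsHermitian) :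
    ∃ (V : unitaryGroup ι ℂ) (x : ι → Circle), NormedSpace.exp (Complex.I • H) =
      V * diagonal (fun i => (x i : ℂ)) * star (V : Matrix ι ι ℂ) := by
  let V := hH.eigenvectorUnitary
  refine ⟨V, fun i => Circle.exp (hH.eigenvalues i), ?_⟩
  have hV_inv : (V : Matrix ι ι ℂ)⁻¹ = star (V : Matrix ι ι ℂ) :=
    inv_eq_left_inv (coe_star_mul_self V)
  have hH_eq : Complex.I • H =
      V * diagonal (fun i => Complex.I * hH.eigenvalues i) * (V : Matrix ι ι ℂ)⁻¹ := by
    conv_lhs => rw [hH.spectral_theorem, conjStarAlgAut_apply, ← smul_mul_assoc, ← mul_smul_comm,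
      ← diagonal_smul]
    rw [hV_inv]
    rfl
  rw [hH_eq, exp_conj _ _ (isUnit_coe (U := V)), hV_inv, exp_diagonal]
  congr 3
  ext i
  simp [Pi.coe_exp, Complex.exp_eq_exp_ℂ, mul_comm]

/-- A unitary matrix without eigenvalue `-1` is `exp (i H)` with `H` Hermitian; any other one is
rotated into this case by a scalar. -/
theorem exists_eq_mul_diagonal_mul_star {A : Matrix ι ι ℂ} (hA : A ∈ unitaryGroup ι ℂ) :
    ∃ (V : unitaryGroup ι ℂ) (x : ι → Circle),
      A = V * diagonal (fun i => (x i : ℂ)) * star (V : Matrix ι ι ℂ) := by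
  obtain ⟨z, hz⟩ := exists_circle_neg_one_notMem_spectrum_smul A
  have hzA : (z : ℂ) • A ∈ unitaryGroup ι ℂ := by
    rw [mem_unitaryGroup_iff] at hA ⊢
    rw [star_smul, smul_mul_smul_comm, hA]
    simp [Complex.mul_conj, Circle.normSq_coe]
  let u : unitary (Matrix ι ι ℂ) := ⟨(z : ℂ) • A, hzA⟩
  obtain ⟨V, x, hx⟩ := exists_exp_I_smul_eq_mul_diagonal_mul_star (argSelfAdjoint u).2
  rw [← expUnitary_coe, expUnitary_argSelfAdjoint ((norm_sub_one_lt_two_iff hzA).mpr hz)] at hx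
  refine ⟨V, fun i => z⁻¹ * x i, ?_⟩
  have hdiag : diagonal (fun i => ((z⁻¹ * x i : Circle) : ℂ)) =
      (z : ℂ)⁻¹ • diagonal fun i => (x i : ℂ) := by
    ext i j
    simp [diagonal_apply]
  rw [hdiag, mul_smul_comm, smul_mul_assoc, ← hx, inv_smul_smul₀ z.coe_ne_zero]

end Diagonalization

theorem eigenvalues_eq_map_of_eq_mul_diagonal_mul_star {n : ℕ} {g V : U n} {x : Fin n → ℂ}
    (hg : (g : Matrix (Fin n) (Fin n) ℂ) =
      V * diagonal x * star (V : Matrix (Fin n) (Fin n) ℂ)) :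
    eigenvalues g = Finset.univ.val.map x := by
  rw [eigenvalues, hg, mul_assoc, charpoly_mul_comm, mul_assoc, Unitary.coe_star_mul_self, mul_one,
    charpoly_diagonal,
    Polynomial.roots_prod _ _ (Finset.prod_ne_zero_iff.2 fun i _ => Polynomial.X_sub_C_ne_zero _)]
  simp [Multiset.bind_singleton]

theorem exists_finset_map_val_eq {ι α : Type*} [Fintype ι] [DecidableEq ι] {f : ι → α}
    {Q R : Multiset α} (h : Q + R = Finset.univ.val.map f) :
    ∃ t : Finset ι, Q = t.val.map f ∧ R = tᶜ.val.map f := by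
  rw [← Multiset.rel_eq, Multiset.rel_map_right, Multiset.rel_add_left] at h
  obtain ⟨s₁, s₂, h₁, h₂, hs⟩ := h
  rw [← Multiset.rel_map_right, Multiset.rel_eq] at h₁ h₂
  have hs₁ : s₁.Nodup := Multiset.nodup_of_le (hs ▸ Multiset.le_add_right s₁ s₂) Finset.univ.nodup
  refine ⟨⟨s₁, hs₁⟩, h₁, ?_⟩
  rw [Finset.compl_eq_univ_sdiff, Finset.sdiff_val, hs, add_tsub_cancel_left, h₂]

section SeparatedSpectrum

theorem pow_le_crossNorm {ι κ E : Type*} [Fintype ι] [Fintype κ] [NormedAddCommGroup E]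
    {f : ι ⊕ κ → E} {ε : ℝ} (hε : 0 ≤ ε) (h : ∀ i k, ε ≤ ‖f (.inl i) - f (.inr k)‖) :
    ε ^ (Fintype.card ι * Fintype.card κ) ≤ crossNorm f :=
  calc ε ^ (Fintype.card ι * Fintype.card κ) = ∏ _i : ι, ∏ _k : κ, ε := by
        simp [← pow_mul, mul_comm]
    _ ≤ crossNorm f := Finset.prod_le_prod (fun _ _ => Finset.prod_nonneg fun _ _ => hε)
        fun i _ => Finset.prod_le_prod (fun _ _ => hε) fun k _ => h i k

theorem IsPolyRep.trace_conj {ι κ : Type*} [Fintype ι] [DecidableEq ι] [Fintype κ] [DecidableEq κ]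
    {P : Matrix κ κ (MvPolynomial (ι × ι) ℂ)} (hP : IsPolyRep P) {S S' : Matrix ι ι ℂ}
    (h : S' * S = 1) (X : Matrix ι ι ℂ) :
    (polyEval P (S * X * S')).trace = (polyEval P X).trace := by
  rw [hP.map_mul, trace_mul_comm, ← hP.map_mul, ← mul_assoc, h, one_mul]

variable {n : ℕ} {ρ : U n → ℂ}

theorem one_le_degree (hρ : ρ ∈ Irr (U n)) : 1 ≤ degree ρ := by
  obtain ⟨m, π, hirr, hπ, rfl⟩ := hρ
  obtain ⟨-, P, hP, -⟩ := exists_isPolyRep hirr hπ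
  have hm : 1 ≤ m := Fin.pos_iff_nonempty.mpr hP.nonempty
  simpa [degree] using hm

theorem norm_mul_crossNorm_le_of_eq_mul_diagonal_mul_star {α β : Type*} [Fintype α] [Fintype β]
    (hρ : ρ ∈ Irr (U n)) {g V : U n} {x : Fin n → Circle}
    (hg : (g : Matrix (Fin n) (Fin n) ℂ) =
      V * diagonal (fun i => (x i : ℂ)) * star (V : Matrix (Fin n) (Fin n) ℂ))
    (e : α ⊕ β ≃ Fin n) :
    ‖ρ g‖ * crossNorm (fun s => (x (e s) : ℂ)) ≤
      (n : ℝ) ^ (2 * (Fintype.card α * Fintype.card β)) *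
        degree ρ ^ (1 - (Fintype.card α * Fintype.card β : ℝ) / n ^ 2) := by
  classical
  obtain ⟨m, π, hirr, hπ, rfl⟩ := hρ
  obtain ⟨N, P, hP, htrace⟩ := exists_isPolyRep hirr hπ
  have hdet : ‖(g : Matrix (Fin n) (Fin n) ℂ).det‖ = 1 :=
    CStarRing.norm_of_mem_unitary (det_of_mem_unitary g.2)
  have hnorm : ‖π.character g‖ = ‖(polyEval P (diagonal fun i => (x i : ℂ))).trace‖ := by
    rw [← hP.trace_conj (Unitary.coe_star_mul_self V), ← hg, ← htrace, norm_mul, norm_pow, hdet,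
      one_pow, one_mul]
  have hdegree : degree π.character = m := by simp [degree]
  simpa only [hnorm, hdegree, Fintype.card_fin] using hP.norm_trace_mul_crossNorm_le e x

theorem card_add_card_of_add_eq_eigenvalues {g : U n} {Q R : Multiset ℂ}
    (hQR : Q + R = eigenvalues g) : Q.card + R.card = n := by
  rw [← Multiset.card_add, hQR, eigenvalues,
    IsAlgClosed.card_roots_eq_natDegree, charpoly_natDegree_eq_dim, Fintype.card_fin]

theorem norm_mul_pow_card_mul_card_le (hρ : ρ ∈ Irr (U n)) {g : U n} {Q R : Multiset ℂ}
    (hQR : Q + R = eigenvalues g) {ε : ℝ} (hε : 0 ≤ ε) (hsep : ∀ a ∈ Q, ∀ b ∈ R, ε ≤ ‖a - b‖) :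
    ‖ρ g‖ * ε ^ (Q.card * R.card) ≤
      (n : ℝ) ^ (2 * (Q.card * R.card)) * degree ρ ^ (1 - (Q.card * R.card : ℝ) / n ^ 2) := by
  obtain ⟨V, x, hg⟩ := exists_eq_mul_diagonal_mul_star g.2
  rw [eigenvalues_eq_map_of_eq_mul_diagonal_mul_star hg] at hQR
  obtain ⟨t, rfl, rfl⟩ := exists_finset_map_val_eq hQR
  let e : t ⊕ (tᶜ : Finset (Fin n)) ≃ Fin n := (Equiv.sumCongr (Equiv.refl _)
    (Equiv.subtypeEquivRight fun _ => Finset.mem_compl)).trans (Equiv.sumCompl (· ∈ t))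
  have hcross : ε ^ (t.card * tᶜ.card) ≤ crossNorm fun s => (x (e s) : ℂ) := by
    rw [← Fintype.card_coe t, ← Fintype.card_coe tᶜ]
    exact pow_le_crossNorm hε fun i k => hsep _ (Multiset.mem_map_of_mem _ i.2) _
      (Multiset.mem_map_of_mem _ k.2)
  have hbound := norm_mul_crossNorm_le_of_eq_mul_diagonal_mul_star hρ hg e
  simp only [Fintype.card_coe] at hbound
  simp only [Multiset.card_map, Finset.card_val]
  exact (mul_le_mul_of_nonneg_left hcross (norm_nonneg _)).trans hbound

theorem two_rpow_mul_logb {a x : ℝ} (hx : 0 < x) : (2 : ℝ) ^ (a * Real.logb 2 x) = x ^ a := by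
  rw [mul_comm, Real.rpow_mul two_pos.le, Real.rpow_logb two_pos (by norm_num) hx]

theorem mul_one_sub_le_mul_div_sq {a b γ : ℝ} (hab : 0 < a + b) (ha : γ * (a + b) ≤ a)
    (hb : γ * (a + b) ≤ b) : γ * (1 - γ) ≤ a * b / (a + b) ^ 2 := by
  rw [le_div_iff₀ (by positivity)]
  linear_combination mul_nonneg (sub_nonneg.mpr ha) (sub_nonneg.mpr hb)

theorem le_rpow_of_mul_rpow_le {y d γ t : ℝ} (hd : 1 ≤ d) (hγ : 0 < γ) (hγ' : γ < 1 / 2)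
    (ht : γ * (1 - γ) ≤ t)
    (h : y * d ^ (-(γ * (1 - γ)) * t) ≤ d ^ (γ / 2 * t) * d ^ (1 - t)) :
    y ≤ d ^ (1 - γ * (1 - γ) / 2) := by
  have hd_pos : 0 < d := zero_lt_one.trans_le hd
  have hexp : γ / 2 * t + (1 - t) - -(γ * (1 - γ)) * t ≤ 1 - γ * (1 - γ) / 2 := by
    have hγ_sub : 0 < γ * (1 - γ) := mul_pos hγ (by linarith)
    have hfactor : γ * (1 - γ) + γ / 2 ≤ 1 / 2 := by
      linear_combination mul_nonneg (by linarith : 0 ≤ 1 / 2 - γ) (by linarith : 0 ≤ 1 - γ)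
    nlinarith
  refine le_trans ?_ (Real.rpow_le_rpow_of_exponent_le hd hexp)
  rwa [Real.rpow_sub hd_pos, le_div_iff₀ (by positivity), Real.rpow_add hd_pos]

theorem natCast_pow_le_rpow {d γ : ℝ} (hn : 0 < n) (hγ : 0 < γ)
    (hd : (n : ℝ) ^ (4 / γ * n ^ 2) ≤ d) (k : ℕ) :
    (n : ℝ) ^ (2 * k) ≤ d ^ (γ / 2 * (k / n ^ 2)) :=
  calc (n : ℝ) ^ (2 * k) = ((n : ℝ) ^ (4 / γ * n ^ 2)) ^ (γ / 2 * (k / n ^ 2)) := by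
        rw [← Real.rpow_mul n.cast_nonneg, ← Real.rpow_natCast]
        congr 1
        push_cast
        field_simp
        ring
    _ ≤ d ^ (γ / 2 * (k / n ^ 2)) := Real.rpow_le_rpow (by positivity) hd (by positivity)

theorem norm_le_of_isSeparated (hn : 0 < n) (hρ : ρ ∈ Irr (U n)) {g : U n} {γ : ℝ} (hγ : 0 < γ)
    (hγ' : γ < 1 / 2) (hdegree : (n : ℝ) ^ (4 / γ * n ^ 2) ≤ degree ρ)
    (hg : IsSeparated γ (degree ρ ^ (-(γ * (1 - γ)) / (n : ℝ) ^ 2)) g) :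
    ‖ρ g‖ ≤ degree ρ ^ (1 - γ * (1 - γ) / 2) := by
  obtain ⟨Q, R, hQR, hQ, hR, hdist⟩ := hg
  have hd := one_le_degree hρ
  have hbound := norm_mul_pow_card_mul_card_le hρ hQR (by positivity) hdist
  have hcard : (n : ℝ) = Q.card + R.card := by
    exact_mod_cast (card_add_card_of_add_eq_eigenvalues hQR).symm
  have hn_pos : (0 : ℝ) < Q.card + R.card := hcard ▸ Nat.cast_pos.mpr hn
  have hratio : γ * (1 - γ) ≤ (Q.card * R.card : ℝ) / n ^ 2 := by
    rw [hcard] at hQ hR ⊢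
    exact mul_one_sub_le_mul_div_sq hn_pos hQ hR
  have hpow := natCast_pow_le_rpow hn hγ hdegree (Q.card * R.card)
  push_cast at hpow
  have hε : (degree ρ ^ (-(γ * (1 - γ)) / (n : ℝ) ^ 2)) ^ (Q.card * R.card) =
      degree ρ ^ (-(γ * (1 - γ)) * ((Q.card * R.card : ℝ) / n ^ 2)) := by
    rw [← Real.rpow_natCast, ← Real.rpow_mul (by positivity)]
    push_cast
    ring_nf
  rw [hε] at hbound
  exact le_rpow_of_mul_rpow_le hd hγ hγ' hratio
    (hbound.trans (mul_le_mul_of_nonneg_right hpow (by positivity)))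

end SeparatedSpectrum

end UnitaryChar

/-! ### Spread spectrum -/

namespace UnitaryChar

open Matrix Real

section Pigeonhole

variable {ι α : Type*} [Fintype ι]

/-- The intervals with `j ≤ card ι` are disjoint and outnumber the points. -/
theorem exists_forall_notMem_Ioc (f : ι → ℝ) (s : ℝ) {δ : ℝ} (hδ : 0 < δ) :
    ∃ j ≤ Fintype.card ι, ∀ i, f i ∉ Set.Ioc (s + j * δ) (s + (j + 1) * δ) := by
  let indices := Finset.univ.image fun i => ⌈(f i - s) / δ⌉₊ - 1
  have hcard : indices.card < (Finset.range (Fintype.card ι + 1)).card :=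
    (Finset.card_image_le.trans_eq Finset.card_univ).trans_lt (by simp)
  obtain ⟨j, hj, hj_notMem⟩ := Finset.exists_mem_notMem_of_card_lt_card hcard
  refine ⟨j, Nat.lt_succ_iff.mp (Finset.mem_range.mp hj), fun i hi => hj_notMem ?_⟩
  have hceil : ⌈(f i - s) / δ⌉₊ = j + 1 := by
    rw [Nat.ceil_eq_iff j.succ_ne_zero, Nat.succ_sub_one, lt_div_iff₀ hδ, div_le_iff₀ hδ]
    push_cast
    exact ⟨by linarith [hi.1], by linarith [hi.2]⟩
  exact Finset.mem_image.mpr ⟨i, Finset.mem_univ i, by rw [hceil, Nat.add_sub_cancel]⟩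

theorem exists_quantile [LinearOrder α] (f : ι → α) {c : ℝ} (hc : 0 < c)
    (hc' : c ≤ Fintype.card ι) :
    ∃ s, c ≤ (Finset.univ.filter fun i => f i ≤ s).card ∧
      ((Finset.univ.filter fun i => f i < s).card : ℝ) < c := by
  have : Nonempty ι := Fintype.card_pos_iff.mp (Nat.cast_pos.mp (hc.trans_le hc'))
  let S := Finset.univ.filter fun i => c ≤ (Finset.univ.filter fun k => f k ≤ f i).card
  have hS_nonempty : S.Nonempty := by
    obtain ⟨i, hi⟩ := Finite.exists_max f
    refine ⟨i, Finset.mem_filter.mpr ⟨Finset.mem_univ i, ?_⟩⟩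
    rwa [Finset.filter_true_of_mem fun k _ => hi k, Finset.card_univ]
  obtain ⟨i, hiS, hi_min⟩ := Finset.exists_min_image S f hS_nonempty
  refine ⟨f i, (Finset.mem_filter.mp hiS).2, ?_⟩
  by_contra! hcard
  have hbelow_nonempty : (Finset.univ.filter fun k => f k < f i).Nonempty :=
    Finset.card_pos.mp (Nat.cast_pos.mp (hc.trans_le hcard))
  obtain ⟨k, hk, hk_max⟩ := Finset.exists_max_image _ f hbelow_nonempty
  have hkS : k ∈ S := by
    refine Finset.mem_filter.mpr ⟨Finset.mem_univ k, hcard.trans (Nat.cast_le.mpr ?_)⟩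
    exact Finset.card_le_card fun l hl => by simpa using hk_max l hl
  exact (Finset.mem_filter.mp hk).2.not_ge (hi_min k hkS)

end Pigeonhole

section CircleAngles

theorem norm_exp_sub_exp (a b : ℝ) :
    ‖(Circle.exp a : ℂ) - Circle.exp b‖ = 2 * |sin ((b - a) / 2)| := by
  have hfactor : (Circle.exp a : ℂ) - Circle.exp b =
      -(Circle.exp a * (Complex.exp (Complex.I * ((b - a : ℝ) : ℂ)) - 1)) := by
    rw [mul_sub, Circle.coe_exp, Circle.coe_exp, ← Complex.exp_add]
    push_cast
    ring_nf
  rw [hfactor, norm_neg, norm_mul, Circle.norm_coe, one_mul,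
    Complex.norm_exp_I_mul_ofReal_sub_one, norm_mul, Real.norm_ofNat, Real.norm_eq_abs]

theorem two_mul_sin_le_norm_exp_sub_exp {a b y : ℝ} (hy : 0 ≤ y) (hle : 2 * y ≤ b - a)
    (hge : b - a ≤ 2 * π - 2 * y) : 2 * sin y ≤ ‖(Circle.exp a : ℂ) - Circle.exp b‖ := by
  have hsin : sin y ≤ sin ((b - a) / 2) := by
    rcases le_total ((b - a) / 2) (π / 2) with h | h
    · exact sin_le_sin_of_le_of_le_pi_div_two (by linarith [pi_pos]) h (by linarith)
    · rw [← sin_pi_sub ((b - a) / 2)]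
      exact sin_le_sin_of_le_of_le_pi_div_two (by linarith [pi_pos]) (by linarith) (by linarith)
  rw [norm_exp_sub_exp]
  exact mul_le_mul_of_nonneg_left (hsin.trans (le_abs_self _)) two_pos.le

theorem sq_le_two_mul_sin {n ε : ℝ} (hn : 2 ≤ n) (hε : 0 ≤ ε) (hεn : ε * n ≤ 1) :
    ε ^ 2 ≤ 2 * sin (ε / (n + 1)) := by
  set y := ε / (n + 1) with hy
  have hy_nonneg : 0 ≤ y := by positivity
  have hε_eq : ε = y * (n + 1) := by rw [hy]; field_simp
  have hε_le : ε ≤ 1 / 2 := by nlinarith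
  have hy_le_one : y ≤ 1 := by nlinarith
  have hsq : ε ^ 2 ≤ y * (3 / 2) :=
    calc ε ^ 2 = y * (ε * (n + 1)) := by rw [hε_eq]; ring
      _ ≤ y * (3 / 2) := mul_le_mul_of_nonneg_left (by linarith) hy_nonneg
  have hcube : y ^ 3 ≤ y := pow_le_of_le_one hy_nonneg hy_le_one three_ne_zero
  linarith [sin_ge_sub_cube hy_nonneg]

theorem sq_le_norm_exp_sub_exp {n ε a b : ℝ} (hn : 2 ≤ n) (hε : 0 ≤ ε) (hεn : ε * n ≤ 1)
    (hle : 2 * ε / (n + 1) ≤ b - a) (hge : b - a ≤ 2 * π - 2 * π / (n + 1)) :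
    ε ^ 2 ≤ ‖(Circle.exp a : ℂ) - Circle.exp b‖ := by
  have hεπ : ε / (n + 1) ≤ π / (n + 1) := by
    gcongr
    nlinarith [pi_gt_three]
  rw [mul_div_assoc] at hle hge
  exact (sq_le_two_mul_sin hn hε hεn).trans
    (two_mul_sin_le_norm_exp_sub_exp (by positivity) hle (by linarith))

theorem exists_angle_mem_Icc {z : Circle} {t δ : ℝ} (hz : (z : ℂ).arg ∉ Set.Ioc (t - δ) t)
    (ht : t ≤ π) (ht' : -π ≤ t - δ) : ∃ φ ∈ Set.Icc t (t - δ + 2 * π), Circle.exp φ = z := by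
  have harg_gt := Complex.neg_pi_lt_arg (z : ℂ)
  have harg_le := Complex.arg_le_pi (z : ℂ)
  rcases lt_or_ge t (z : ℂ).arg with h | h
  · exact ⟨_, ⟨h.le, by linarith⟩, Circle.exp_arg z⟩
  · have harg_le' : (z : ℂ).arg ≤ t - δ := not_lt.mp fun h' => hz ⟨h', h⟩
    exact ⟨(z : ℂ).arg + 2 * π, ⟨by linarith, by linarith⟩,
      by rw [Circle.exp_add, Circle.exp_arg, Circle.exp_two_pi, mul_one]⟩

/-- Finitely many points miss one of the `card ι + 1` equal arcs of the circle, which is then cut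
there. -/
theorem exists_angles {ι : Type*} [Fintype ι] (x : ι → Circle) :
    ∃ φ : ι → ℝ, (∀ i, Circle.exp (φ i) = x i) ∧
      ∀ i k, φ i - φ k ≤ 2 * π - 2 * π / (Fintype.card ι + 1) := by
  set δ := 2 * π / (Fintype.card ι + 1 : ℝ) with hδ
  have hδ_pos : 0 < δ := by positivity
  have hδ_mul : (Fintype.card ι + 1) * δ = 2 * π := by rw [hδ]; field_simp
  obtain ⟨j, hj, hgap⟩ := exists_forall_notMem_Ioc (fun i => (x i : ℂ).arg) (-π) hδ_pos
  have hj_le : ((j : ℝ) + 1) * δ ≤ (Fintype.card ι + 1) * δ := by gcongr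
  have hj_nonneg : 0 ≤ j * δ := by positivity
  have hsub : -π + (j + 1) * δ - δ = -π + j * δ := by ring
  choose φ hφ hφ_exp using fun i => exists_angle_mem_Icc (z := x i) (t := -π + (j + 1) * δ) (δ := δ)
    (by rw [hsub]; exact hgap i) (by linarith) (by linarith)
  exact ⟨φ, hφ_exp, fun i k => by linarith [(hφ i).2, (hφ k).1]⟩

end CircleAngles

section SpreadSpectrum

variable {n : ℕ} {g : U n}

theorem isSeparated_of_le_norm_sub {x : Fin n → ℂ} (hx : eigenvalues g = Finset.univ.val.map x)
    {γ ε : ℝ} {t : Finset (Fin n)} (ht : γ * n ≤ t.card) (ht' : γ * n ≤ tᶜ.card)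
    (h : ∀ i ∈ t, ∀ k ∈ tᶜ, ε ≤ ‖x i - x k‖) : IsSeparated γ ε g := by
  refine ⟨t.val.map x, tᶜ.val.map x, ?_, by simpa using ht, by simpa using ht', ?_⟩
  · rw [hx, ← Multiset.map_add, Finset.compl_eq_univ_sdiff, Finset.sdiff_val,
      add_tsub_cancel_of_le (Finset.val_le_iff.mpr (Finset.subset_univ t))]
  · simp only [Multiset.mem_map, Finset.mem_val]
    rintro _ ⟨i, hi, rfl⟩ _ ⟨k, hk, rfl⟩
    exact h i hi k hk

theorem IsSpread.add_two_mul_lt {γ ε s s' : ℝ} (hg : IsSpread (2 * γ) ε g) {φ : Fin n → ℝ}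
    (hφ : eigenvalues g = Finset.univ.val.map fun i => (Circle.exp (φ i) : ℂ))
    (hs : ((Finset.univ.filter fun i => φ i < s).card : ℝ) < γ * n)
    (hs' : ((Finset.univ.filter fun i => s' < φ i).card : ℝ) < γ * n) : s + 2 * ε < s' := by
  classical
  by_contra! hle
  let inArc := Finset.univ.filter fun i => (Circle.exp (φ i) : ℂ) ∈ arc s (2 * ε)
  have hcount : (inArc.card : ℝ) ≤ (1 - 2 * γ) * n := by
    convert hg s
    rw [hφ, Multiset.countP_map]
    rfl
  have hcover : Finset.univ ⊆ inArc ∪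
      ((Finset.univ.filter fun i => φ i < s) ∪ Finset.univ.filter fun i => s' < φ i) := by
    intro i _
    simp only [inArc, Finset.mem_union, Finset.mem_filter, Finset.mem_univ, true_and]
    by_contra! hi
    exact hi.1 ⟨φ i, ⟨hi.2.1, hi.2.2.trans hle⟩, (Circle.coe_exp _).symm⟩
  have hcard := (Finset.card_le_card hcover).trans ((Finset.card_union_le _ _).trans
    (Nat.add_le_add_left (Finset.card_union_le _ _) _))
  rw [Finset.card_univ, Fintype.card_fin] at hcard
  have hcard_real := Nat.cast_le (α := ℝ).mpr hcard
  push_cast at hcard_real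
  linarith

/-- Between the lower and the upper `γ`-quantile of the angles of the eigenvalues there is room for
`n + 1` intervals of length `2 ε / (n + 1)`, one of which contains no angle. -/
theorem IsSpread.isSeparated (hn : 2 ≤ n) {γ ε : ℝ} (hγ : 0 < γ) (hγ' : γ ≤ 1) (hε : 0 < ε)
    (hεn : ε * n ≤ 1) (hg : IsSpread (2 * γ) ε g) : IsSeparated γ (ε ^ 2) g := by
  obtain ⟨V, x, hVx⟩ := exists_eq_mul_diagonal_mul_star g.2
  obtain ⟨φ, hφ, hrange⟩ := exists_angles x
  have heig := eigenvalues_eq_map_of_eq_mul_diagonal_mul_star hVx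
  simp only [← hφ] at heig
  have hγn_pos : 0 < γ * n := by positivity
  have hγn_le : γ * n ≤ Fintype.card (Fin n) := by
    rw [Fintype.card_fin]
    exact mul_le_of_le_one_left n.cast_nonneg hγ'
  obtain ⟨s, hs_le, hs_lt⟩ := exists_quantile φ hγn_pos hγn_le
  obtain ⟨s', hs'_le, hs'_lt⟩ : ∃ s' : ℝ, γ * n ≤ (Finset.univ.filter fun i => s' ≤ φ i).card ∧
      ((Finset.univ.filter fun i => s' < φ i).card : ℝ) < γ * n :=
    exists_quantile (OrderDual.toDual ∘ φ) hγn_pos hγn_le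
  have hwide : s + 2 * ε < s' := hg.add_two_mul_lt heig hs_lt hs'_lt
  set δ := 2 * ε / (n + 1 : ℝ) with hδ
  have hδ_pos : 0 < δ := by positivity
  obtain ⟨j, hj, hgap⟩ := exists_forall_notMem_Ioc φ s hδ_pos
  rw [Fintype.card_fin] at hj
  have hδ_mul : (n + 1) * δ = 2 * ε := by rw [hδ]; field_simp
  have hj_le : ((j : ℝ) + 1) * δ ≤ (n + 1) * δ := by gcongr
  have hj_nonneg : 0 ≤ j * δ := by positivity
  refine isSeparated_of_le_norm_sub heig (t := Finset.univ.filter fun i => φ i ≤ s + j * δ)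
    (hs_le.trans ?_) (hs'_le.trans ?_) fun i hi k hk => ?_
  · gcongr
    linarith
  · simp only [Finset.compl_filter, not_le]
    gcongr
    linarith
  · simp only [Finset.compl_filter, Finset.mem_filter, Finset.mem_univ, true_and, not_le] at hi hk
    have hk_gt : s + (j + 1) * δ < φ k := not_le.mp fun hk_le => hgap k ⟨hk, hk_le⟩
    have hrange_ki := hrange k i
    rw [Fintype.card_fin] at hrange_ki
    exact sq_le_norm_exp_sub_exp (by exact_mod_cast hn) hε.le hεn (by linarith) hrange_ki

theorem norm_le_of_isSpread (hn : 2 ≤ n) {ρ : U n → ℂ} (hρ : ρ ∈ Irr (U n)) {γ : ℝ} (hγ : 0 < γ)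
    (hγ' : γ < 1 / 2) (hdegree : (n : ℝ) ^ (4 / γ * n ^ 2) ≤ degree ρ)
    (hg : IsSpread (2 * γ) (degree ρ ^ (-(γ * (1 - γ) / 2) / (n : ℝ) ^ 2)) g) :
    ‖ρ g‖ ≤ degree ρ ^ (1 - γ * (1 - γ) / 2) := by
  have hn_pos : 0 < n := by lia
  have hdegree_pos : 0 < degree ρ := zero_lt_one.trans_le (one_le_degree hρ)
  have hγ_sub : 0 < 1 - γ := by linarith
  have hle : (n : ℝ) ≤ degree ρ ^ (γ * (1 - γ) / 2 / (n : ℝ) ^ 2) :=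
    calc (n : ℝ) ≤ (n : ℝ) ^ (2 * (1 - γ)) :=
          Real.self_le_rpow_of_one_le (Nat.one_le_cast.mpr hn_pos) (by linarith)
      _ = ((n : ℝ) ^ (4 / γ * (n : ℝ) ^ 2)) ^ (γ * (1 - γ) / 2 / (n : ℝ) ^ 2) := by
          rw [← Real.rpow_mul n.cast_nonneg]
          congr 1
          field_simp
          norm_num
      _ ≤ _ := Real.rpow_le_rpow (by positivity) hdegree (by positivity)
  have hmul_le : degree ρ ^ (-(γ * (1 - γ) / 2) / (n : ℝ) ^ 2) * n ≤ 1 := by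
    rwa [neg_div, Real.rpow_neg hdegree_pos.le, inv_mul_le_one₀ (by positivity)]
  have hsq : (degree ρ ^ (-(γ * (1 - γ) / 2) / (n : ℝ) ^ 2)) ^ 2 =
      degree ρ ^ (-(γ * (1 - γ)) / (n : ℝ) ^ 2) := by
    rw [← Real.rpow_natCast, ← Real.rpow_mul hdegree_pos.le]
    push_cast
    ring_nf
  have hseparated := hg.isSeparated hn hγ (by linarith) (by positivity) hmul_le
  rw [hsq] at hseparated
  exact norm_le_of_isSeparated hn_pos hρ hγ hγ' hdegree hseparated

end SpreadSpectrum

end UnitaryChar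

theorem mainTheorem4 (n : ℕ) (hn : 2 ≤ n)
    (ρ : UnitaryChar.U n → ℂ) (hρ : ρ ∈ UnitaryChar.Irr (UnitaryChar.U n))
    (g : UnitaryChar.U n) :
    (∀ γ : ℝ, 0 < γ → γ < 1 / 2 →
      UnitaryChar.degree ρ > (2 : ℝ) ^ (16 / γ * (n : ℝ) ^ 2 * Real.logb 2 n) →
      UnitaryChar.IsSeparated γ
        (UnitaryChar.degree ρ ^ (-(γ * (1 - γ)) / (n : ℝ) ^ 2)) g →
      ‖ρ g‖ ≤ UnitaryChar.degree ρ ^ (1 - γ * (1 - γ) / 2)) ∧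
    (∀ β : ℝ, 0 < β → β < 1 →
      UnitaryChar.degree ρ > (2 : ℝ) ^ (8 / β * (n : ℝ) ^ 2 * Real.logb 2 n) →
      UnitaryChar.IsSpread β
        (UnitaryChar.degree ρ ^ (-(1 / 8 * (β * (2 - β))) / (n : ℝ) ^ 2)) g →
      ‖ρ g‖ ≤ UnitaryChar.degree ρ ^ (1 - β * (2 - β) / 8)) := by
  have hn_pos : 0 < n := by lia
  simp only [UnitaryChar.two_rpow_mul_logb (Nat.cast_pos.mpr hn_pos), gt_iff_lt]
  refine ⟨fun γ hγ hγ' hdegree hg => ?_, fun β hβ hβ' hdegree hg => ?_⟩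
  · refine UnitaryChar.norm_le_of_isSeparated hn_pos hρ hγ hγ' (le_trans ?_ hdegree.le) hg
    have hone_le : (1 : ℝ) ≤ n := Nat.one_le_cast.mpr hn_pos
    gcongr
    norm_num
  · obtain ⟨γ, rfl⟩ : ∃ γ, β = 2 * γ := ⟨β / 2, by ring⟩
    have hdiv : 8 / (2 * γ) = 4 / γ := by ring
    have hexp : 1 / 8 * (2 * γ * (2 - 2 * γ)) = γ * (1 - γ) / 2 := by ring
    have hexp' : 2 * γ * (2 - 2 * γ) / 8 = γ * (1 - γ) / 2 := by ring
    rw [hdiv] at hdegree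
    rw [hexp] at hg
    rw [hexp']
    exact UnitaryChar.norm_le_of_isSpread hn hρ (by linarith) (by linarith) hdegree.le hg
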